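/- **Setting.** Let $(M,g)$ be a connected complete Riemannian manifold with Levi-Civita connection $\nabla$ and curvature $R_{X,Y}=[\nabla_X,\nabla_Y]-\nabla_{[X,Y]}$. Let $\bar\nabla$ be an Ambrose–Singer connection on $M$, i.e. a metric connection with $\bar\nabla$-parallel torsion and $\bar\nabla$-parallel curvature. Assume that $(M,g,\bar\nabla)$ is naturally reductive: the tensor $\tau$ defined by $\bar\nabla_XY=\nabla_XY+\frac12\tau_XY$ is totally skew-symmetric, i.e. $\langle\tau_XY,Z\rangle$ is a $3$-form. For $k\ge 0$ put $\mathscr R_k(X)U:=(\nabla^k_{X,\dots,X}R)_{U,X}X$ and $\mathscr R_X:=\mathscr R_0(X)$ (the Jacobi operator). A monic real polynomial $P(\lambda)=\lambda^{N}+a_2\lambda^{N-2}+a_4\lambda^{N-4}+\cdots$ is said to define a *linear Jacobi relation* if $$\mathscr R_{N}(X)=-a_2\|X\|^2\mathscr R_{N-2}(X)-a_4\|X\|^4\mathscr R_{N-4}(X)-\cdots\qquad\text{for all tangent vectors } X;$$ for $N=d+1$, $d\ge0$, this is a linear Jacobi relation of order $d$. For a tangent vector $X$ let $\mathscr T_X$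 be the operator $\mathscr T_X\mathscr R:=\frac12(\mathscr R\,\tau_X-\tau_X\,\mathscr R)$ on endomorphisms, and write $P(\mathscr T)\mathscr R\equiv0$ if $P(\mathscr T_X)\mathscr R_X=0$ for all unit tangent vectors $X$ of $M$. **Decomposition.** Let $p\in M$ and let $U$ be a non-empty open connected subset of the unit sphere of $T_pM$ on which the distinct non-zero eigenvalues $0<\lambda_1^2(X)<\dots<\lambda_m^2(X)$ of $-\tau_X^2$ are well defined continuous functions of $X\in U$ (with $m$ independent of $X$ and $\lambda_k>0$). For $X\in U$ let $V_0=\ker\tau_X$, let $V_k$ be the $\lambda_k^2(X)$-eigenspace of $-\tau_X^2$, let $\pi_k$ be the orthogonal projection onto $V_k$ ($0\le k\le m$), and let $J=\bigoplus_{k\ge1}\frac1{\lambda_k}\tau_X|_{V_k}$. Put $$\mathscr R^{k,\ell}=\pi_\ell\mathscr R_X\pi_k+\pi_k\mathscr R_X\pi_\ell\quad(0\le k<\ell\le m),\qquad \mathscr R^{k,k}=\pi_k\mathscr R_X\pi_k,$$ and for $1\le k\le\ell$ $$\mathscr R^{k,\ell}_{(1,1)}=\tfrac12(\mathscr R^{k,\ell}-J\mathscr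 R^{k,\ell}J),\qquad \mathscr R^{k,\ell}_{(2,0)+(0,2)}=\tfrac12(\mathscr R^{k,\ell}+J\mathscr R^{k,\ell}J).$$ All of these depend on $X\in U$; "constant" and "$\equiv0$" below refer to $X\in U$. **Proposition.** (a) There exists a linear Jacobi relation (of some order $d\ge 0$) on $M$ if and only if the following three conditions hold: 1. for every $k\ge1$: $\lambda_k$ is constant, or $\mathscr R^{k,k}_{(2,0)+(0,2)}\equiv\mathscr R^{0,k}\equiv0$; 2. for all $1\le k<\ell$: $\lambda_\ell-\lambda_k$ is constant, or $\mathscr R^{k,\ell}_{(1,1)}\equiv0$; 3. for all $1\le k<\ell$: $\lambda_k+\lambda_\ell$ is constant, or $\mathscr R^{k,\ell}_{(2,0)+(0,2)}\equiv0$. (b) In this case let $Q(\lambda)$ be the (monic) least common multiple of the polynomials - $\lambda^2+\frac14(\lambda_k-\lambda_\ell)^2$ with $1\le k<\ell$ and $\mathscr R^{k,\ell}_{(1,1)}\not\equiv0$, - $\lambda^2+\frac14(\lambda_k+\lambda_\ell)^2$ with $1\le k\le\ell$ and $\mathscr R^{k,\ell}_{(2,0)+(0,2)}\not\equiv0$,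 - $\lambda^2+\frac14\lambda_k^2$ with $1\le k$ and $\mathscr R^{0,k}\not\equiv0$. Then $P(\lambda):=\lambda\,Q(\lambda)$ defines a linear Jacobi relation, and $P(\mathscr T)\mathscr R\equiv0$. Moreover the only possible linear Jacobi relation of smaller degree is $Q(\mathscr T)\mathscr R\equiv0$: if a monic polynomial $P'$ of degree less than $\deg P$ defines a linear Jacobi relation, then $P'=Q$ and $Q(\mathscr T)\mathscr R\equiv0$. -/

import Mathlib

open Bundle
open scoped Manifold ContDiff

noncomputable section

/-! ### Linear algebra of a skew-symmetric endomorphism of a Euclidean space -/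

section LinearAlgebra

variable {V : Type*} [NormedAddCommGroup V] [InnerProductSpace ℝ V] [FiniteDimensional ℝ V]

/-- The operator `R ↦ (R ∘ A - A ∘ R) / 2`, i.e. `-1/2` times the natural action `A ⋆ R = [A, R]`
of `A` on endomorphisms. -/
def halfCommutator (A : Module.End ℝ V) : Module.End ℝ (Module.End ℝ V) :=
  (1 / 2 : ℝ) • (LinearMap.mulRight ℝ A - LinearMap.mulLeft ℝ A)

/-- The orthogonal projection `π_0` onto `V_0 = ker A`. -/
def kerProj (A : Module.End ℝ V) : Module.End ℝ V :=
  ((LinearMap.ker A).starProjection : V →L[ℝ] V).toLinearMap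

/-- The orthogonal projection onto the eigenspace of `-A²` for the eigenvalue `c²`. -/
def eigProj (A : Module.End ℝ V) (c : ℝ) : Module.End ℝ V :=
  ((Module.End.eigenspace (-(A * A)) (c ^ 2)).starProjection : V →L[ℝ] V).toLinearMap

/-- The complex structure `J_A = ⨁ₖ (1 / λₖ) A|_{Vₖ}` on `V_{≥ 1}`, extended by zero to `ker A`.
Here `l` lists the numbers `λₖ > 0` whose squares are the nonzero eigenvalues of `-A²`. -/
def complexStr (A : Module.End ℝ V) {m : ℕ} (l : Fin m → ℝ) : Module.End ℝ V :=
  ∑ k, (l k)⁻¹ • (A * eigProj A (l k))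

/-- The component `R^{0,k}`, where `c = λₖ`, extended by zero to all of `V`. -/
def zeroBlock (A R : Module.End ℝ V) (c : ℝ) : Module.End ℝ V :=
  eigProj A c * R * kerProj A + kerProj A * R * eigProj A c

/-- The component `R^{k,j}` (`k, j ≥ 1`), extended by zero to all of `V`: for `k ≠ j` it is given by
`⟨R^{k,j} u, v⟩ = ⟨R πₖ u, πⱼ v⟩ + ⟨R πⱼ u, πₖ v⟩`, and `R^{k,k}` is the restriction of `R` to `Vₖ`
as a bilinear form. -/
def block (A R : Module.End ℝ V) {m : ℕ} (l : Fin m → ℝ) (k j : Fin m) : Module.End ℝ V :=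
  if k = j then eigProj A (l k) * R * eigProj A (l k)
  else eigProj A (l j) * R * eigProj A (l k) + eigProj A (l k) * R * eigProj A (l j)

/-- The component `R^{k,j}_{(1,1)} = (R^{k,j} - J_A R^{k,j} J_A) / 2`. -/
def block11 (A R : Module.End ℝ V) {m : ℕ} (l : Fin m → ℝ) (k j : Fin m) : Module.End ℝ V :=
  (1 / 2 : ℝ) • (block A R l k j - complexStr A l * block A R l k j * complexStr A l)

/-- The component `R^{k,j}_{(2,0)+(0,2)} = (R^{k,j} + J_A R^{k,j} J_A) / 2`. -/
def block20 (A R : Module.End ℝ V) {m : ℕ} (l : Fin m → ℝ) (k j : Fin m) : Module.End ℝ V :=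
  (1 / 2 : ℝ) • (block A R l k j + complexStr A l * block A R l k j * complexStr A l)

end LinearAlgebra

/-- `Q` is the (monic) least common multiple of the polynomials in `F`. -/
def IsMonicLcm (F : Set (Polynomial ℝ)) (Q : Polynomial ℝ) : Prop :=
  Q.Monic ∧ ∀ S : Polynomial ℝ, Q ∣ S ↔ ∀ f ∈ F, f ∣ S

/-! ### Connections, tensors and curvature on a manifold -/

section Manifold

/-- (Not necessarily continuous) vector fields on `M`. -/
abbrev VecField (E : Type*) [NormedAddCommGroup E] [NormedSpace ℝ E]
    (M : Type*) [TopologicalSpace M] [ChartedSpace E M] : Type _ :=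
  Π x : M, TangentSpace 𝓘(ℝ, E) x

/-- Connections on the tangent bundle of `M`. For such a `nabla`, the vector `nabla Y x v` is
`∇_v Y` at the point `x`. -/
abbrev Connection (E : Type*) [NormedAddCommGroup E] [NormedSpace ℝ E]
    (M : Type*) [TopologicalSpace M] [ChartedSpace E M] [IsManifold 𝓘(ℝ, E) ∞ M] : Type _ :=
  CovariantDerivative 𝓘(ℝ, E) E (fun x : M => TangentSpace 𝓘(ℝ, E) x)

variable {E : Type*} [NormedAddCommGroup E] [NormedSpace ℝ E]
  {M : Type*} [TopologicalSpace M] [ChartedSpace E M]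

instance tangentSpace_finiteDimensional [FiniteDimensional ℝ E] (x : M) :
    FiniteDimensional ℝ (TangentSpace 𝓘(ℝ, E) x) :=
  inferInstanceAs (FiniteDimensional ℝ E)

variable [IsManifold 𝓘(ℝ, E) ∞ M]

/-- Smoothness of a vector field. -/
def IsSmoothField (X : VecField E M) : Prop :=
  CMDiff ∞ (T% X)

/-- The vector field `∇_X Y`. -/
def Connection.along (nabla : Connection E M) (X Y : VecField E M) : VecField E M :=
  fun x => nabla Y x (X x)

/-- The curvature `R(X, Y) Z = ∇_X ∇_Y Z - ∇_Y ∇_X Z - ∇_{[X, Y]} Z` on vector fields. -/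
def Connection.curv (nabla : Connection E M) (X Y Z : VecField E M) : VecField E M :=
  nabla.along X (nabla.along Y Z) - nabla.along Y (nabla.along X Z)
    - nabla.along (VectorField.mlieBracket 𝓘(ℝ, E) X Y) Z

/-- The covariant derivative `∇S` of a `TM`-valued tensor `S` with `m` arguments, as an operation on
vector fields: `(∇S)(Y₀; Y₁, …, Yₘ) = ∇_{Y₀} (S(Y₁, …, Yₘ)) - ∑ᵢ S(Y₁, …, ∇_{Y₀} Yᵢ, …, Yₘ)`. -/
def Connection.derivTensor (nabla : Connection E M) {m : ℕ}
    (S : (Fin m → VecField E M) → VecField E M) : (Fin (m + 1) → VecField E M) → VecField E M :=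
  fun Y => nabla.along (Y 0) (S (Fin.tail Y)) -
    ∑ i : Fin m, S (Function.update (Fin.tail Y) i (nabla.along (Y 0) (Fin.tail Y i)))

/-- The tensor `S` is parallel: `∇S = 0`. -/
def Connection.IsParallel (nabla : Connection E M) {m : ℕ}
    (S : (Fin m → VecField E M) → VecField E M) : Prop :=
  ∀ Y : Fin (m + 1) → VecField E M, (∀ i, IsSmoothField (Y i)) → nabla.derivTensor S Y = 0

/-- The curvature `(X, Y, Z) ↦ R(X, Y) Z` as a tensor with three arguments. -/
def Connection.curvTensor (nabla : Connection E M) : (Fin 3 → VecField E M) → VecField E M :=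
  fun Y => nabla.curv (Y 0) (Y 1) (Y 2)

/-- The `k`-fold iterated covariant derivative `∇ᵏR` of the curvature. The first `k` arguments are
the directions of differentiation, the last three are those of `R`. -/
def Connection.iterDerivCurv (nabla : Connection E M) :
    (k : ℕ) → (Fin (3 + k) → VecField E M) → VecField E M
  | 0 => nabla.curvTensor
  | k + 1 => nabla.derivTensor (nabla.iterDerivCurv k)

/-- The symmetrized `k`-th covariant derivative of the curvature,
`ℛ_k(X) U = (∇ᵏ_{X,…,X} R)(U, X) X`. -/
def Connection.symDerivCurv (nabla : Connection E M) (k : ℕ) (X U : VecField E M) : VecField E M :=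
  nabla.iterDerivCurv k (fun i => if (i : ℕ) = k then U else X)

/-! ### The Jacobi operator at a point -/

lemma eventually_extend_add {p : M} (u w : TangentSpace 𝓘(ℝ, E) p) :
    ∀ᶠ y in nhds p, FiberBundle.extend E (u + w) y
      = ((FiberBundle.extend E u + FiberBundle.extend E w : VecField E M) y) := by
  set t := trivializationAt E (fun x : M => TangentSpace 𝓘(ℝ, E) x) p with ht
  have hp : p ∈ t.baseSet := FiberBundle.mem_baseSet_trivializationAt' p
  have hlin : (t ⟨p, u + w⟩).2 = (t ⟨p, u⟩).2 + (t ⟨p, w⟩).2 := (t.linear ℝ hp).map_add u w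
  filter_upwards [t.open_baseSet.mem_nhds hp] with y hy
  simp only [FiberBundle.extend, Pi.add_apply, ← ht]
  rw [hlin, ← t.symmₗ_apply hy (R := ℝ), ← t.symmₗ_apply hy (R := ℝ), ← t.symmₗ_apply hy (R := ℝ),
    map_add]

lemma eventually_extend_smul {p : M} (c : ℝ) (u : TangentSpace 𝓘(ℝ, E) p) :
    ∀ᶠ y in nhds p, FiberBundle.extend E (c • u) y
      = ((c • (FiberBundle.extend E u : VecField E M)) y) := by
  set t := trivializationAt E (fun x : M => TangentSpace 𝓘(ℝ, E) x) p with ht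
  have hp : p ∈ t.baseSet := FiberBundle.mem_baseSet_trivializationAt' p
  have hlin : (t ⟨p, c • u⟩).2 = c • (t ⟨p, u⟩).2 := (t.linear ℝ hp).map_smul c u
  filter_upwards [t.open_baseSet.mem_nhds hp] with y hy
  simp only [FiberBundle.extend, Pi.smul_apply, ← ht]
  rw [hlin, ← t.symmₗ_apply hy (R := ℝ), ← t.symmₗ_apply hy (R := ℝ), map_smul]

section Jacobi

variable [FiniteDimensional ℝ E] [T2Space M]

lemma mdifferentiableAt_along_extend (nabla : Connection E M)
    [hs : nabla.ContMDiffCovariantDerivative ∞] {p : M} (u w : TangentSpace 𝓘(ℝ, E) p) :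
    MDiffAt (T% (nabla.along (FiberBundle.extend E u) (FiberBundle.extend E w) : VecField E M))
      p := by
  obtain ⟨s, hsp, hsw⟩ := FiberBundle.exists_contMDiffOn_extend (k := ∞) 𝓘(ℝ, E) E w
  obtain ⟨t, hts, ht, hpt⟩ := mem_nhds_iff.1 hsp
  obtain ⟨f, hf, -⟩ :=
    (SmoothBumpFunction.nhds_basis_support (I := 𝓘(ℝ, E)) (ht.mem_nhds hpt)).mem_iff.1
      (ht.mem_nhds hpt)
  have hglob : CMDiff ∞ (T% ((f : M → ℝ) • (FiberBundle.extend E w : VecField E M))) :=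
    ContMDiffOn.smul_section_of_tsupport f.contMDiff.contMDiffOn ht hf (hsw.mono hts)
  have h1 := hs.contMDiff.contMDiff (σ := (f : M → ℝ) • (FiberBundle.extend E w : VecField E M))
    (hglob.of_le (by simp)).contMDiffOn
  have h2 := ((h1 p (Set.mem_univ p)).contMDiffAt Filter.univ_mem).clm_bundle_apply
    (FiberBundle.contMDiffAt_extend (k := ∞) 𝓘(ℝ, E) E u)
  refine (h2.mdifferentiableAt (by simp)).congr_of_eventuallyEq ?_
  have h3 : ∀ᶠ y in nhds p, ∀ᶠ z in nhds y, f z = 1 :=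
    eventually_eventually_nhds.2 f.eventuallyEq_one
  filter_upwards [h3, ht.mem_nhds hpt] with y hy hyt
  congr 1
  have : nabla (FiberBundle.extend E w) y
      = nabla ((f : M → ℝ) • (FiberBundle.extend E w : VecField E M)) y := by
    refine nabla.isCovariantDerivativeOnUniv.congr_of_eventuallyEq
      (((hsw.mono hts).contMDiffAt (ht.mem_nhds hyt)).mdifferentiableAt (by simp))
      (hglob.contMDiffAt.mdifferentiableAt (by simp)) Filter.univ_mem ?_
    filter_upwards [hy] with z hz
    simp [hz]
  simp [Connection.along, this]

/-- The Jacobi operator `ℛ(X) : U ↦ R(U, X) X` of the tangent space at `p`. The curvature is a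
tensor, so the choice of the vector fields extending `U` and `X` does not matter. -/
def Connection.jacobiOp (nabla : Connection E M) [nabla.ContMDiffCovariantDerivative ∞]
    {p : M} (X : TangentSpace 𝓘(ℝ, E) p) : Module.End ℝ (TangentSpace 𝓘(ℝ, E) p) where
  toFun U := nabla.curv (FiberBundle.extend E U) (FiberBundle.extend E X) (FiberBundle.extend E X) p
  map_add' U W := by
    have hU := FiberBundle.mdifferentiableAt_extend 𝓘(ℝ, E) E U
    have hW := FiberBundle.mdifferentiableAt_extend 𝓘(ℝ, E) E W
    have hUX := mdifferentiableAt_along_extend nabla U X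
    have hWX := mdifferentiableAt_along_extend nabla W X
    have h := nabla.isCovariantDerivativeOnUniv.add hUX hWX
    have e : nabla (nabla.along (FiberBundle.extend E (U + W)) (FiberBundle.extend E X)) p
        = nabla (nabla.along (FiberBundle.extend E U) (FiberBundle.extend E X)
          + nabla.along (FiberBundle.extend E W) (FiberBundle.extend E X)) p := by
      refine nabla.isCovariantDerivativeOnUniv.congr_of_eventuallyEq
        (mdifferentiableAt_along_extend nabla (U + W) X)
        (mdifferentiableAt_add_section hUX hWX) Filter.univ_mem ?_
      filter_upwards [eventually_extend_add U W] with y hy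
      simp [Connection.along, hy]
    have b := Filter.EventuallyEq.mlieBracket_vectorField_eq (I := 𝓘(ℝ, E))
      (eventually_extend_add U W) (Filter.EventuallyEq.refl (nhds p)
        (FiberBundle.extend E X : VecField E M))
    simp only [Connection.curv, Pi.sub_apply]
    simp only [Connection.along] at e h ⊢
    rw [e, h, b, VectorField.mlieBracket_add_left hU hW]
    simp
    abel
  map_smul' c U := by
    have hU := FiberBundle.mdifferentiableAt_extend 𝓘(ℝ, E) E U
    have hUX := mdifferentiableAt_along_extend nabla U X
    have h := nabla.isCovariantDerivativeOnUniv.smul_const c hUX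
    have e : nabla (nabla.along (FiberBundle.extend E (c • U)) (FiberBundle.extend E X)) p
        = nabla (c • nabla.along (FiberBundle.extend E U) (FiberBundle.extend E X)) p := by
      refine nabla.isCovariantDerivativeOnUniv.congr_of_eventuallyEq
        (mdifferentiableAt_along_extend nabla (c • U) X)
        hUX.smul_const_section Filter.univ_mem ?_
      filter_upwards [eventually_extend_smul c U] with y hy
      simp [Connection.along, hy]
    have b := Filter.EventuallyEq.mlieBracket_vectorField_eq (I := 𝓘(ℝ, E))
      (eventually_extend_smul c U) (Filter.EventuallyEq.refl (nhds p)
        (FiberBundle.extend E X : VecField E M))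
    simp only [Connection.curv, Pi.sub_apply]
    simp only [Connection.along] at e h ⊢
    rw [e, h, b, VectorField.mlieBracket_const_smul_left hU]
    simp [smul_sub]

/-- The torsion endomorphism `τ_X` of the tangent space at `p`, `τ_X Y = 2 (∇̄_X Y - ∇_X Y)`, where
`∇̄ = nablaBar`. In other words `∇̄ = ∇ + τ / 2`. -/
def torsionEnd (nabla nablaBar : Connection E M) {p : M} (X : TangentSpace 𝓘(ℝ, E) p) :
    Module.End ℝ (TangentSpace 𝓘(ℝ, E) p) where
  toFun Y := (2 : ℝ) • nablaBar.difference nabla p Y X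
  map_add' Y Z := by simp
  map_smul' c Y := by simp [smul_smul, mul_comm]

end Jacobi

/-! ### Naturally reductive spaces and linear Jacobi relations -/

section Riemannian

variable [FiniteDimensional ℝ E] [RiemannianBundle (fun x : M => TangentSpace 𝓘(ℝ, E) x)]
  [IsContMDiffRiemannianBundle 𝓘(ℝ, E) ∞ E (fun x : M => TangentSpace 𝓘(ℝ, E) x)]

/-- `∇` is the Levi-Civita connection of the Riemannian metric: it is metric and torsion free. -/
structure IsLeviCivita (nabla : Connection E M) : Prop where
  metric : CovariantDerivative.IsMetricCompatible (I := 𝓘(ℝ, E))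
    (V := fun x : M => TangentSpace 𝓘(ℝ, E) x) nabla
  torsion_free : nabla.torsion = 0

/-- Ambrose-Singer connections: metric connections with parallel torsion and parallel curvature. -/
structure IsAmbroseSinger (nablaBar : Connection E M) : Prop where
  metric : CovariantDerivative.IsMetricCompatible (I := 𝓘(ℝ, E))
    (V := fun x : M => TangentSpace 𝓘(ℝ, E) x) nablaBar
  torsion_parallel :
    nablaBar.IsParallel (fun Y : Fin 2 → VecField E M => fun x => nablaBar.torsion x (Y 0 x) (Y 1 x))
  curvature_parallel : nablaBar.IsParallel nablaBar.curvTensor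

/-- `(M, g, ∇̄)` with Levi-Civita connection `∇` is naturally reductive: `∇̄` is an Ambrose-Singer
connection and `τ(X, Y, Z) = ⟨τ_X Y, Z⟩` is alternating, where `∇̄ = ∇ + τ / 2`. -/
structure IsNaturallyReductive (nabla nablaBar : Connection E M) : Prop where
  ambroseSinger : IsAmbroseSinger nablaBar
  alternating : ∀ (p : M) (X Y : TangentSpace 𝓘(ℝ, E) p),
    inner ℝ (torsionEnd nabla nablaBar X X) Y = 0 ∧
    inner ℝ (torsionEnd nabla nablaBar X Y) Y = 0 ∧
    inner ℝ (torsionEnd nabla nablaBar X Y) X = 0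

/-- The monic polynomial `P = λᴺ + a₂ λᴺ⁻² + a₄ λᴺ⁻⁴ + ⋯` of degree `N` defines the relation
`ℛ_N = - a₂ ‖·‖² ℛ_{N-2} - a₄ ‖·‖⁴ ℛ_{N-4} - ⋯`
between the symmetrized covariant derivatives of the curvature. If `N = d + 1`, then this is a linear
Jacobi relation of order `d`. -/
structure IsLinearJacobi (nabla : Connection E M) (P : Polynomial ℝ) : Prop where
  monic : P.Monic
  parity : ∀ i ≤ P.natDegree, Odd (P.natDegree - i) → P.coeff i = 0
  relation : ∀ X U : VecField E M, IsSmoothField X → IsSmoothField U → ∀ x : M,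
    ∑ i ∈ Finset.range (P.natDegree + 1),
      (P.coeff i * ‖X x‖ ^ (P.natDegree - i)) • nabla.symDerivCurv i X U x = 0

/-- There is a linear Jacobi relation (of some order `d ≥ 0`). -/
def HasLinearJacobi (nabla : Connection E M) : Prop :=
  ∃ (d : ℕ) (P : Polynomial ℝ), P.natDegree = d + 1 ∧ IsLinearJacobi nabla P

/-- The algebraic relation `P(𝒯) ℛ ≡ 0`: it says that `P(𝒯_X) ℛ_X = 0` for all unit vectors `X`,
where `𝒯_X ℛ = (ℛ τ_X - τ_X ℛ) / 2`. -/
def AlgebraicJacobi [T2Space M] (nabla nablaBar : Connection E M)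
    [nabla.ContMDiffCovariantDerivative ∞] (P : Polynomial ℝ) : Prop :=
  ∀ (q : M) (X : TangentSpace 𝓘(ℝ, E) q), ‖X‖ = 1 →
    Polynomial.aeval (halfCommutator (torsionEnd nabla nablaBar X)) P (nabla.jacobiOp X) = 0

/-- `λ₁ < ⋯ < λₘ` are continuous positive functions on the set `U` of unit vectors, such that the
nonzero eigenvalues of `-τ_X²` are precisely `λ₁(X)², …, λₘ(X)²` for every `X ∈ U`. -/
structure IsEigenvalueSystem (nabla nablaBar : Connection E M) {p : M}
    (U : Set (Metric.sphere (0 : TangentSpace 𝓘(ℝ, E) p) 1)) {m : ℕ}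
    (lam : Fin m → Metric.sphere (0 : TangentSpace 𝓘(ℝ, E) p) 1 → ℝ) : Prop where
  continuousOn : ∀ k, ContinuousOn (lam k) U
  pos : ∀ X ∈ U, ∀ k, 0 < lam k X
  strictMono : ∀ X ∈ U, StrictMono fun k => lam k X
  eigenvalues : ∀ X ∈ U, ∀ c : ℝ, c ≠ 0 →
    (Module.End.HasEigenvalue (-(torsionEnd nabla nablaBar (X : TangentSpace 𝓘(ℝ, E) p) *
      torsionEnd nabla nablaBar (X : TangentSpace 𝓘(ℝ, E) p))) c ↔ ∃ k, c = lam k X ^ 2)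

section Components

variable [T2Space M] (nabla nablaBar : Connection E M) [nabla.ContMDiffCovariantDerivative ∞]
  {p : M} {m : ℕ} (lam : Fin m → Metric.sphere (0 : TangentSpace 𝓘(ℝ, E) p) 1 → ℝ)
  (X : Metric.sphere (0 : TangentSpace 𝓘(ℝ, E) p) 1)

/-- The component `ℛ^{0,k}` of the Jacobi operator `ℛ_X` with respect to `A = τ_X`. -/
def jacobi0 (k : Fin m) : Module.End ℝ (TangentSpace 𝓘(ℝ, E) p) :=
  zeroBlock (torsionEnd nabla nablaBar (X : TangentSpace 𝓘(ℝ, E) p))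
    (nabla.jacobiOp (X : TangentSpace 𝓘(ℝ, E) p)) (lam k X)

/-- The component `ℛ^{k,j}_{(1,1)}` of the Jacobi operator `ℛ_X` with respect to `A = τ_X`. -/
def jacobi11 (k j : Fin m) : Module.End ℝ (TangentSpace 𝓘(ℝ, E) p) :=
  block11 (torsionEnd nabla nablaBar (X : TangentSpace 𝓘(ℝ, E) p))
    (nabla.jacobiOp (X : TangentSpace 𝓘(ℝ, E) p)) (fun i => lam i X) k j

/-- The component `ℛ^{k,j}_{(2,0)+(0,2)}` of the Jacobi operator `ℛ_X` with respect to `A = τ_X`. -/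
def jacobi20 (k j : Fin m) : Module.End ℝ (TangentSpace 𝓘(ℝ, E) p) :=
  block20 (torsionEnd nabla nablaBar (X : TangentSpace 𝓘(ℝ, E) p))
    (nabla.jacobiOp (X : TangentSpace 𝓘(ℝ, E) p)) (fun i => lam i X) k j

end Components

/-- The quadratic factors whose least common multiple is `Q`. A factor occurs if the corresponding
component of the Jacobi operator does not vanish identically on `U`. -/
def jacobiFactors [T2Space M] (nabla nablaBar : Connection E M)
    [nabla.ContMDiffCovariantDerivative ∞] {p : M}
    (U : Set (Metric.sphere (0 : TangentSpace 𝓘(ℝ, E) p) 1)) {m : ℕ}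
    (lam : Fin m → Metric.sphere (0 : TangentSpace 𝓘(ℝ, E) p) 1 → ℝ) : Set (Polynomial ℝ) :=
  {f | ∃ k j : Fin m, k < j ∧ (∃ X ∈ U, jacobi11 nabla nablaBar lam X k j ≠ 0) ∧
      ∃ X ∈ U, f = Polynomial.X ^ 2 + Polynomial.C ((lam k X - lam j X) ^ 2 / 4)} ∪
  {f | ∃ k j : Fin m, k ≤ j ∧ (∃ X ∈ U, jacobi20 nabla nablaBar lam X k j ≠ 0) ∧
      ∃ X ∈ U, f = Polynomial.X ^ 2 + Polynomial.C ((lam k X + lam j X) ^ 2 / 4)} ∪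
  {f | ∃ k : Fin m, (∃ X ∈ U, jacobi0 nabla nablaBar lam X k ≠ 0) ∧
      ∃ X ∈ U, f = Polynomial.X ^ 2 + Polynomial.C (lam k X ^ 2 / 4)}

end Riemannian

end Manifold

end

/-! From geometry to algebra. Both τ and R are ∇̄-parallel, so substituting ∇ = ∇̄ - τ/2 turns every
covariant derivative of R into the derivation action of -τ/2 (`iterDerivCurv_eq`). Since τ_X X = 0,
only the slot of U is affected when all other slots hold X, and the k-th symmetrized derivative
becomes 𝒯_X^k ℛ_X (`symDerivCurv_eq`). A linear Jacobi relation is therefore the same as a monic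
polynomial P of the right parity with P(𝒯)ℛ ≡ 0 (`isLinearJacobi_iff`).

Linear algebra at one X. On V_k the operator τ_X is λ_k J, so 𝒯_X² acts on each component of ℛ_X as
a scalar: -(λ_k - λ_l)²/4 on type (1,1), -(λ_k + λ_l)²/4 on type (2,0)+(0,2), -λ_k²/4 on the mixed
blocks with the kernel. The corresponding quadratics are irreducible when the frequency is nonzero,
so P(𝒯_X) kills a nonzero component exactly when its quadratic divides P
(`dvd_of_aeval_apply_eq_zero`). The diagonal (1,1) blocks and π_0 ℛ π_0 lie in the kernel of 𝒯_X and
account for the extra factor λ (`aeval_X_mul_eq_zero`).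

Necessity. P has finitely many quadratic factors, so a continuous frequency is locally constant
wherever its component is nonzero. The λ_k are real analytic (power sums of the λ_k² are traces of
powers of -τ_X²; invert by the inverse function theorem), so the identity theorem on the connected
cone over U makes that frequency constant on all of U (`hasConstantFrequencies_of_aeval_eq_zero`).

Sufficiency and minimality. With constant frequencies Q is a finite product of distinct even
irreducibles and λQ annihilates ℛ_X for X in U. As λQ is odd, its homogenization contains only even
powers of the norm and is analytic on the whole tangent space; vanishing on an open cone, it
vanishes identically (`aeval_eq_zero_of_isOpen`). Parallel transport of ∇̄ is isometric and
preserves τ and R, and connectedness carries the relation to all of M (`algebraicJacobi_of_point`).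
Every relation is divisible by Q, so one of degree less than that of λQ equals Q. -/

noncomputable section

/-! ### Spectral decomposition of a skew-symmetric endomorphism -/

section SkewLinearAlgebra

variable {V : Type*} [NormedAddCommGroup V] [InnerProductSpace ℝ V] [FiniteDimensional ℝ V]

/-- `A` is skew-symmetric, and the squares of the distinct positive numbers `l k` are the nonzero
eigenvalues of `-A²`. -/
structure IsSkewSpectrum (A : Module.End ℝ V) {m : ℕ} (l : Fin m → ℝ) : Prop where
  skew : ∀ x y, inner ℝ (A x) y = -inner ℝ x (A y)
  pos : ∀ k, 0 < l k
  injective : Function.Injective l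
  eigenvalues : ∀ c : ℝ, c ≠ 0 → (Module.End.HasEigenvalue (-(A * A)) c ↔ ∃ k, c = l k ^ 2)

/-- The numbers `l k`, together with the number zero. -/
def spectrumWithZero {m : ℕ} (l : Fin m → ℝ) (i : Option (Fin m)) : ℝ := i.elim 0 l

@[simp] lemma spectrumWithZero_none {m : ℕ} (l : Fin m → ℝ) : spectrumWithZero l none = 0 := rfl

@[simp] lemma spectrumWithZero_some {m : ℕ} (l : Fin m → ℝ) (k : Fin m) :
    spectrumWithZero l (some k) = l k := rfl

/-- The orthogonal projections onto the summands of the spectral decomposition. -/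
def specProj (A : Module.End ℝ V) {m : ℕ} (l : Fin m → ℝ) (i : Option (Fin m)) : Module.End ℝ V :=
  eigProj A (spectrumWithZero l i)

@[simp] lemma specProj_some (A : Module.End ℝ V) {m : ℕ} (l : Fin m → ℝ) (k : Fin m) :
    specProj A l (some k) = eigProj A (l k) := rfl

lemma negSq_mul_eigProj (A : Module.End ℝ V) (c : ℝ) :
    -(A * A) * eigProj A c = c ^ 2 • eigProj A c := by
  ext v
  have h : eigProj A c v ∈ Module.End.eigenspace (-(A * A)) (c ^ 2) :=
    Submodule.starProjection_apply_mem _ v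
  exact Module.End.mem_eigenspace_iff.1 h

lemma eigProj_apply_of_mem (A : Module.End ℝ V) {c : ℝ} {v : V}
    (hv : v ∈ Module.End.eigenspace (-(A * A)) (c ^ 2)) : eigProj A c v = v :=
  Submodule.starProjection_eq_self_iff.2 hv

lemma isIdempotentElem_eigProj (A : Module.End ℝ V) (c : ℝ) : IsIdempotentElem (eigProj A c) := by
  ext v
  exact eigProj_apply_of_mem A (Submodule.starProjection_apply_mem _ v)

lemma halfCommutator_apply (A S : Module.End ℝ V) :
    halfCommutator A S = (1 / 2 : ℝ) • (S * A - A * S) := rfl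

namespace IsSkewSpectrum

variable {A : Module.End ℝ V} {m : ℕ} {l : Fin m → ℝ} (h : IsSkewSpectrum A l)

include h

/-- The eigenspace is invariant under A, and by skew-symmetry so is its orthogonal complement; A
therefore respects the orthogonal splitting. -/
lemma commute_eigProj (c : ℝ) : Commute A (eigProj A c) := by
  set K := Module.End.eigenspace (-(A * A)) (c ^ 2) with hK
  have hAK : ∀ v ∈ K, A v ∈ K := fun v hv => by
    rw [hK, Module.End.mem_eigenspace_iff] at hv ⊢
    have := congrArg A hv
    simpa using this
  have hAK' : ∀ v ∈ Kᗮ, A v ∈ Kᗮ := fun v hv => by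
    rw [Submodule.mem_orthogonal'] at hv ⊢
    intro u hu
    rw [h.skew, hv _ (hAK u hu), neg_zero]
  ext v
  change A (K.starProjection v) = K.starProjection (A v)
  symm
  apply Submodule.eq_starProjection_of_mem_orthogonal (hAK _ (Submodule.starProjection_apply_mem _ v))
  rw [← map_sub]
  exact hAK' _ (Submodule.sub_starProjection_mem_orthogonal v)

/-- Skew-symmetry gives ⟨A v, A v⟩ = -⟨v, A² v⟩, so A² v = 0 forces A v = 0. This lets the kernel be
treated as one more spectral summand, with frequency zero. -/
lemma ker_eq : LinearMap.ker A = Module.End.eigenspace (-(A * A)) ((0 : ℝ) ^ 2) := by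
  ext v
  simp only [LinearMap.mem_ker, Module.End.mem_eigenspace_iff]
  constructor
  · intro hv; simp [hv]
  · intro hv
    have h1 : A (A v) = 0 := by simpa using hv
    have h2 := h.skew v (A v)
    rw [h1, inner_zero_right, neg_zero] at h2
    exact inner_self_eq_zero.1 h2

lemma kerProj_eq : kerProj A = specProj A l none := by
  simp only [kerProj, specProj, eigProj, spectrumWithZero_none, h.ker_eq]

lemma commute_specProj (i : Option (Fin m)) : Commute A (specProj A l i) := h.commute_eigProj _

lemma spectrumWithZero_sq_injective : Function.Injective fun i => spectrumWithZero l i ^ 2 := by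
  intro i j hij
  have hn : ∀ i, 0 ≤ spectrumWithZero l i := by
    rintro (_ | k)
    · exact le_rfl
    · exact (h.pos k).le
  have h1 : spectrumWithZero l i = spectrumWithZero l j :=
    (pow_left_inj₀ (hn i) (hn j) two_ne_zero).1 hij
  rcases i with _ | i <;> rcases j with _ | j
  · rfl
  · exact absurd h1.symm (h.pos j).ne'
  · exact absurd h1 (h.pos i).ne'
  · rw [h.injective h1]

lemma specProj_mul_of_ne {i j : Option (Fin m)} (hij : i ≠ j) :
    specProj A l i * specProj A l j = 0 := by
  set B := -(A * A)
  have hc : Commute B (specProj A l i) :=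
    ((h.commute_specProj i).mul_left (h.commute_specProj i)).neg_left
  have h1 : specProj A l i * (B * specProj A l j)
      = spectrumWithZero l j ^ 2 • (specProj A l i * specProj A l j) := by
    rw [specProj, specProj, negSq_mul_eigProj, mul_smul_comm]
  have h2 : specProj A l i * (B * specProj A l j)
      = spectrumWithZero l i ^ 2 • (specProj A l i * specProj A l j) := by
    rw [← mul_assoc, ← hc.eq]
    rw [specProj, specProj, negSq_mul_eigProj, smul_mul_assoc]
  have h3 : (spectrumWithZero l i ^ 2 - spectrumWithZero l j ^ 2) •
      (specProj A l i * specProj A l j) = 0 := by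
    rw [sub_smul, ← h1, ← h2, sub_self]
  refine (smul_eq_zero.1 h3).resolve_left ?_
  exact sub_ne_zero.2 fun e => hij (h.spectrumWithZero_sq_injective e)

lemma specProj_mul_self (i : Option (Fin m)) : specProj A l i * specProj A l i = specProj A l i :=
  isIdempotentElem_eigProj A _

/-- -A² is symmetric, so its eigenspaces span; each nonzero one belongs either to the value zero or
to a listed l k, and there the sum of the projections is the identity. -/
lemma sum_specProj : ∑ i, specProj A l i = 1 := by
  set B := -(A * A) with hB
  have hsymm : B.IsSymmetric := fun x y => by
    simp [hB, h.skew]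
  have htop : ⨆ c : ℝ, Module.End.eigenspace B c = ⊤ :=
    (Submodule.orthogonal_eq_bot_iff).1 hsymm.orthogonalComplement_iSup_eigenspaces_eq_bot
  have hle : ⨆ c : ℝ, Module.End.eigenspace B c ≤ LinearMap.ker (∑ i, specProj A l i - 1) := by
    refine iSup_le fun c v hv => ?_
    have key : ∀ i, spectrumWithZero l i ^ 2 = c → (∑ j, specProj A l j) v = v := by
      rintro i rfl
      have hi : specProj A l i v = v := eigProj_apply_of_mem A hv
      rw [LinearMap.sum_apply, Finset.sum_eq_single i, hi]
      · intro j _ hj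
        rw [← hi, ← Module.End.mul_apply, h.specProj_mul_of_ne hj, LinearMap.zero_apply]
      · simp
    rw [LinearMap.mem_ker, LinearMap.sub_apply, sub_eq_zero, Module.End.one_apply]
    by_cases hv0 : v = 0
    · simp [hv0]
    by_cases hc : c = 0
    · exact key none (by simp [hc])
    · obtain ⟨k, hk⟩ := (h.eigenvalues c hc).1
        (Module.End.hasEigenvalue_of_hasEigenvector ⟨hv, hv0⟩)
      exact key (some k) (by simp [hk])
  rw [htop, top_le_iff, LinearMap.ker_eq_top] at hle
  exact sub_eq_zero.1 hle

lemma commute_complexStr : Commute A (complexStr A l) := by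
  unfold complexStr
  exact Commute.sum_right _ _ _ fun k _ =>
    ((Commute.refl A).mul_right (h.commute_eigProj _)).smul_right _

lemma complexStr_mul_eigProj (k : Fin m) :
    complexStr A l * eigProj A (l k) = (l k)⁻¹ • (A * eigProj A (l k)) := by
  rw [complexStr, Finset.sum_mul, Finset.sum_eq_single k]
  · rw [smul_mul_assoc, mul_assoc, (isIdempotentElem_eigProj A _).eq]
  · intro j _ hj
    rw [smul_mul_assoc, mul_assoc, ← specProj_some, ← specProj_some,
      h.specProj_mul_of_ne (by simpa using hj), mul_zero, smul_zero]
  · simp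

lemma commute_specProj_specProj (i j : Option (Fin m)) :
    Commute (specProj A l i) (specProj A l j) := by
  by_cases hij : i = j
  · rw [hij]
  · rw [Commute, SemiconjBy, h.specProj_mul_of_ne hij, h.specProj_mul_of_ne (Ne.symm hij)]

lemma commute_complexStr_specProj (i : Option (Fin m)) :
    Commute (complexStr A l) (specProj A l i) := by
  unfold complexStr
  exact Commute.sum_left _ _ _ fun k _ =>
    ((h.commute_specProj i).mul_left (h.commute_specProj_specProj (some k) i)).smul_left _

lemma mul_eigProj (k : Fin m) :
    A * eigProj A (l k) = l k • (complexStr A l * eigProj A (l k)) := by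
  rw [h.complexStr_mul_eigProj, smul_smul, mul_inv_cancel₀ (h.pos k).ne', one_smul]

lemma eigProj_mul (k : Fin m) :
    eigProj A (l k) * A = l k • (eigProj A (l k) * complexStr A l) := by
  rw [← (h.commute_eigProj _).eq, h.mul_eigProj, ← specProj_some,
    (h.commute_complexStr_specProj _).eq]

lemma complexStr_sq_mul_eigProj (k : Fin m) :
    complexStr A l * (complexStr A l * eigProj A (l k)) = -eigProj A (l k) := by
  have e := negSq_mul_eigProj A (l k)
  rw [h.complexStr_mul_eigProj, mul_smul_comm, ← mul_assoc, ← h.commute_complexStr.eq, mul_assoc,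
    h.complexStr_mul_eigProj, mul_smul_comm, smul_smul, ← mul_assoc]
  rw [neg_mul, neg_eq_iff_eq_neg] at e
  rw [e, smul_neg, smul_smul]
  have := (h.pos k).ne'
  field_simp
  simp

lemma eigProj_mul_complexStr_sq (k : Fin m) :
    eigProj A (l k) * complexStr A l * complexStr A l = -eigProj A (l k) := by
  rw [← h.complexStr_sq_mul_eigProj k, ← specProj_some, ← (h.commute_complexStr_specProj _).eq,
    mul_assoc, ← (h.commute_complexStr_specProj _).eq]

lemma mul_specProj_none : A * specProj A l none = 0 := by
  ext v
  have : specProj A l none v ∈ LinearMap.ker A := by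
    rw [h.ker_eq]; exact Submodule.starProjection_apply_mem _ v
  exact this

lemma specProj_none_mul : specProj A l none * A = 0 := by
  rw [← (h.commute_specProj none).eq, h.mul_specProj_none]

end IsSkewSpectrum

/-! ### The half commutator on matrix blocks -/

section Pieces

variable {A J S : Module.End ℝ V} {a b : ℝ}

/-- S stands for a block from a summand with frequency a to one with frequency b. The combination S
- JSJ commutes with J, so A acts as aJ from the right and as bJ from the left, and the two
contributions subtract. -/
lemma halfCommutator_sub_conj (hAJ : Commute A J) (h1 : S * A = a • (S * J))
    (h2 : A * S = b • (J * S)) (h3 : J * (J * S) = -S) (h4 : S * J * J = -S) :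
    halfCommutator A (S - J * S * J) = ((a - b) / 2) • (S * J + J * S) := by
  have e1 : J * S * J * A = a • (-(J * S)) := by
    rw [mul_assoc (J * S), ← hAJ.eq, ← mul_assoc, mul_assoc J, h1, mul_smul_comm, smul_mul_assoc,
      mul_assoc, h4, mul_neg]
  have e2 : A * (J * S * J) = b • (-(S * J)) := by
    rw [← mul_assoc, ← mul_assoc, hAJ.eq, mul_assoc J, h2, mul_smul_comm, smul_mul_assoc, h3,
      neg_mul]
  rw [halfCommutator_apply, sub_mul, mul_sub, h1, h2, e1, e2]
  module

/-- Here S + JSJ anticommutes with J; moving J across changes the sign, so the two frequencies add.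
-/
lemma halfCommutator_add_conj (hAJ : Commute A J) (h1 : S * A = a • (S * J))
    (h2 : A * S = b • (J * S)) (h3 : J * (J * S) = -S) (h4 : S * J * J = -S) :
    halfCommutator A (S + J * S * J) = ((a + b) / 2) • (S * J - J * S) := by
  have e1 : J * S * J * A = a • (-(J * S)) := by
    rw [mul_assoc (J * S), ← hAJ.eq, ← mul_assoc, mul_assoc J, h1, mul_smul_comm, smul_mul_assoc,
      mul_assoc, h4, mul_neg]
  have e2 : A * (J * S * J) = b • (-(S * J)) := by
    rw [← mul_assoc, ← mul_assoc, hAJ.eq, mul_assoc J, h2, mul_smul_comm, smul_mul_assoc, h3,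
      neg_mul]
  rw [halfCommutator_apply, add_mul, mul_add, h1, h2, e1, e2]
  module

/-- One application yields (a - b)/2 times J(S - JSJ); a second one returns to S - JSJ, with a minus
sign from J² = -1. -/
lemma halfCommutator_sq_sub_conj (hAJ : Commute A J) (h1 : S * A = a • (S * J))
    (h2 : A * S = b • (J * S)) (h3 : J * (J * S) = -S) (h4 : S * J * J = -S) :
    halfCommutator A (halfCommutator A (S - J * S * J))
      = -((a - b) ^ 2 / 4) • (S - J * S * J) := by
  rw [halfCommutator_sub_conj hAJ h1 h2 h3 h4, map_smul, halfCommutator_apply]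
  have e1 : S * J * A = a • (-S) := by
    rw [mul_assoc, ← hAJ.eq, ← mul_assoc, h1, smul_mul_assoc, h4]
  have e2 : J * S * A = a • (J * S * J) := by
    rw [mul_assoc, h1, mul_smul_comm, mul_assoc]
  have e3 : A * (S * J) = b • (J * S * J) := by
    rw [← mul_assoc, h2, smul_mul_assoc]
  have e4 : A * (J * S) = b • (-S) := by
    rw [← mul_assoc, hAJ.eq, mul_assoc, h2, mul_smul_comm, h3]
  rw [add_mul, mul_add, e1, e2, e3, e4]
  module

lemma halfCommutator_sq_add_conj (hAJ : Commute A J) (h1 : S * A = a • (S * J))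
    (h2 : A * S = b • (J * S)) (h3 : J * (J * S) = -S) (h4 : S * J * J = -S) :
    halfCommutator A (halfCommutator A (S + J * S * J))
      = -((a + b) ^ 2 / 4) • (S + J * S * J) := by
  rw [halfCommutator_add_conj hAJ h1 h2 h3 h4, map_smul, halfCommutator_apply]
  have e1 : S * J * A = a • (-S) := by
    rw [mul_assoc, ← hAJ.eq, ← mul_assoc, h1, smul_mul_assoc, h4]
  have e2 : J * S * A = a • (J * S * J) := by
    rw [mul_assoc, h1, mul_smul_comm, mul_assoc]
  have e3 : A * (S * J) = b • (J * S * J) := by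
    rw [← mul_assoc, h2, smul_mul_assoc]
  have e4 : A * (J * S) = b • (-S) := by
    rw [← mul_assoc, hAJ.eq, mul_assoc, h2, mul_smul_comm, h3]
  rw [sub_mul, mul_sub, e1, e2, e3, e4]
  module

/-- One side of S lies in the kernel of A, so just one term of the commutator survives and no
splitting into types is needed. -/
lemma halfCommutator_sq_of_mul_eq_zero (hAJ : Commute A J) (h1 : S * A = 0)
    (h2 : A * S = b • (J * S)) (h3 : J * (J * S) = -S) :
    halfCommutator A (halfCommutator A S) = -(b ^ 2 / 4) • S := by
  have e : A * (J * S) = b • (-S) := by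
    rw [← mul_assoc, hAJ.eq, mul_assoc, h2, mul_smul_comm, h3]
  rw [halfCommutator_apply A S, h1, h2, zero_sub, map_smul, map_neg, map_smul, halfCommutator_apply,
    e, mul_assoc, h1, mul_zero]
  module

lemma halfCommutator_sq_of_mul_eq_zero' (hAJ : Commute A J) (h1 : S * A = b • (S * J))
    (h2 : A * S = 0) (h3 : S * J * J = -S) :
    halfCommutator A (halfCommutator A S) = -(b ^ 2 / 4) • S := by
  have e : S * J * A = b • (-S) := by
    rw [mul_assoc, ← hAJ.eq, ← mul_assoc, h1, smul_mul_assoc, h3]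
  rw [halfCommutator_apply A S, h1, h2, sub_zero, map_smul, map_smul, halfCommutator_apply,
    e, ← mul_assoc, h2, zero_mul]
  module

end Pieces

end SkewLinearAlgebra

/-! ### Action of 𝒯 on the blocks of an endomorphism, and divisibility of annihilating polynomials.
-/

section BlockRelations

variable {V : Type*} [NormedAddCommGroup V] [InnerProductSpace ℝ V] [FiniteDimensional ℝ V]

/-- Conjugation by endomorphisms commuting with `A` commutes with the half commutator. -/
lemma halfCommutator_mul_mul {A B C : Module.End ℝ V} (hB : Commute A B) (hC : Commute A C)
    (S : Module.End ℝ V) : halfCommutator A (B * S * C) = B * halfCommutator A S * C := by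
  simp only [halfCommutator_apply, mul_smul_comm, smul_mul_assoc, mul_sub, sub_mul]
  congr 2
  · rw [mul_assoc (B * S), ← hC.eq, ← mul_assoc, mul_assoc B]
  · rw [← mul_assoc, ← mul_assoc, hB.eq, mul_assoc B]

lemma aeval_apply_of_comm {W : Type*} [AddCommGroup W] [Module ℝ W] (T : Module.End ℝ W)
    (C : W →ₗ[ℝ] W) (hC : ∀ S, T (C S) = C (T S)) (P : Polynomial ℝ) (S : W) :
    Polynomial.aeval T P (C S) = C (Polynomial.aeval T P S) := by
  induction P using Polynomial.induction_on' with
  | add p q hp hq => simp [hp, hq]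
  | monomial n a =>
    have hn : ∀ S, (T ^ n) (C S) = C ((T ^ n) S) := by
      induction n with
      | zero => simp
      | succ n ih => intro S; rw [pow_succ, Module.End.mul_apply, Module.End.mul_apply, hC, ih]
    simp [Polynomial.aeval_monomial, hn]

lemma aeval_halfCommutator_mul_mul {A B C : Module.End ℝ V} (hB : Commute A B) (hC : Commute A C)
    (P : Polynomial ℝ) (S : Module.End ℝ V) :
    Polynomial.aeval (halfCommutator A) P (B * S * C)
      = B * Polynomial.aeval (halfCommutator A) P S * C :=
  aeval_apply_of_comm _ (LinearMap.mulRight ℝ C ∘ₗ LinearMap.mulLeft ℝ B)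
    (fun S => halfCommutator_mul_mul hB hC S) P S

lemma aeval_sq_add_apply {W : Type*} [AddCommGroup W] [Module ℝ W] {T : Module.End ℝ W} {c : ℝ}
    {S : W} (hS : T (T S) = -c • S) :
    Polynomial.aeval T (Polynomial.X ^ 2 + Polynomial.C c) S = 0 := by
  simp [pow_two, hS]

lemma aeval_apply_eq_zero_of_dvd {W : Type*} [AddCommGroup W] [Module ℝ W] {T : Module.End ℝ W}
    {P Q : Polynomial ℝ} {S : W} (hPQ : P ∣ Q) (hS : Polynomial.aeval T P S = 0) :
    Polynomial.aeval T Q S = 0 := by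
  obtain ⟨D, rfl⟩ := hPQ
  rw [mul_comm, map_mul, Module.End.mul_apply, hS, map_zero]

lemma irreducible_X_sq_add_C {c : ℝ} (hc : 0 < c) :
    Irreducible (Polynomial.X ^ 2 + Polynomial.C c) := by
  have hd : (Polynomial.X ^ 2 + Polynomial.C c).natDegree = 2 := Polynomial.natDegree_X_pow_add_C
  rw [Polynomial.irreducible_iff_roots_eq_zero_of_degree_le_three hd.ge (by omega)]
  refine Multiset.eq_zero_of_forall_notMem fun x hx => ?_
  have := Polynomial.isRoot_of_mem_roots hx
  simp only [Polynomial.IsRoot, Polynomial.eval_add, Polynomial.eval_pow, Polynomial.eval_X,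
    Polynomial.eval_C] at this
  nlinarith [sq_nonneg x]

/-- Otherwise f and P are coprime, and the Bézout identity 1 = af + bP evaluated at T would
annihilate the nonzero vector S. -/
lemma dvd_of_aeval_apply_eq_zero {W : Type*} [AddCommGroup W] [Module ℝ W] {T : Module.End ℝ W}
    {f P : Polynomial ℝ} (hf : Irreducible f) {S : W} (hS : S ≠ 0)
    (h1 : Polynomial.aeval T f S = 0) (h2 : Polynomial.aeval T P S = 0) : f ∣ P := by
  by_contra hfP
  obtain ⟨a, b, hab⟩ := (hf.coprime_iff_not_dvd).2 hfP
  apply hS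
  have := congrArg (fun q => Polynomial.aeval T q S) hab
  simpa [h1, h2] using this.symm

section

variable (A R : Module.End ℝ V) {m : ℕ} (l : Fin m → ℝ) (k j : Fin m)

lemma block_symm : block A R l k j = block A R l j k := by
  unfold block
  by_cases h : k = j
  · subst h; rfl
  · rw [if_neg h, if_neg (Ne.symm h), add_comm]

lemma block11_add_block20 : block11 A R l k j + block20 A R l k j = block A R l k j := by
  unfold block11 block20
  module

end

namespace IsSkewSpectrum

variable {A : Module.End ℝ V} {m : ℕ} {l : Fin m → ℝ} (h : IsSkewSpectrum A l)
  (R : Module.End ℝ V)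

include h

section piece

variable (k j : Fin m)

lemma piece_mul : eigProj A (l j) * R * eigProj A (l k) * A
    = l k • (eigProj A (l j) * R * eigProj A (l k) * complexStr A l) := by
  rw [mul_assoc, h.eigProj_mul, mul_smul_comm, ← mul_assoc]

lemma mul_piece : A * (eigProj A (l j) * R * eigProj A (l k))
    = l j • (complexStr A l * (eigProj A (l j) * R * eigProj A (l k))) := by
  simp only [← mul_assoc]
  rw [h.mul_eigProj, smul_mul_assoc, smul_mul_assoc]

lemma complexStr_sq_mul_piece :
    complexStr A l * (complexStr A l * (eigProj A (l j) * R * eigProj A (l k)))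
      = -(eigProj A (l j) * R * eigProj A (l k)) := by
  have := h.complexStr_sq_mul_eigProj j
  simp only [← mul_assoc] at this ⊢
  rw [this]
  simp

lemma piece_mul_complexStr_sq :
    eigProj A (l j) * R * eigProj A (l k) * complexStr A l * complexStr A l
      = -(eigProj A (l j) * R * eigProj A (l k)) := by
  have := h.eigProj_mul_complexStr_sq k
  rw [mul_assoc, mul_assoc, ← mul_assoc (eigProj A (l k)), this, mul_neg]

end piece

/-- Source and target frequencies agree, so the factor (a - b)/2 vanishes. These blocks are one
reason for the factor X in `aeval_X_mul_eq_zero`. -/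
lemma halfCommutator_block11_self (k : Fin m) :
    halfCommutator A (block11 A R l k k) = 0 := by
  rw [block11, block, if_pos rfl, map_smul, halfCommutator_sub_conj h.commute_complexStr
    (h.piece_mul R k k) (h.mul_piece R k k) (h.complexStr_sq_mul_piece R k k)
    (h.piece_mul_complexStr_sq R k k)]
  simp

/-- The two off-diagonal pieces exchange the roles of the frequencies, but (l k - l j)² is
symmetric, so their sum is still an eigenvector of the squared operator. -/
lemma halfCommutator_sq_block11 (k j : Fin m) :
    halfCommutator A (halfCommutator A (block11 A R l k j))
      = -((l k - l j) ^ 2 / 4) • block11 A R l k j := by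
  by_cases hkj : k = j
  · subst hkj
    rw [h.halfCommutator_block11_self]
    simp
  have e1 := halfCommutator_sq_sub_conj h.commute_complexStr
    (h.piece_mul R k j) (h.mul_piece R k j) (h.complexStr_sq_mul_piece R k j)
    (h.piece_mul_complexStr_sq R k j)
  have e2 := halfCommutator_sq_sub_conj h.commute_complexStr
    (h.piece_mul R j k) (h.mul_piece R j k) (h.complexStr_sq_mul_piece R j k)
    (h.piece_mul_complexStr_sq R j k)
  have e3 : block11 A R l k j = (1 / 2 : ℝ) •
      ((eigProj A (l j) * R * eigProj A (l k)
        - complexStr A l * (eigProj A (l j) * R * eigProj A (l k)) * complexStr A l)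
      + (eigProj A (l k) * R * eigProj A (l j)
        - complexStr A l * (eigProj A (l k) * R * eigProj A (l j)) * complexStr A l)) := by
    rw [block11, block, if_neg hkj, mul_add, add_mul]
    module
  rw [e3, map_smul, map_smul, map_add, map_add, e1, e2]
  module

lemma halfCommutator_sq_block20 (k j : Fin m) :
    halfCommutator A (halfCommutator A (block20 A R l k j))
      = -((l k + l j) ^ 2 / 4) • block20 A R l k j := by
  have e1 := halfCommutator_sq_add_conj h.commute_complexStr
    (h.piece_mul R k j) (h.mul_piece R k j) (h.complexStr_sq_mul_piece R k j)
    (h.piece_mul_complexStr_sq R k j)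
  by_cases hkj : k = j
  · subst hkj
    rw [block20, block, if_pos rfl]
    simp only [map_smul]
    rw [e1]
    module
  have e2 := halfCommutator_sq_add_conj h.commute_complexStr
    (h.piece_mul R j k) (h.mul_piece R j k) (h.complexStr_sq_mul_piece R j k)
    (h.piece_mul_complexStr_sq R j k)
  have e3 : block20 A R l k j = (1 / 2 : ℝ) •
      ((eigProj A (l j) * R * eigProj A (l k)
        + complexStr A l * (eigProj A (l j) * R * eigProj A (l k)) * complexStr A l)
      + (eigProj A (l k) * R * eigProj A (l j)
        + complexStr A l * (eigProj A (l k) * R * eigProj A (l j)) * complexStr A l)) := by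
    rw [block20, block, if_neg hkj, mul_add, add_mul]
    module
  rw [e3, map_smul, map_smul, map_add, map_add, e1, e2]
  module

lemma halfCommutator_sq_zeroBlock (k : Fin m) :
    halfCommutator A (halfCommutator A (zeroBlock A R (l k)))
      = -(l k ^ 2 / 4) • zeroBlock A R (l k) := by
  have e1 := halfCommutator_sq_of_mul_eq_zero (S := eigProj A (l k) * R * kerProj A)
    (b := l k) h.commute_complexStr
    (by rw [h.kerProj_eq, mul_assoc, h.specProj_none_mul, mul_zero])
    (by simp only [← mul_assoc]; rw [h.mul_eigProj, smul_mul_assoc, smul_mul_assoc])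
    (by
      have := h.complexStr_sq_mul_eigProj k
      simp only [← mul_assoc] at this ⊢
      rw [this]; simp)
  have e2 := halfCommutator_sq_of_mul_eq_zero' (S := kerProj A * R * eigProj A (l k))
    (b := l k) h.commute_complexStr
    (by rw [mul_assoc, h.eigProj_mul, mul_smul_comm, ← mul_assoc])
    (by rw [h.kerProj_eq, ← mul_assoc, ← mul_assoc, h.mul_specProj_none, zero_mul, zero_mul])
    (by rw [mul_assoc, mul_assoc, ← mul_assoc (eigProj A (l k)), h.eigProj_mul_complexStr_sq,
          mul_neg])
  rw [zeroBlock]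
  simp only [map_add]
  rw [e1, e2]
  module

section components

variable {P : Polynomial ℝ} {R}

lemma commute_kerProj : Commute A (kerProj A) := h.kerProj_eq ▸ h.commute_specProj none

lemma aeval_block (k j : Fin m) (hP : Polynomial.aeval (halfCommutator A) P R = 0) :
    Polynomial.aeval (halfCommutator A) P (block A R l k j) = 0 := by
  unfold block
  split_ifs with hkj
  · rw [aeval_halfCommutator_mul_mul (h.commute_eigProj _) (h.commute_eigProj _), hP]; simp
  · rw [map_add, aeval_halfCommutator_mul_mul (h.commute_eigProj _) (h.commute_eigProj _),
      aeval_halfCommutator_mul_mul (h.commute_eigProj _) (h.commute_eigProj _), hP]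
    simp

lemma aeval_block11 (k j : Fin m) (hP : Polynomial.aeval (halfCommutator A) P R = 0) :
    Polynomial.aeval (halfCommutator A) P (block11 A R l k j) = 0 := by
  rw [block11, map_smul, map_sub,
    aeval_halfCommutator_mul_mul h.commute_complexStr h.commute_complexStr, h.aeval_block k j hP]
  simp

lemma aeval_block20 (k j : Fin m) (hP : Polynomial.aeval (halfCommutator A) P R = 0) :
    Polynomial.aeval (halfCommutator A) P (block20 A R l k j) = 0 := by
  rw [block20, map_smul, map_add,
    aeval_halfCommutator_mul_mul h.commute_complexStr h.commute_complexStr, h.aeval_block k j hP]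
  simp

lemma aeval_zeroBlock (k : Fin m) (hP : Polynomial.aeval (halfCommutator A) P R = 0) :
    Polynomial.aeval (halfCommutator A) P (zeroBlock A R (l k)) = 0 := by
  rw [zeroBlock, map_add, aeval_halfCommutator_mul_mul (h.commute_eigProj _) h.commute_kerProj,
    aeval_halfCommutator_mul_mul h.commute_kerProj (h.commute_eigProj _), hP]
  simp

lemma dvd_of_block11_ne_zero {k j : Fin m} (hkj : k ≠ j)
    (hP : Polynomial.aeval (halfCommutator A) P R = 0) (hne : block11 A R l k j ≠ 0) :
    Polynomial.X ^ 2 + Polynomial.C ((l k - l j) ^ 2 / 4) ∣ P := by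
  have : l k - l j ≠ 0 := sub_ne_zero.2 (h.injective.ne hkj)
  exact dvd_of_aeval_apply_eq_zero (irreducible_X_sq_add_C (by positivity)) hne
    (aeval_sq_add_apply (h.halfCommutator_sq_block11 R k j)) (h.aeval_block11 k j hP)

lemma dvd_of_block20_ne_zero {k j : Fin m}
    (hP : Polynomial.aeval (halfCommutator A) P R = 0) (hne : block20 A R l k j ≠ 0) :
    Polynomial.X ^ 2 + Polynomial.C ((l k + l j) ^ 2 / 4) ∣ P := by
  have := h.pos k
  have := h.pos j
  exact dvd_of_aeval_apply_eq_zero (irreducible_X_sq_add_C (by positivity)) hne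
    (aeval_sq_add_apply (h.halfCommutator_sq_block20 R k j)) (h.aeval_block20 k j hP)

lemma dvd_of_zeroBlock_ne_zero {k : Fin m}
    (hP : Polynomial.aeval (halfCommutator A) P R = 0) (hne : zeroBlock A R (l k) ≠ 0) :
    Polynomial.X ^ 2 + Polynomial.C (l k ^ 2 / 4) ∣ P := by
  have := h.pos k
  exact dvd_of_aeval_apply_eq_zero (irreducible_X_sq_add_C (by positivity)) hne
    (aeval_sq_add_apply (h.halfCommutator_sq_zeroBlock R k)) (h.aeval_zeroBlock k hP)

end components

/-- If all factors belonging to nonzero components of `R` divide `Q`, then `X * Q` annihilates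
`R`. -/
theorem aeval_X_mul_eq_zero {Q : Polynomial ℝ}
    (h0 : ∀ k, zeroBlock A R (l k) = 0 ∨ Polynomial.X ^ 2 + Polynomial.C (l k ^ 2 / 4) ∣ Q)
    (h11 : ∀ k j, k < j → block11 A R l k j = 0 ∨
      Polynomial.X ^ 2 + Polynomial.C ((l k - l j) ^ 2 / 4) ∣ Q)
    (h20 : ∀ k j, k ≤ j → block20 A R l k j = 0 ∨
      Polynomial.X ^ 2 + Polynomial.C ((l k + l j) ^ 2 / 4) ∣ Q) :
    Polynomial.aeval (halfCommutator A) (Polynomial.X * Q) R = 0 := by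
  set N := Polynomial.aeval (halfCommutator A) (Polynomial.X * Q) with hN
  have hX : ∀ S, halfCommutator A S = 0 → N S = 0 := fun S hS =>
    aeval_apply_eq_zero_of_dvd (dvd_mul_right _ _) (by simpa using hS)
  have hQ : ∀ (S : Module.End ℝ V) (c : ℝ),
      halfCommutator A (halfCommutator A S) = -c • S →
      (S = 0 ∨ Polynomial.X ^ 2 + Polynomial.C c ∣ Q) → N S = 0 := by
    rintro S c hS (rfl | hd)
    · exact map_zero N
    · exact aeval_apply_eq_zero_of_dvd (hd.mul_left _) (aeval_sq_add_apply hS)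
  have hblock : ∀ k j, k ≤ j → N (block A R l k j) = 0 := by
    intro k j hkj
    rw [← block11_add_block20, map_add,
      hQ _ _ (h.halfCommutator_sq_block20 R k j) (h20 k j hkj), add_zero]
    rcases hkj.eq_or_lt with rfl | hlt
    · exact hX _ (h.halfCommutator_block11_self R k)
    · exact hQ _ _ (h.halfCommutator_sq_block11 R k j) (h11 k j hlt)
  have hblock' : ∀ k j, N (block A R l k j) = 0 := fun k j =>
    (le_total k j).elim (hblock k j) fun hjk => block_symm A R l k j ▸ hblock j k hjk
  have hzero : ∀ k, N (zeroBlock A R (l k)) = 0 := fun k =>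
    hQ _ _ (h.halfCommutator_sq_zeroBlock R k) (h0 k)
  -- N commutes with multiplication by spectral projections on either side. Each piece π_i R π_j can
  -- thus be cut out of a block already known to be annihilated, and these pieces add up to R.
  have hconj : ∀ i j (S : Module.End ℝ V), N S = 0 → N (specProj A l i * S * specProj A l j) = 0 :=
    fun i j S hS => by
      rw [hN, aeval_halfCommutator_mul_mul (h.commute_specProj i) (h.commute_specProj j), ← hN, hS]
      simp
  have hid : ∀ i (S : Module.End ℝ V), specProj A l i * (specProj A l i * S) = specProj A l i * S :=
    fun i S => by rw [← mul_assoc, h.specProj_mul_self]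
  have hne : ∀ {i j} (_ : i ≠ j) (S : Module.End ℝ V),
      specProj A l i * (specProj A l j * S) = 0 :=
    fun hij S => by rw [← mul_assoc, h.specProj_mul_of_ne hij, zero_mul]
  have hpiece : ∀ i j, N (specProj A l i * R * specProj A l j) = 0 := by
    rintro (_ | i) (_ | j)
    -- The piece on the kernel of A is annihilated by 𝒯 itself, hence by the factor X.
    · refine hX _ ?_
      rw [halfCommutator_apply, mul_assoc, h.specProj_none_mul, ← mul_assoc, ← mul_assoc,
        h.mul_specProj_none]
      simp
    · convert hconj none (some j) _ (hzero j) using 2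
      simp only [zeroBlock, h.kerProj_eq, ← specProj_some, mul_add, add_mul, mul_assoc, hid,
        h.specProj_mul_self]
      rw [hne (by simp)]
      simp
    · convert hconj (some i) none _ (hzero i) using 2
      simp only [zeroBlock, h.kerProj_eq, ← specProj_some, mul_add, add_mul, mul_assoc, hid,
        h.specProj_mul_self]
      rw [hne (by simp)]
      simp
    · convert hconj (some i) (some j) _ (hblock' j i) using 2
      unfold block
      split_ifs with hij
      · subst hij
        simp only [← specProj_some, mul_assoc, hid, h.specProj_mul_self]
      · simp only [← specProj_some, mul_add, add_mul, mul_assoc, hid, h.specProj_mul_self]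
        rw [hne (by simpa using Ne.symm hij)]
        simp
  have hR : R = ∑ i, ∑ j, specProj A l i * R * specProj A l j := by
    simp_rw [← Finset.mul_sum, ← Finset.sum_mul, h.sum_specProj]
    simp
  rw [hR]
  simp only [map_sum, hpiece, Finset.sum_const_zero]

end IsSkewSpectrum

end BlockRelations

/-! ### Analyticity of functions determined by their power sums. -/

section PowerSums

open Filter Topology in
/-- Pairwise different continuous functions whose weighted power sums are analytic are analytic. -/
theorem contDiffAt_of_powerSums {W : Type*} [NormedAddCommGroup W] [NormedSpace ℝ W] {m : ℕ}
    {y : W → Fin m → ℝ} {w₀ : W} (hy : ContinuousAt y w₀) (hinj : Function.Injective (y w₀))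
    {d : Fin m → ℝ} (hd : ∀ k, d k ≠ 0) {p : W → Fin m → ℝ} (hp : ContDiffAt ℝ ω p w₀)
    (h : ∀ᶠ w in 𝓝 w₀, ∀ j : Fin m, ∑ k, d k * y w k ^ ((j : ℕ) + 1) = p w j) :
    ContDiffAt ℝ ω y w₀ := by
  set Ψ : (Fin m → ℝ) → Fin m → ℝ := fun z j => ∑ k, d k * z k ^ ((j : ℕ) + 1) with hΨ
  -- The Jacobian matrix of the power sum map at `y w₀`. Its determinant is a nonzero multiple of a
  -- Vandermonde determinant, so distinct values and nonzero weights make it invertible.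
  set N : Matrix (Fin m) (Fin m) ℝ :=
    Matrix.diagonal (fun j : Fin m => ((j : ℕ) : ℝ) + 1) * (Matrix.vandermonde (y w₀)).transpose *
      Matrix.diagonal d with hN
  have hdet : IsUnit N := by
    rw [Matrix.isUnit_iff_isUnit_det, isUnit_iff_ne_zero, hN, Matrix.det_mul, Matrix.det_mul,
      Matrix.det_diagonal, Matrix.det_diagonal, Matrix.det_transpose]
    refine mul_ne_zero (mul_ne_zero ?_ (Matrix.det_vandermonde_ne_zero_iff.2 hinj)) ?_
    · exact Finset.prod_ne_zero_iff.2 fun j _ => by positivity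
    · exact Finset.prod_ne_zero_iff.2 fun j _ => hd j
  set L : (Fin m → ℝ) ≃L[ℝ] (Fin m → ℝ) := (LinearEquiv.ofInjectiveEndo (Matrix.mulVecLin N)
    (Matrix.mulVec_injective_iff_isUnit.2 hdet)).toContinuousLinearEquiv with hL
  have hLapp : ∀ z j, L z j = ∑ k, d k * (((j : ℕ) + 1) * y w₀ k ^ (j : ℕ) * z k) := by
    intro z j
    change Matrix.mulVec N z j = _
    simp only [Matrix.mulVec, dotProduct, hN, Matrix.mul_diagonal, Matrix.diagonal_mul,
      Matrix.transpose_apply, Matrix.vandermonde_apply]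
    exact Finset.sum_congr rfl fun k _ => by ring
  have hderiv : HasFDerivAt Ψ (L : (Fin m → ℝ) →L[ℝ] (Fin m → ℝ)) (y w₀) := by
    rw [hasFDerivAt_pi']
    intro j
    have h1 : HasFDerivAt (fun z : Fin m → ℝ => ∑ k, d k * z k ^ ((j : ℕ) + 1))
        (∑ k, d k • ((((j : ℕ) + 1 : ℕ) * y w₀ k ^ (j : ℕ)) •
          ContinuousLinearMap.proj (R := ℝ) (φ := fun _ : Fin m => ℝ) k)) (y w₀) := by
      refine HasFDerivAt.fun_sum fun k _ => HasFDerivAt.const_mul ?_ _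
      simpa using (hasFDerivAt_apply (𝕜 := ℝ) (F' := fun _ : Fin m => ℝ) k (y w₀)).pow ((j : ℕ) + 1)
    refine h1.congr_fderiv ?_
    ext z
    simp [hLapp]
  have hsmooth : ContDiffAt ℝ ω Ψ (y w₀) := by
    refine ContDiff.contDiffAt (contDiff_pi.2 fun j => ?_)
    exact ContDiff.sum fun k _ => contDiff_const.mul ((contDiff_apply ℝ ℝ k).pow _)
  have hstrict := hsmooth.hasStrictFDerivAt' hderiv (by simp)
  have hev : ∀ᶠ z in 𝓝 (y w₀), hsmooth.localInverse hderiv (by simp) (Ψ z) = z :=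
    hstrict.eventually_left_inverse
  have hΨp : Ψ (y w₀) = p w₀ := funext h.self_of_nhds
  have hinv := hsmooth.to_localInverse hderiv (by simp)
  rw [hΨp] at hinv
  refine (hinv.comp w₀ hp).congr_of_eventuallyEq ?_
  -- Continuity of y keeps `y w` in the region where the local inverse undoes Ψ; without it the
  -- power sums could select another preimage.
  filter_upwards [hy.eventually hev, h] with w hw1 hw2
  rw [Function.comp_apply, ← funext hw2]
  exact hw1.symm

end PowerSums

/-! ### Spectral projections as polynomials in -A², and traces of powers. -/

section Lagrange

variable {V : Type*} [NormedAddCommGroup V] [InnerProductSpace ℝ V] [FiniteDimensional ℝ V]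
  {A : Module.End ℝ V} {m : ℕ} {l : Fin m → ℝ}

/-- The Lagrange polynomial in `-A²` that describes the projection `specProj A l i`. -/
def lagrangePoly {m : ℕ} (l : Fin m → ℝ) (i : Option (Fin m)) : Polynomial ℝ :=
  ∏ j ∈ Finset.univ.erase i,
    Polynomial.C (spectrumWithZero l i ^ 2 - spectrumWithZero l j ^ 2)⁻¹ *
      (Polynomial.X - Polynomial.C (spectrumWithZero l j ^ 2))

namespace IsSkewSpectrum

variable (h : IsSkewSpectrum A l)
include h

lemma aeval_mul_specProj (p : Polynomial ℝ) (i : Option (Fin m)) :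
    Polynomial.aeval (-(A * A)) p * specProj A l i
      = p.eval (spectrumWithZero l i ^ 2) • specProj A l i := by
  induction p using Polynomial.induction_on' with
  | add p q hp hq => rw [map_add, add_mul, hp, hq, Polynomial.eval_add, add_smul]
  | monomial n a =>
    have hn : (-(A * A)) ^ n * specProj A l i
        = (spectrumWithZero l i ^ 2) ^ n • specProj A l i := by
      induction n with
      | zero => simp
      | succ n ih =>
        rw [pow_succ (-(A * A)) n, mul_assoc, specProj, negSq_mul_eigProj, mul_smul_comm,
          ← specProj, ih, smul_smul, ← pow_succ' (spectrumWithZero l i ^ 2)]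
    rw [Polynomial.aeval_monomial, mul_assoc, hn, Polynomial.eval_monomial, mul_smul_comm,
      ← Algebra.smul_def, smul_smul, mul_comm]

lemma aeval_eq_sum (p : Polynomial ℝ) :
    Polynomial.aeval (-(A * A)) p = ∑ i, p.eval (spectrumWithZero l i ^ 2) • specProj A l i := by
  simp_rw [← h.aeval_mul_specProj, ← Finset.mul_sum, h.sum_specProj, mul_one]

/-- Lagrange interpolation: the polynomial is one at the i-th eigenvalue of -A² and zero at the
others. This makes the dependence of the projection on A and l explicit, whence its continuity. -/
lemma specProj_eq_aeval (i : Option (Fin m)) :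
    specProj A l i = Polynomial.aeval (-(A * A)) (lagrangePoly l i) := by
  rw [h.aeval_eq_sum, Finset.sum_eq_single i]
  · rw [lagrangePoly, Polynomial.eval_prod, Finset.prod_eq_one, one_smul]
    intro j hj
    have : spectrumWithZero l i ^ 2 - spectrumWithZero l j ^ 2 ≠ 0 :=
      sub_ne_zero.2 fun e => (Finset.ne_of_mem_erase hj) (h.spectrumWithZero_sq_injective e).symm
    simp [this]
  · intro j _ hj
    rw [lagrangePoly, Polynomial.eval_prod, Finset.prod_eq_zero (Finset.mem_erase.2
      ⟨hj, Finset.mem_univ j⟩), zero_smul]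
    simp
  · simp

/-- Take traces in the spectral decomposition. The positive exponent removes the kernel, and the
weights are the multiplicities of the eigenvalues. -/
lemma trace_negSq_pow (n : ℕ) :
    LinearMap.trace ℝ V ((-(A * A)) ^ (n + 1))
      = ∑ k, LinearMap.trace ℝ V (eigProj A (l k)) * (l k ^ 2) ^ (n + 1) := by
  have := h.aeval_eq_sum (Polynomial.X ^ (n + 1))
  rw [map_pow, Polynomial.aeval_X] at this
  rw [this, Fintype.sum_option]
  simp [mul_comm]

end IsSkewSpectrum

lemma trace_eigProj (A : Module.End ℝ V) (c : ℝ) : LinearMap.trace ℝ V (eigProj A c)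
    = Module.finrank ℝ (Module.End.eigenspace (-(A * A)) (c ^ 2)) := by
  refine LinearMap.IsProj.trace ⟨fun v => ?_, fun v hv => ?_⟩
  · exact Submodule.starProjection_apply_mem _ v
  · exact eigProj_apply_of_mem A hv

lemma IsSkewSpectrum.trace_eigProj_ne_zero (h : IsSkewSpectrum A l) (k : Fin m) :
    LinearMap.trace ℝ V (eigProj A (l k)) ≠ 0 := by
  rw [trace_eigProj, Nat.cast_ne_zero]
  have := (h.eigenvalues _ (pow_ne_zero 2 (h.pos k).ne')).2 ⟨k, rfl⟩
  intro h0
  exact this (Submodule.finrank_eq_zero.1 h0)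

end Lagrange

/-! ### Continuous dependence of the spectral data and of the blocks. -/

section Continuity

variable {T : Type*} [TopologicalSpace T]

/-- The polynomial itself varies with the parameter, as `lagrangePoly` does through the eigenvalues.
-/
lemma continuousOn_aeval_prod {𝔸 : Type*} [NormedRing 𝔸] [NormedAlgebra ℝ 𝔸] {ι : Type*}
    (s : Finset ι) {c ν : ι → T → ℝ} {B : T → 𝔸} {U : Set T} (hc : ∀ j ∈ s, ContinuousOn (c j) U)
    (hν : ∀ j ∈ s, ContinuousOn (ν j) U) (hB : ContinuousOn B U) :
    ContinuousOn (fun X => Polynomial.aeval (B X)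
      (∏ j ∈ s, Polynomial.C (c j X) * (Polynomial.X - Polynomial.C (ν j X)))) U := by
  classical
  induction s using Finset.induction_on with
  | empty => simpa using continuousOn_const
  | insert a s ha ih =>
    simp only [Finset.prod_insert ha, map_mul, map_sub, Polynomial.aeval_C, Polynomial.aeval_X]
    refine ContinuousOn.mul (ContinuousOn.mul ?_ (hB.sub ?_))
      (ih (fun j hj => hc j (Finset.mem_insert_of_mem hj))
        fun j hj => hν j (Finset.mem_insert_of_mem hj))
    · exact (continuous_algebraMap ℝ 𝔸).comp_continuousOn (hc a (Finset.mem_insert_self a s))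
    · exact (continuous_algebraMap ℝ 𝔸).comp_continuousOn (hν a (Finset.mem_insert_self a s))

variable {V : Type*} [NormedAddCommGroup V] [InnerProductSpace ℝ V] [FiniteDimensional ℝ V]
  {m : ℕ}

/-- Endomorphisms of a finite dimensional space as continuous linear maps. -/
abbrev endCLM (V : Type*) [NormedAddCommGroup V] [InnerProductSpace ℝ V] [FiniteDimensional ℝ V] :
    Module.End ℝ V ≃ₐ[ℝ] (V →L[ℝ] V) :=
  Module.End.toContinuousLinearMap V

/-- A family of endomorphisms with a continuous family of eigenvalues. -/
structure IsContinuousSpectrum (A : T → Module.End ℝ V) (U : Set T) (lam : Fin m → T → ℝ) :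
    Prop where
  spec : ∀ X ∈ U, IsSkewSpectrum (A X) fun k => lam k X
  cont : ∀ k, ContinuousOn (lam k) U
  contEnd : ContinuousOn (fun X => endCLM V (A X)) U

namespace IsContinuousSpectrum

variable {A : T → Module.End ℝ V} {U : Set T} {lam : Fin m → T → ℝ}
  (h : IsContinuousSpectrum A U lam)
include h

lemma continuousOn_spectrumWithZero (i : Option (Fin m)) :
    ContinuousOn (fun X => spectrumWithZero (fun k => lam k X) i) U := by
  rcases i with _ | k
  · simpa using continuousOn_const
  · exact h.cont k

lemma continuousOn_specProj (i : Option (Fin m)) :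
    ContinuousOn (fun X => endCLM V (specProj (A X) (fun k => lam k X) i)) U := by
  have hB : ContinuousOn (fun X => -(endCLM V (A X) * endCLM V (A X))) U :=
    (h.contEnd.mul h.contEnd).neg
  refine (continuousOn_aeval_prod (Finset.univ.erase i)
    (c := fun j X => (spectrumWithZero (fun k => lam k X) i ^ 2
      - spectrumWithZero (fun k => lam k X) j ^ 2)⁻¹)
    (ν := fun j X => spectrumWithZero (fun k => lam k X) j ^ 2)
    (fun j hj => ?_) (fun j _ => (h.continuousOn_spectrumWithZero j).pow 2) hB).congr ?_
  · refine ContinuousOn.inv₀ (((h.continuousOn_spectrumWithZero i).pow 2).sub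
      ((h.continuousOn_spectrumWithZero j).pow 2)) fun X hX => sub_ne_zero.2 fun e => ?_
    exact (Finset.ne_of_mem_erase hj) ((h.spec X hX).spectrumWithZero_sq_injective e).symm
  · intro X hX
    beta_reduce
    rw [(h.spec X hX).specProj_eq_aeval, lagrangePoly, ← Polynomial.aeval_algHom_apply]
    simp

lemma continuousOn_eigProj (k : Fin m) :
    ContinuousOn (fun X => endCLM V (eigProj (A X) (lam k X))) U :=
  h.continuousOn_specProj (some k)

lemma continuousOn_kerProj : ContinuousOn (fun X => endCLM V (kerProj (A X))) U :=
  (h.continuousOn_specProj none).congr fun X hX => by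
    beta_reduce; rw [(h.spec X hX).kerProj_eq]

lemma continuousOn_complexStr :
    ContinuousOn (fun X => endCLM V (complexStr (A X) fun k => lam k X)) U := by
  simp only [complexStr, map_sum, map_smul, map_mul]
  exact continuousOn_finsetSum _ fun k _ => ContinuousOn.smul
    ((h.cont k).inv₀ fun X hX => ((h.spec X hX).pos k).ne')
    (h.contEnd.mul (h.continuousOn_eigProj k))

variable {R : T → Module.End ℝ V} (hR : ContinuousOn (fun X => endCLM V (R X)) U)
include hR

lemma continuousOn_zeroBlock (k : Fin m) :
    ContinuousOn (fun X => endCLM V (zeroBlock (A X) (R X) (lam k X))) U := by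
  simp only [zeroBlock, map_add, map_mul]
  exact ((((h.continuousOn_eigProj k).mul hR).mul h.continuousOn_kerProj).add
    ((h.continuousOn_kerProj.mul hR).mul (h.continuousOn_eigProj k)))

lemma continuousOn_block (k j : Fin m) :
    ContinuousOn (fun X => endCLM V (block (A X) (R X) (fun i => lam i X) k j)) U := by
  unfold block
  split_ifs
  · simp only [map_mul]
    exact ((h.continuousOn_eigProj k).mul hR).mul (h.continuousOn_eigProj k)
  · simp only [map_add, map_mul]
    exact (((h.continuousOn_eigProj j).mul hR).mul (h.continuousOn_eigProj k)).add
      (((h.continuousOn_eigProj k).mul hR).mul (h.continuousOn_eigProj j))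

lemma continuousOn_block11 (k j : Fin m) :
    ContinuousOn (fun X => endCLM V (block11 (A X) (R X) (fun i => lam i X) k j)) U := by
  simp only [block11, map_sub, map_mul, map_smul]
  exact ContinuousOn.const_smul ((h.continuousOn_block hR k j).sub
    ((h.continuousOn_complexStr.mul (h.continuousOn_block hR k j)).mul h.continuousOn_complexStr)) (1 / 2 : ℝ)

lemma continuousOn_block20 (k j : Fin m) :
    ContinuousOn (fun X => endCLM V (block20 (A X) (R X) (fun i => lam i X) k j)) U := by
  simp only [block20, map_add, map_mul, map_smul]
  exact ContinuousOn.const_smul ((h.continuousOn_block hR k j).add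
    ((h.continuousOn_complexStr.mul (h.continuousOn_block hR k j)).mul h.continuousOn_complexStr)) (1 / 2 : ℝ)

end IsContinuousSpectrum

/-- The trace as a continuous linear functional. -/
def traceCLM (V : Type*) [NormedAddCommGroup V] [InnerProductSpace ℝ V] [FiniteDimensional ℝ V] :
    (V →L[ℝ] V) →L[ℝ] ℝ :=
  LinearMap.toContinuousLinearMap
    (LinearMap.trace ℝ V ∘ₗ ((endCLM V).symm.toLinearMap : (V →L[ℝ] V) →ₗ[ℝ] Module.End ℝ V))

lemma traceCLM_endCLM (S : Module.End ℝ V) : traceCLM V (endCLM V S) = LinearMap.trace ℝ V S := by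
  simp [traceCLM]

-- The multiplicity is a natural number and, as the trace of a continuous family of projections,
-- depends continuously on the parameter; two integers at distance less than one coincide.
open Topology in
lemma IsContinuousSpectrum.eventually_trace_eigProj_eq {A : T → Module.End ℝ V} {U : Set T}
    {lam : Fin m → T → ℝ} (h : IsContinuousSpectrum A U lam) (hU : IsOpen U) {Y : T} (hY : Y ∈ U)
    (k : Fin m) : ∀ᶠ X in 𝓝 Y, LinearMap.trace ℝ V (eigProj (A X) (lam k X))
      = LinearMap.trace ℝ V (eigProj (A Y) (lam k Y)) := by
  have hc : ContinuousAt (fun X => LinearMap.trace ℝ V (eigProj (A X) (lam k X))) Y := by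
    simp only [← traceCLM_endCLM]
    exact (traceCLM V).continuous.continuousAt.comp
      ((h.continuousOn_eigProj k).continuousAt (hU.mem_nhds hY))
  filter_upwards [hc.eventually (Metric.ball_mem_nhds _ one_pos)] with X hX
  rw [trace_eigProj, trace_eigProj] at hX ⊢
  rw [Real.dist_eq, abs_lt] at hX
  have h1 := hX.1
  have h2 := hX.2
  rw [neg_lt_sub_iff_lt_add] at h1
  rw [sub_lt_iff_lt_add] at h2
  norm_cast at h1 h2 ⊢
  omega

end Continuity

/-! ### Cones over subsets of the unit sphere. -/

section SphereCone

open Filter Topology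

variable {V : Type*} [NormedAddCommGroup V] [InnerProductSpace ℝ V]

/-- The radial projection onto the unit sphere, with value `X₀` at the origin. -/
def sphereProj (X₀ : Metric.sphere (0 : V) 1) (v : V) : Metric.sphere (0 : V) 1 :=
  open scoped Classical in
  if h : v = 0 then X₀ else ⟨‖v‖⁻¹ • v, by simp [norm_smul, h]⟩

lemma coe_sphereProj (X₀ : Metric.sphere (0 : V) 1) {v : V} (hv : v ≠ 0) :
    (sphereProj X₀ v : V) = ‖v‖⁻¹ • v := by
  simp [sphereProj, hv]

lemma coe_sphere_ne_zero (X : Metric.sphere (0 : V) 1) : (X : V) ≠ 0 := by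
  intro h
  have := norm_eq_of_mem_sphere X
  simp [h] at this

lemma sphereProj_smul_coe (X₀ X : Metric.sphere (0 : V) 1) {t : ℝ} (ht : 0 < t) :
    sphereProj X₀ (t • (X : V)) = X := by
  apply Subtype.ext
  rw [coe_sphereProj _ (smul_ne_zero ht.ne' (coe_sphere_ne_zero X)), norm_smul,
    norm_eq_of_mem_sphere, Real.norm_of_nonneg ht.le, mul_one, smul_smul, inv_mul_cancel₀ ht.ne',
    one_smul]

@[simp] lemma sphereProj_coe (X₀ X : Metric.sphere (0 : V) 1) : sphereProj X₀ (X : V) = X := by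
  simpa using sphereProj_smul_coe X₀ X one_pos

lemma continuousOn_sphereProj (X₀ : Metric.sphere (0 : V) 1) :
    ContinuousOn (sphereProj X₀) {0}ᶜ := by
  rw [Topology.IsInducing.subtypeVal.continuousOn_iff]
  have : ContinuousOn (fun v : V => ‖v‖⁻¹ • v) {0}ᶜ :=
    (continuousOn_id.norm.inv₀ fun v hv => norm_ne_zero_iff.2 hv).smul continuousOn_id
  exact this.congr fun v hv => coe_sphereProj X₀ hv

/-- The open cone spanned by a subset of the unit sphere. -/
def sphereCone (X₀ : Metric.sphere (0 : V) 1) (U : Set (Metric.sphere (0 : V) 1)) : Set V :=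
  {0}ᶜ ∩ sphereProj X₀ ⁻¹' U

variable (X₀ : Metric.sphere (0 : V) 1) {U : Set (Metric.sphere (0 : V) 1)}

lemma isOpen_sphereCone (hU : IsOpen U) : IsOpen (sphereCone X₀ U) :=
  (continuousOn_sphereProj X₀).isOpen_inter_preimage isOpen_compl_singleton hU

lemma coe_mem_sphereCone {X : Metric.sphere (0 : V) 1} (hX : X ∈ U) :
    (X : V) ∈ sphereCone X₀ U :=
  ⟨coe_sphere_ne_zero X, by simpa using hX⟩

/-- Polar coordinates. They give the connectedness of the cone and reduce homogeneous identities on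
it to unit vectors. -/
lemma sphereCone_eq_image : sphereCone X₀ U
    = (fun q : ℝ × Metric.sphere (0 : V) 1 => q.1 • (q.2 : V)) '' (Set.Ioi 0 ×ˢ U) := by
  ext v
  constructor
  · rintro ⟨hv, hU⟩
    have hv' : v ≠ 0 := hv
    refine ⟨(‖v‖, sphereProj X₀ v), ⟨norm_pos_iff.2 hv', hU⟩, ?_⟩
    simp [coe_sphereProj X₀ hv', smul_smul, hv']
  · rintro ⟨⟨t, X⟩, ⟨ht, hX⟩, rfl⟩
    refine ⟨smul_ne_zero (Set.mem_Ioi.1 ht).ne' (coe_sphere_ne_zero X), ?_⟩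
    change sphereProj X₀ (t • (X : V)) ∈ U
    rwa [sphereProj_smul_coe X₀ X ht]

lemma isPreconnected_sphereCone (hU : IsPreconnected U) : IsPreconnected (sphereCone X₀ U) := by
  rw [sphereCone_eq_image]
  exact (isPreconnected_Ioi.prod hU).image _
    (continuous_fst.smul (continuous_subtype_val.comp continuous_snd)).continuousOn

/-- The identity theorem for the radially constant extension of c. Passing to the open cone allows
analyticity to be used in a vector space rather than on the sphere. -/
lemma eq_of_eventually_eq_of_analyticOnNhd (hU : IsPreconnected U)
    {c : Metric.sphere (0 : V) 1 → ℝ}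
    (hc : AnalyticOnNhd ℝ (fun v => c (sphereProj X₀ v)) (sphereCone X₀ U))
    {Y : Metric.sphere (0 : V) 1} (hY : Y ∈ U) (hcY : ∀ᶠ X in 𝓝 Y, c X = c Y) :
    ∀ X ∈ U, c X = c Y := by
  intro X hX
  have hcont : ContinuousAt (sphereProj X₀) (Y : V) :=
    (continuousOn_sphereProj X₀).continuousAt
      (isOpen_compl_singleton.mem_nhds (coe_sphere_ne_zero Y))
  have hev : (fun v => c (sphereProj X₀ v)) =ᶠ[𝓝 (Y : V)] fun _ => c Y := by
    rw [ContinuousAt, sphereProj_coe] at hcont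
    exact hcont.eventually hcY
  simpa using hc.eqOn_of_preconnected_of_eventuallyEq analyticOnNhd_const
    (isPreconnected_sphereCone X₀ hU) (coe_mem_sphereCone X₀ hY) hev (coe_mem_sphereCone X₀ hX)

end SphereCone

/-! ### Analyticity and local constancy of the eigenvalues. -/

section AnalyticEigenvalues

open Filter Topology

variable {V : Type*} [NormedAddCommGroup V] [InnerProductSpace ℝ V] [FiniteDimensional ℝ V]
  {m : ℕ} {τ : V →ₗ[ℝ] Module.End ℝ V} {U : Set (Metric.sphere (0 : V) 1)}
  {lam : Fin m → Metric.sphere (0 : V) 1 → ℝ}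

lemma contDiff_endCLM_linear (τ : V →ₗ[ℝ] Module.End ℝ V) {n : WithTop ℕ∞} :
    ContDiff ℝ n fun v => endCLM V (τ v) :=
  (LinearMap.toContinuousLinearMap ((endCLM V).toLinearMap ∘ₗ τ)).contDiff

/-- The squares of the eigenvalues are pairwise different and continuous, and their power sums
weighted by multiplicity are traces of powers of -τ_X², which are analytic away from the origin;
`contDiffAt_of_powerSums` applies. -/
lemma analyticOnNhd_eigenvalue
    (h : IsContinuousSpectrum (fun X : Metric.sphere (0 : V) 1 => τ (X : V)) U lam)
    (hU : IsOpen U) (X₀ : Metric.sphere (0 : V) 1) (k : Fin m) :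
    AnalyticOnNhd ℝ (fun v => lam k (sphereProj X₀ v)) (sphereCone X₀ U) := by
  rintro v₀ ⟨hv₀, hY⟩
  have hv₀' : v₀ ≠ 0 := hv₀
  set Y := sphereProj X₀ v₀ with hYdef
  change Y ∈ U at hY
  have hcont : Tendsto (sphereProj X₀) (𝓝 v₀) (𝓝 Y) :=
    (continuousOn_sphereProj X₀).continuousAt (isOpen_compl_singleton.mem_nhds hv₀)
  have hlam : ∀ j, Tendsto (fun v => lam j (sphereProj X₀ v)) (𝓝 v₀) (𝓝 (lam j Y)) := fun j =>
    Tendsto.comp ((h.cont j).continuousAt (hU.mem_nhds hY)) hcont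
  have hspec := h.spec Y hY
  have key : ContDiffAt ℝ ω (fun v j => lam j (sphereProj X₀ v) ^ 2) v₀ := by
    refine contDiffAt_of_powerSums (d := fun j => LinearMap.trace ℝ V (eigProj (τ (Y : V)) (lam j Y)))
      (p := fun v (j : Fin m) => traceCLM V ((-(endCLM V (τ (‖v‖⁻¹ • v)) *
        endCLM V (τ (‖v‖⁻¹ • v)))) ^ ((j : ℕ) + 1)))
      (tendsto_pi_nhds.2 fun j => (hlam j).pow 2) ?_ (fun j => hspec.trace_eigProj_ne_zero j) ?_ ?_
    · intro i j hij
      exact hspec.injective ((pow_left_inj₀ (hspec.pos i).le (hspec.pos j).le two_ne_zero).1 hij)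
    · refine contDiffAt_pi.2 fun j => ?_
      have h1 : ContDiffAt ℝ ω (fun v : V => ‖v‖⁻¹ • v) v₀ :=
        ((contDiffAt_norm ℝ hv₀').inv (norm_ne_zero_iff.2 hv₀')).smul contDiffAt_id
      have h2 : ContDiffAt ℝ ω (fun v : V => endCLM V (τ (‖v‖⁻¹ • v))) v₀ :=
        (contDiff_endCLM_linear τ).contDiffAt.comp v₀ h1
      exact (traceCLM V).contDiff.contDiffAt.comp v₀ ((h2.mul h2).neg.pow _)
    -- The weights were frozen at Y; this is legitimate because multiplicities are locally constant.
    · have htr : ∀ᶠ X : Metric.sphere (0 : V) 1 in 𝓝 Y, ∀ j, LinearMap.trace ℝ V (eigProj (τ (X : V)) (lam j X))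
          = LinearMap.trace ℝ V (eigProj (τ (Y : V)) (lam j Y)) :=
        eventually_all.2 fun j => h.eventually_trace_eigProj_eq hU hY j
      filter_upwards [hcont.eventually htr, hcont.eventually (hU.mem_nhds hY),
        isOpen_compl_singleton.mem_nhds hv₀] with v h1 h2 h3 j
      have h4 := (h.spec _ h2).trace_negSq_pow j
      simp only [h1] at h4
      simp only [coe_sphereProj X₀ h3] at h4
      rw [← map_mul, ← map_neg, ← map_pow, traceCLM_endCLM, h4]
  have hk := (contDiffAt_pi.1 key k).sqrt (pow_ne_zero 2 (hspec.pos k).ne')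
  refine (hk.congr_of_eventuallyEq ?_).analyticAt
  filter_upwards [hcont.eventually (hU.mem_nhds hY)] with v hv
  exact (Real.sqrt_sq ((h.spec _ hv).pos k).le).symm

/-- Each such r produces the complex root ir/2 of P, and different r produce different roots. -/
lemma finite_setOf_X_sq_add_C_dvd {P : Polynomial ℝ} (hP : P ≠ 0) :
    {r : ℝ | Polynomial.X ^ 2 + Polynomial.C (r ^ 2 / 4) ∣ P}.Finite := by
  have hP' : P.map (algebraMap ℝ ℂ) ≠ 0 :=
    (Polynomial.map_ne_zero_iff (algebraMap ℝ ℂ).injective).2 hP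
  refine Set.Finite.of_injOn (f := fun r : ℝ => (r / 2 : ℂ) * Complex.I)
    (t := {z | z ∈ (P.map (algebraMap ℝ ℂ)).roots}) ?_ ?_ ?_
  · rintro r ⟨D, hD⟩
    rw [Set.mem_ofPred_eq, Polynomial.mem_roots hP', Polynomial.IsRoot, hD]
    simp only [Polynomial.map_mul, Polynomial.map_add, Polynomial.map_pow, Polynomial.map_X,
      Polynomial.map_C, Polynomial.eval_mul, Polynomial.eval_add, Polynomial.eval_pow,
      Polynomial.eval_X, Polynomial.eval_C, mul_pow, Complex.I_sq]
    push_cast [Complex.coe_algebraMap]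
    ring
  · intro r _ s _ hrs
    have := mul_right_cancel₀ Complex.I_ne_zero hrs
    have h2 : (r : ℂ) = s := by linear_combination 2 * this
    exact_mod_cast h2
  · exact (P.map (algebraMap ℝ ℂ)).roots.toFinset.finite_toSet.subset fun z hz => by
      simpa using hz

/-- Near Y the component S stays nonzero, so c takes values in the finite set of frequencies allowed
by P; a continuous function into a finite set is locally constant. -/
lemma eventually_eq_of_dvd {T : Type*} [TopologicalSpace T] {U : Set T} (hU : IsOpen U)
    {P : Polynomial ℝ} (hP : P ≠ 0) {c : T → ℝ} (hc : ContinuousOn c U) {S : T → Module.End ℝ V}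
    (hS : ContinuousOn (fun X => endCLM V (S X)) U)
    (hd : ∀ X ∈ U, S X ≠ 0 → Polynomial.X ^ 2 + Polynomial.C (c X ^ 2 / 4) ∣ P)
    {Y : T} (hY : Y ∈ U) (hSY : S Y ≠ 0) : ∀ᶠ X in 𝓝 Y, c X = c Y := by
  have hUY := hU.mem_nhds hY
  have hfin := (finite_setOf_X_sq_add_C_dvd hP).subset
    (Set.sdiff_subset (t := {c Y}))
  have h1 : ∀ᶠ X in 𝓝 Y, c X ∉
      {r : ℝ | Polynomial.X ^ 2 + Polynomial.C (r ^ 2 / 4) ∣ P} \ {c Y} :=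
    (hc.continuousAt hUY).eventually (hfin.isClosed.isOpen_compl.mem_nhds (by simp))
  have h2 : ∀ᶠ X in 𝓝 Y, endCLM V (S X) ≠ 0 :=
    (hS.continuousAt hUY).eventually_ne (by simpa using hSY)
  filter_upwards [h1, h2, hUY] with X hX1 hX2 hX3
  by_contra hne
  exact hX1 ⟨hd X hX3 (by simpa using hX2), hne⟩

end AnalyticEigenvalues

/-! ### Constancy of the frequencies and annihilating polynomials for a family. -/

section Relations

open Filter Topology

variable {V : Type*} [NormedAddCommGroup V] [InnerProductSpace ℝ V] [FiniteDimensional ℝ V]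
  {m : ℕ}

/-- The quadratic factors of the components of a family `R` of endomorphisms that do not vanish
identically on `U`. -/
def componentFactors {T : Type*} (A R : T → Module.End ℝ V) (U : Set T) (lam : Fin m → T → ℝ) :
    Set (Polynomial ℝ) :=
  {f | ∃ k j : Fin m, k < j ∧ (∃ X ∈ U, block11 (A X) (R X) (fun i => lam i X) k j ≠ 0) ∧
      ∃ X ∈ U, f = Polynomial.X ^ 2 + Polynomial.C ((lam k X - lam j X) ^ 2 / 4)} ∪
  {f | ∃ k j : Fin m, k ≤ j ∧ (∃ X ∈ U, block20 (A X) (R X) (fun i => lam i X) k j ≠ 0) ∧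
      ∃ X ∈ U, f = Polynomial.X ^ 2 + Polynomial.C ((lam k X + lam j X) ^ 2 / 4)} ∪
  {f | ∃ k : Fin m, (∃ X ∈ U, zeroBlock (A X) (R X) (lam k X) ≠ 0) ∧
      ∃ X ∈ U, f = Polynomial.X ^ 2 + Polynomial.C (lam k X ^ 2 / 4)}

/-- The eigenvalue combinations belonging to the components of `R` that do not vanish identically
are constant on `U`. -/
structure HasConstantFrequencies {T : Type*} (A R : T → Module.End ℝ V) (U : Set T)
    (lam : Fin m → T → ℝ) : Prop where
  zero : ∀ k, (∃ Y ∈ U, zeroBlock (A Y) (R Y) (lam k Y) ≠ 0) →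
    ∀ X ∈ U, ∀ Y ∈ U, lam k X = lam k Y
  sub : ∀ k j, k < j → (∃ Y ∈ U, block11 (A Y) (R Y) (fun i => lam i Y) k j ≠ 0) →
    ∀ X ∈ U, ∀ Y ∈ U, lam k X - lam j X = lam k Y - lam j Y
  add : ∀ k j, k ≤ j → (∃ Y ∈ U, block20 (A Y) (R Y) (fun i => lam i Y) k j ≠ 0) →
    ∀ X ∈ U, ∀ Y ∈ U, lam k X + lam j X = lam k Y + lam j Y

/-- A factor may be formed at one point of U while its component is nonzero only at another;
constancy of the frequency moves the factor to the point where divisibility can be proved. -/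
lemma HasConstantFrequencies.dvd_of_mem {T : Type*} {A R : T → Module.End ℝ V} {U : Set T}
    {lam : Fin m → T → ℝ} (hA : ∀ X ∈ U, IsSkewSpectrum (A X) fun k => lam k X)
    (hc : HasConstantFrequencies A R U lam) {P : Polynomial ℝ}
    (hP : ∀ X ∈ U, Polynomial.aeval (halfCommutator (A X)) P (R X) = 0) {f : Polynomial ℝ}
    (hf : f ∈ componentFactors A R U lam) : f ∣ P := by
  rcases hf with (⟨k, j, hkj, ⟨Y, hY, hne⟩, X, hX, rfl⟩ | ⟨k, j, hkj, ⟨Y, hY, hne⟩, X, hX, rfl⟩) |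
    ⟨k, ⟨Y, hY, hne⟩, X, hX, rfl⟩
  · rw [hc.sub k j hkj ⟨Y, hY, hne⟩ X hX Y hY]
    exact (hA Y hY).dvd_of_block11_ne_zero hkj.ne (hP Y hY) hne
  · rw [hc.add k j hkj ⟨Y, hY, hne⟩ X hX Y hY]
    exact (hA Y hY).dvd_of_block20_ne_zero (hP Y hY) hne
  · rw [hc.zero k ⟨Y, hY, hne⟩ X hX Y hY]
    exact (hA Y hY).dvd_of_zeroBlock_ne_zero (hP Y hY) hne

/-! ### Relations force constant frequencies. -/

section necessity

variable {τ : V →ₗ[ℝ] Module.End ℝ V} {U : Set (Metric.sphere (0 : V) 1)}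
  {lam : Fin m → Metric.sphere (0 : V) 1 → ℝ} {R : Metric.sphere (0 : V) 1 → Module.End ℝ V}

/-- A polynomial relation forces the frequencies of the nonvanishing components to be constant. -/
theorem hasConstantFrequencies_of_aeval_eq_zero
    (h : IsContinuousSpectrum (fun X : Metric.sphere (0 : V) 1 => τ (X : V)) U lam)
    (hU : IsOpen U) (hUc : IsPreconnected U)
    (hR : ContinuousOn (fun X => endCLM V (R X)) U) {P : Polynomial ℝ} (hP0 : P ≠ 0)
    (hP : ∀ X ∈ U, Polynomial.aeval (halfCommutator (τ (X : V))) P (R X) = 0) :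
    HasConstantFrequencies (fun X : Metric.sphere (0 : V) 1 => τ (X : V)) R U lam := by
  have main : ∀ (c : Metric.sphere (0 : V) 1 → ℝ) (S : Metric.sphere (0 : V) 1 → Module.End ℝ V),
      (∀ X₀, AnalyticOnNhd ℝ (fun v => c (sphereProj X₀ v)) (sphereCone X₀ U)) →
      ContinuousOn c U → ContinuousOn (fun X => endCLM V (S X)) U →
      (∀ X ∈ U, S X ≠ 0 → Polynomial.X ^ 2 + Polynomial.C (c X ^ 2 / 4) ∣ P) →
      (∃ Y ∈ U, S Y ≠ 0) → ∀ X ∈ U, ∀ Y ∈ U, c X = c Y := by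
    rintro c S hc hcc hS hd ⟨Y, hY, hSY⟩ X hX X' hX'
    -- Local constancy is only available where S is nonzero; analyticity extends it to all of U,
    -- zeros of S included.
    have := eq_of_eventually_eq_of_analyticOnNhd Y hUc (hc Y) hY
      (eventually_eq_of_dvd hU hP0 hcc hS hd hY hSY)
    rw [this X hX, this X' hX']
  have han := fun X₀ k => analyticOnNhd_eigenvalue h hU X₀ k
  refine ⟨fun k => ?_, fun k j hkj => ?_, fun k j _ => ?_⟩
  · exact main (lam k) _ (fun X₀ => han X₀ k) (h.cont k) (h.continuousOn_zeroBlock hR k)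
      fun X hX hne => (h.spec X hX).dvd_of_zeroBlock_ne_zero (hP X hX) hne
  · exact main (fun X => lam k X - lam j X) _ (fun X₀ => (han X₀ k).sub (han X₀ j))
      ((h.cont k).sub (h.cont j)) (h.continuousOn_block11 hR k j)
      fun X hX hne => (h.spec X hX).dvd_of_block11_ne_zero hkj.ne (hP X hX) hne
  · exact main (fun X => lam k X + lam j X) _ (fun X₀ => (han X₀ k).add (han X₀ j))
      ((h.cont k).add (h.cont j)) (h.continuousOn_block20 hR k j)
      fun X hX hne => (h.spec X hX).dvd_of_block20_ne_zero (hP X hX) hne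

end necessity

/-- Different monic irreducibles are coprime, so the least common multiple is simply the product.
Evenness is expressed by `Polynomial.expand ℝ 2` and is multiplicative. -/
lemma exists_isMonicLcm_of_finite {F : Set (Polynomial ℝ)} (hF : F.Finite)
    (hirr : ∀ f ∈ F, Irreducible f) (hmon : ∀ f ∈ F, f.Monic)
    (heven : ∀ f ∈ F, ∃ q, Polynomial.expand ℝ 2 q = f) :
    ∃ Q, IsMonicLcm F Q ∧ ∃ q, Polynomial.expand ℝ 2 q = Q := by
  refine ⟨∏ f ∈ hF.toFinset, f, ⟨Polynomial.monic_prod_of_monic _ _ fun f hf =>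
    hmon f (hF.mem_toFinset.1 hf), fun S => ⟨fun hS f hf => ?_, fun hS => ?_⟩⟩, ?_⟩
  · exact (Finset.dvd_prod_of_mem (fun f => f) (hF.mem_toFinset.2 hf)).trans hS
  · refine Finset.prod_dvd_of_coprime (fun f hf g hg hfg => ?_) fun f hf =>
      hS f (hF.mem_toFinset.1 hf)
    have hf' := hF.mem_toFinset.1 hf
    have hg' := hF.mem_toFinset.1 hg
    refine ((hirr f hf').coprime_iff_not_dvd).2 fun hd => hfg ?_
    exact Polynomial.eq_of_monic_of_associated (hmon f hf') (hmon g hg')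
      ((hirr f hf').associated_of_dvd (hirr g hg') hd)
  · refine Finset.prod_induction _ (fun Q => ∃ q, Polynomial.expand ℝ 2 q = Q) ?_
      ⟨1, map_one _⟩ fun f hf => heven f (hF.mem_toFinset.1 hf)
    rintro _ _ ⟨p, rfl⟩ ⟨q, rfl⟩
    exact ⟨p * q, map_mul _ _ _⟩

/-- Constancy makes the set of factors finite, since all of them can be evaluated at one base point
Y; the blockwise criterion `aeval_X_mul_eq_zero` then applies at every X with the same Q. -/
theorem HasConstantFrequencies.exists_isMonicLcm {T : Type*} {A R : T → Module.End ℝ V}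
    {U : Set T} {lam : Fin m → T → ℝ} (hA : ∀ X ∈ U, IsSkewSpectrum (A X) fun k => lam k X)
    (hU : U.Nonempty) (hc : HasConstantFrequencies A R U lam) :
    ∃ Q, IsMonicLcm (componentFactors A R U lam) Q ∧ (∃ q, Polynomial.expand ℝ 2 q = Q) ∧
      ∀ X ∈ U, Polynomial.aeval (halfCommutator (A X)) (Polynomial.X * Q) (R X) = 0 := by
  obtain ⟨Y, hY⟩ := hU
  set g : ℝ → Polynomial ℝ := fun r => Polynomial.X ^ 2 + Polynomial.C (r ^ 2 / 4) with hg
  have hform : ∀ f ∈ componentFactors A R U lam, ∃ r : ℝ, r ≠ 0 ∧ f = g r := by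
    rintro f ((⟨k, j, hkj, -, X, hX, rfl⟩ | ⟨k, j, hkj, -, X, hX, rfl⟩) | ⟨k, -, X, hX, rfl⟩)
    · exact ⟨_, sub_ne_zero.2 ((hA X hX).injective.ne hkj.ne), rfl⟩
    · exact ⟨_, (add_pos ((hA X hX).pos k) ((hA X hX).pos j)).ne', rfl⟩
    · exact ⟨_, ((hA X hX).pos k).ne', rfl⟩
  have hfin : (componentFactors A R U lam).Finite := by
    refine (((Set.finite_range fun i : Fin m × Fin m => g (lam i.1 Y - lam i.2 Y)).union
      (Set.finite_range fun i : Fin m × Fin m => g (lam i.1 Y + lam i.2 Y))).union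
      (Set.finite_range fun k : Fin m => g (lam k Y))).subset ?_
    rintro f ((⟨k, j, hkj, hne, X, hX, rfl⟩ | ⟨k, j, hkj, hne, X, hX, rfl⟩) |
      ⟨k, hne, X, hX, rfl⟩)
    · exact Or.inl (Or.inl ⟨(k, j), by rw [hc.sub k j hkj hne X hX Y hY]⟩)
    · exact Or.inl (Or.inr ⟨(k, j), by rw [hc.add k j hkj hne X hX Y hY]⟩)
    · exact Or.inr ⟨k, by rw [hc.zero k hne X hX Y hY]⟩
  obtain ⟨Q, hQ, hq⟩ := exists_isMonicLcm_of_finite hfin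
    (fun f hf => by
      obtain ⟨r, hr, rfl⟩ := hform f hf
      exact irreducible_X_sq_add_C (by positivity))
    (fun f hf => by
      obtain ⟨r, hr, rfl⟩ := hform f hf
      exact Polynomial.monic_X_pow_add_C _ two_ne_zero)
    (fun f hf => by
      obtain ⟨r, hr, rfl⟩ := hform f hf
      exact ⟨Polynomial.X + Polynomial.C (r ^ 2 / 4), by simp [hg]⟩)
  refine ⟨Q, hQ, hq, fun X hX => ?_⟩
  have hdvd := (hQ.2 Q).1 dvd_rfl
  refine (hA X hX).aeval_X_mul_eq_zero _ (fun k => ?_) (fun k j hkj => ?_) fun k j hkj => ?_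
  · exact or_iff_not_imp_left.2 fun hne => hdvd _ (Or.inr ⟨k, ⟨X, hX, hne⟩, X, hX, rfl⟩)
  · exact or_iff_not_imp_left.2 fun hne =>
      hdvd _ (Or.inl (Or.inl ⟨k, j, hkj, ⟨X, hX, hne⟩, X, hX, rfl⟩))
  · exact or_iff_not_imp_left.2 fun hne =>
      hdvd _ (Or.inl (Or.inr ⟨k, j, hkj, ⟨X, hX, hne⟩, X, hX, rfl⟩))

/-- The parity condition on the coefficients of `P = λᴺ + a₂ λᴺ⁻² + ⋯`. -/
def HasParity (P : Polynomial ℝ) : Prop :=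
  ∀ i ≤ P.natDegree, Odd (P.natDegree - i) → P.coeff i = 0

/-- An even polynomial times X is odd and has odd degree, so the coefficients at odd distance from
the top vanish. -/
lemma hasParity_X_mul_expand {q : Polynomial ℝ} (hq : (Polynomial.expand ℝ 2 q).Monic) :
    HasParity (Polynomial.X * Polynomial.expand ℝ 2 q) := by
  intro i hi hodd
  rw [Polynomial.natDegree_X_mul hq.ne_zero, Polynomial.natDegree_expand] at hi hodd
  rcases i with _ | i
  · simp
  · rw [Polynomial.coeff_X_mul, Polynomial.coeff_expand two_pos, if_neg]
    intro hd
    rw [Nat.odd_iff] at hodd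
    omega

/-! ### Homogeneous extension of a relation from unit vectors to the whole space. -/

section homogeneity

variable (τ : V →ₗ[ℝ] Module.End ℝ V) {R : V → Module.End ℝ V}

lemma halfCommutator_smul (t : ℝ) (A : Module.End ℝ V) :
    halfCommutator (t • A) = t • halfCommutator A := by
  refine LinearMap.ext fun S => ?_
  rw [LinearMap.smul_apply, halfCommutator_apply, halfCommutator_apply, mul_smul_comm,
    smul_mul_assoc]
  module

lemma halfCommutator_pow_smul (hR : ∀ (t : ℝ) v, R (t • v) = t ^ 2 • R v) (t : ℝ) (v : V) (i : ℕ) :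
    (halfCommutator (τ (t • v)) ^ i) (R (t • v)) = t ^ (i + 2) • (halfCommutator (τ v) ^ i) (R v) := by
  rw [map_smul, halfCommutator_smul, smul_pow, hR, LinearMap.smul_apply, map_smul, smul_smul,
    pow_add]

/-- The homogenization of `P(𝒯_v) R_v`. -/
def homogenizedRelation (R : V → Module.End ℝ V) (P : Polynomial ℝ) (v : V) : Module.End ℝ V :=
  ∑ i ∈ Finset.range (P.natDegree + 1),
    (P.coeff i * ‖v‖ ^ (P.natDegree - i)) • (halfCommutator (τ v) ^ i) (R v)

/-- The term of index i has degree i + 2 from the operator and degree N - i from the norm, N being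
the degree of P. Only t ≥ 0 is allowed, since without a parity assumption odd powers of the norm may
occur. -/
lemma homogenizedRelation_smul (hR : ∀ (t : ℝ) v, R (t • v) = t ^ 2 • R v) (P : Polynomial ℝ)
    {t : ℝ} (ht : 0 ≤ t) {v : V} (hv : ‖v‖ = 1) :
    homogenizedRelation τ R P (t • v)
      = t ^ (P.natDegree + 2) • Polynomial.aeval (halfCommutator (τ v)) P (R v) := by
  rw [homogenizedRelation, Polynomial.aeval_eq_sum_range, LinearMap.sum_apply, Finset.smul_sum]
  refine Finset.sum_congr rfl fun i hi => ?_
  have hi' : i ≤ P.natDegree := Nat.lt_succ_iff.1 (Finset.mem_range.1 hi)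
  rw [halfCommutator_pow_smul τ hR, norm_smul, hv, mul_one, Real.norm_of_nonneg ht,
    LinearMap.smul_apply, smul_smul, smul_smul]
  congr 1
  rw [show P.natDegree + 2 = (P.natDegree - i) + (i + 2) by omega, pow_add]
  ring

lemma homogenizedRelation_of_norm_eq_one (P : Polynomial ℝ) {v : V} (hv : ‖v‖ = 1) :
    homogenizedRelation τ R P v = Polynomial.aeval (halfCommutator (τ v)) P (R v) := by
  rw [homogenizedRelation, Polynomial.aeval_eq_sum_range, LinearMap.sum_apply]
  simp [hv]

lemma homogenizedRelation_eq_zero_iff (hR : ∀ (t : ℝ) v, R (t • v) = t ^ 2 • R v)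
    (P : Polynomial ℝ) : (∀ v, homogenizedRelation τ R P v = 0) ↔
      ∀ v, ‖v‖ = 1 → Polynomial.aeval (halfCommutator (τ v)) P (R v) = 0 := by
  refine ⟨fun h v hv => by rw [← homogenizedRelation_of_norm_eq_one τ P hv, h], fun h v => ?_⟩
  by_cases hv : v = 0
  · subst hv
    have h0 : R 0 = 0 := by simpa using hR 0 0
    simp [homogenizedRelation, h0]
  · have hn : ‖v‖ ≠ 0 := norm_ne_zero_iff.2 hv
    have h1 : ‖(‖v‖⁻¹ • v)‖ = 1 := by simp [norm_smul, hn]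
    have := homogenizedRelation_smul τ hR P (norm_nonneg v) h1
    rwa [smul_smul, mul_inv_cancel₀ hn, one_smul, h _ h1, smul_zero] at this

lemma contDiff_halfCommutator_pow (hR : ContDiff ℝ ω fun v => endCLM V (R v)) (i : ℕ) :
    ContDiff ℝ ω fun v => endCLM V ((halfCommutator (τ v) ^ i) (R v)) := by
  induction i with
  | zero => simpa using hR
  | succ i ih =>
    simp only [pow_succ', Module.End.mul_apply, halfCommutator_apply, map_smul, map_sub, map_mul]
    exact ((ih.mul (contDiff_endCLM_linear τ)).sub
      ((contDiff_endCLM_linear τ).mul ih)).const_smul (1 / 2 : ℝ)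

/-- A polynomial relation of the right parity that holds on an open set of unit vectors holds for
all unit vectors. -/
theorem aeval_eq_zero_of_isOpen (hR : ∀ (t : ℝ) v, R (t • v) = t ^ 2 • R v)
    (hRa : ContDiff ℝ ω fun v => endCLM V (R v)) {P : Polynomial ℝ} (hP : HasParity P)
    {U : Set (Metric.sphere (0 : V) 1)} (hU : IsOpen U) (hne : U.Nonempty)
    (hPU : ∀ X ∈ U, Polynomial.aeval (halfCommutator (τ (X : V))) P (R (X : V)) = 0)
    {v : V} (hv : ‖v‖ = 1) : Polynomial.aeval (halfCommutator (τ v)) P (R v) = 0 := by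
  have han : ContDiff ℝ ω fun v => endCLM V (homogenizedRelation τ R P v) := by
    simp only [homogenizedRelation, map_sum, map_smul]
    refine ContDiff.sum fun i hi => ?_
    have hi' : i ≤ P.natDegree := Nat.lt_succ_iff.1 (Finset.mem_range.1 hi)
    -- Here parity enters: even powers of the norm are powers of ‖v‖² and analytic also at the
    -- origin, while the other terms have zero coefficient. The identity theorem can thus be used on
    -- the whole of V.
    rcases Nat.even_or_odd (P.natDegree - i) with ⟨r, hr⟩ | hodd
    · simp only [hr, ← two_mul, pow_mul]
      exact (contDiff_const.mul ((contDiff_norm_sq ℝ).pow r)).smul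
        (contDiff_halfCommutator_pow τ hRa i)
    · simp only [hP i hi' hodd, zero_mul, zero_smul]
      exact contDiff_const
  obtain ⟨Y, hY⟩ := hne
  have hev : (fun v => endCLM V (homogenizedRelation τ R P v)) =ᶠ[𝓝 (Y : V)] 0 := by
    filter_upwards [(isOpen_sphereCone Y hU).mem_nhds (coe_mem_sphereCone Y hY)] with w hw
    rw [sphereCone_eq_image] at hw
    obtain ⟨⟨t, X⟩, ⟨ht, hX⟩, rfl⟩ := hw
    change endCLM V (homogenizedRelation τ R P (t • (X : V))) = 0
    rw [homogenizedRelation_smul τ hR P (le_of_lt ht) (norm_eq_of_mem_sphere X), hPU X hX, smul_zero,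
      map_zero]
  have han' : AnalyticOnNhd ℝ (fun v => endCLM V (homogenizedRelation τ R P v)) Set.univ :=
    fun w _ => han.contDiffAt.analyticAt
  have hzero := congrFun (han'.eq_of_eventuallyEq analyticOnNhd_const hev) v
  rw [← homogenizedRelation_of_norm_eq_one τ P hv]
  exact (endCLM V).injective (hzero.trans (map_zero _).symm)

end homogeneity

end Relations

/-! ### Smooth vector fields and covariant derivatives -/

section SmoothFields

variable {E : Type*} [NormedAddCommGroup E] [NormedSpace ℝ E]
  {M : Type*} [TopologicalSpace M] [ChartedSpace E M] [IsManifold 𝓘(ℝ, E) ∞ M]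

namespace IsSmoothField

variable {X Y : VecField E M}

lemma mdifferentiableAt (hX : IsSmoothField X) (x : M) : MDiffAt (T% X) x :=
  (ContMDiff.contMDiffAt hX).mdifferentiableAt (by simp)

lemma add (hX : IsSmoothField X) (hY : IsSmoothField Y) : IsSmoothField (X + Y) :=
  ContMDiff.add_section hX hY

lemma sub (hX : IsSmoothField X) (hY : IsSmoothField Y) : IsSmoothField (X - Y) :=
  ContMDiff.sub_section hX hY

lemma neg (hX : IsSmoothField X) : IsSmoothField (-X) :=
  ContMDiff.neg_section hX

lemma const_smul (c : ℝ) (hX : IsSmoothField X) : IsSmoothField (c • X) :=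
  ContMDiff.const_smul_section hX

lemma smul {f : M → ℝ} (hf : CMDiff ∞ f) (hX : IsSmoothField X) : IsSmoothField (f • X) :=
  ContMDiff.smul_section hf hX

lemma zero : IsSmoothField (0 : VecField E M) :=
  contMDiff_zeroSection ℝ (fun x : M => TangentSpace 𝓘(ℝ, E) x)

lemma sum {ι : Type*} {s : Finset ι} {F : ι → VecField E M} (h : ∀ i ∈ s, IsSmoothField (F i)) :
    IsSmoothField (∑ i ∈ s, F i) := by
  classical
  induction s using Finset.induction_on with
  | empty => simpa using zero
  | insert a s ha ih =>
    rw [Finset.sum_insert ha]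
    exact (h a (by simp)).add (ih fun i hi => h i (by simp [hi]))

lemma along (nabla : Connection E M) [hs : nabla.ContMDiffCovariantDerivative ∞]
    (hX : IsSmoothField X) (hY : IsSmoothField Y) : IsSmoothField (nabla.along X Y) := by
  have h1 := hs.contMDiff.contMDiff (σ := Y) (ContMDiff.contMDiffOn (ContMDiff.of_le hY (by simp)))
  exact ContMDiff.clm_bundle_apply (contMDiffOn_univ.1 h1) hX

end IsSmoothField

namespace Connection

variable (nabla : Connection E M) {X Y Z : VecField E M}

lemma along_apply (X Y : VecField E M) (x : M) : nabla.along X Y x = nabla Y x (X x) := rfl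

lemma along_add_left (X Y Z : VecField E M) :
    nabla.along (X + Y) Z = nabla.along X Z + nabla.along Y Z := by
  ext1 x; simp [along]

lemma along_sub_left (X Y Z : VecField E M) :
    nabla.along (X - Y) Z = nabla.along X Z - nabla.along Y Z := by
  ext1 x; simp [along]

lemma along_smul_left (f : M → ℝ) (X Z : VecField E M) :
    nabla.along (f • X) Z = f • nabla.along X Z := by
  ext1 x; simp [along]

lemma along_neg_left (X Z : VecField E M) : nabla.along (-X) Z = -nabla.along X Z := by
  ext1 x; simp [along]

lemma along_zero_right (X : VecField E M) : nabla.along X 0 = 0 := by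
  ext1 x; simp [along]

lemma along_add_right (X : VecField E M) (hY : IsSmoothField Y) (hZ : IsSmoothField Z) :
    nabla.along X (Y + Z) = nabla.along X Y + nabla.along X Z := by
  ext1 x
  simp [along, nabla.isCovariantDerivativeOnUniv.add (hY.mdifferentiableAt x)
    (hZ.mdifferentiableAt x)]

lemma along_const_smul_right (c : ℝ) (X : VecField E M) (hY : IsSmoothField Y) :
    nabla.along X (c • Y) = c • nabla.along X Y := by
  ext1 x
  simp [along, nabla.isCovariantDerivativeOnUniv.smul_const c (hY.mdifferentiableAt x)]

lemma along_neg_right (X : VecField E M) (hY : IsSmoothField Y) :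
    nabla.along X (-Y) = -nabla.along X Y := by
  have := nabla.along_const_smul_right (-1) X hY
  simpa using this

lemma along_sub_right (X : VecField E M) (hY : IsSmoothField Y) (hZ : IsSmoothField Z) :
    nabla.along X (Y - Z) = nabla.along X Y - nabla.along X Z := by
  rw [sub_eq_add_neg, nabla.along_add_right X hY hZ.neg, nabla.along_neg_right X hZ,
    sub_eq_add_neg]

lemma along_sum_right (X : VecField E M) {ι : Type*} {s : Finset ι} {F : ι → VecField E M}
    (h : ∀ i ∈ s, IsSmoothField (F i)) :
    nabla.along X (∑ i ∈ s, F i) = ∑ i ∈ s, nabla.along X (F i) := by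
  classical
  induction s using Finset.induction_on with
  | empty => simp [along_zero_right]
  | insert a s ha ih =>
    have h' : ∀ i ∈ s, IsSmoothField (F i) := fun i hi => h i (by simp [hi])
    rw [Finset.sum_insert ha, Finset.sum_insert ha,
      nabla.along_add_right X (h a (by simp)) (IsSmoothField.sum h'), ih h']

lemma along_smul_right {f : M → ℝ} (hf : CMDiff ∞ f) (X : VecField E M) (hY : IsSmoothField Y) :
    nabla.along X (f • Y) = f • nabla.along X Y + (fun x => d% f x (X x)) • Y := by
  ext1 x
  simp [along, nabla.isCovariantDerivativeOnUniv.leibniz (hY.mdifferentiableAt x)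
    (hf.contMDiffAt.mdifferentiableAt (by simp))]

end Connection

end SmoothFields

/-! ### Smooth extensions of tangent vectors and tensoriality -/

section Tensoriality

variable {E : Type*} [NormedAddCommGroup E] [NormedSpace ℝ E] [FiniteDimensional ℝ E]
  {M : Type*} [TopologicalSpace M] [ChartedSpace E M] [IsManifold 𝓘(ℝ, E) ∞ M] [T2Space M]

/-- A smooth bump function at `p`. -/
def bumpAt (E : Type*) [NormedAddCommGroup E] [NormedSpace ℝ E] [FiniteDimensional ℝ E]
    {M : Type*} [TopologicalSpace M] [ChartedSpace E M] (p : M) :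
    SmoothBumpFunction 𝓘(ℝ, E) p := Classical.arbitrary _

/-- The vector fields that are constant in the tangent coordinates at `p`, cut off away from `p`. -/
def frameField (p : M) : E →ₗ[ℝ] VecField E M where
  toFun a := fun y =>
    bumpAt E p y • (trivializationAt E (fun x : M => TangentSpace 𝓘(ℝ, E) x) p).symmL ℝ y a
  map_add' a b := by ext1 y; simp
  map_smul' c a := by
    ext1 y
    simp only [map_smul, Pi.smul_apply, RingHom.id_apply]
    exact smul_comm _ _ _

lemma frameField_apply (p : M) (a : E) (y : M) : frameField p a y = bumpAt E p y •
    (trivializationAt E (fun x : M => TangentSpace 𝓘(ℝ, E) x) p).symmL ℝ y a := rfl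

lemma isSmoothField_frameField (p : M) (a : E) : IsSmoothField (frameField p a) := by
  set t := trivializationAt E (fun x : M => TangentSpace 𝓘(ℝ, E) x) p with ht
  refine ContMDiffOn.smul_section_of_tsupport (u := t.baseSet) (ψ := bumpAt E p)
    (s := fun y => t.symmL ℝ y a) (bumpAt E p).contMDiff.contMDiffOn
    t.open_baseSet (bumpAt E p).tsupport_subset_chartAt_source ?_
  rw [t.contMDiffOn_section_baseSet_iff]
  refine (contMDiffOn_const (c := a)).congr fun y hy => ?_
  simp [Trivialization.symmL_apply, hy]

/-- The smooth vector field extending `v`. -/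
def smoothExtend {p : M} (v : TangentSpace 𝓘(ℝ, E) p) : VecField E M :=
  frameField p ((trivializationAt E (fun x : M => TangentSpace 𝓘(ℝ, E) x) p) ⟨p, v⟩).2

lemma isSmoothField_smoothExtend {p : M} (v : TangentSpace 𝓘(ℝ, E) p) :
    IsSmoothField (smoothExtend v) := isSmoothField_frameField _ _

lemma eventually_smoothExtend_eq {p : M} (v : TangentSpace 𝓘(ℝ, E) p) :
    ∀ᶠ y in nhds p, smoothExtend v y = FiberBundle.extend E v y := by
  filter_upwards [(bumpAt E p).eventuallyEq_one, (trivializationAt E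
    (fun x : M => TangentSpace 𝓘(ℝ, E) x) p).open_baseSet.mem_nhds
    (FiberBundle.mem_baseSet_trivializationAt' p)] with y hy hyb
  rw [smoothExtend, frameField_apply, hy, Pi.one_apply, one_smul, Trivialization.symmL_apply _ hyb]
  rfl

@[simp] lemma smoothExtend_self {p : M} (v : TangentSpace 𝓘(ℝ, E) p) : smoothExtend v p = v := by
  rw [(eventually_smoothExtend_eq v).self_of_nhds, FiberBundle.extend_apply_self]

lemma smoothExtend_add {p : M} (v w : TangentSpace 𝓘(ℝ, E) p) :
    smoothExtend (v + w) = smoothExtend v + smoothExtend w := by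
  have := ((trivializationAt E (fun x : M => TangentSpace 𝓘(ℝ, E) x) p).linear ℝ
    (FiberBundle.mem_baseSet_trivializationAt' p)).map_add v w
  simp only [smoothExtend, this, map_add]

lemma smoothExtend_smul {p : M} (c : ℝ) (v : TangentSpace 𝓘(ℝ, E) p) :
    smoothExtend (c • v) = c • smoothExtend v := by
  have := ((trivializationAt E (fun x : M => TangentSpace 𝓘(ℝ, E) x) p).linear ℝ
    (FiberBundle.mem_baseSet_trivializationAt' p)).map_smul c v
  simp only [smoothExtend, this, map_smul]

/-- Near `p`, a smooth field is a combination of the frame at `p` with smooth coefficients. -/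
lemma exists_frame_decomposition {X : VecField E M} (hX : IsSmoothField X) (p : M) :
    ∃ g : Fin (Module.finrank ℝ E) → M → ℝ, (∀ i, CMDiff ∞ (g i)) ∧ (X p = 0 → ∀ i, g i p = 0) ∧
      (fun y => bumpAt E p y ^ 2) • X = ∑ i, g i • frameField p (Module.finBasis ℝ E i) ∧
      ∀ y ∈ (chartAt E p).source, bumpAt E p y = 1 → ∑ i, g i y • Module.finBasis ℝ E i =
        (trivializationAt E (fun x : M => TangentSpace 𝓘(ℝ, E) x) p).continuousLinearMapAt ℝ y
          (X y) := by
  set t := trivializationAt E (fun x : M => TangentSpace 𝓘(ℝ, E) x) p with ht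
  set b := Module.finBasis ℝ E
  have hc : CMDiff ∞ (fun y => bumpAt E p y • (t ⟨y, X y⟩).2) := by
    refine (bumpAt E p).contMDiff_smul ?_
    exact (t.contMDiffOn_section_baseSet_iff).1 (ContMDiff.contMDiffOn hX)
  refine ⟨fun i y => LinearMap.toContinuousLinearMap (b.coord i)
    (bumpAt E p y • (t ⟨y, X y⟩).2), fun i => ?_, fun h i => ?_, ?_,
    fun y hy hy1 => ?_⟩
  · exact (ContinuousLinearMap.contMDiff _).comp hc
  · have := (t.linear ℝ (FiberBundle.mem_baseSet_trivializationAt' p)).map_zero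
    simp only [h, this, smul_zero, map_zero]
  -- One factor of the bump function sits in the coefficients and one in the frame fields, hence the
  -- square.
  · ext1 y
    simp only [Pi.smul_apply', Finset.sum_apply, frameField_apply, ← ht]
    by_cases hy : y ∈ t.baseSet
    · have h1 : X y = t.symmL ℝ y (t ⟨y, X y⟩).2 := by
        rw [Trivialization.symmL_apply _ hy, t.symm_apply_apply_mk hy]
      have h2 := b.sum_repr (t ⟨y, X y⟩).2
      conv_lhs => rw [h1, ← h2]
      simp only [map_sum, map_smul, Finset.smul_sum, smul_smul]
      refine Finset.sum_congr rfl fun i _ => ?_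
      congr 1
      simp [b]
      ring
    · have : bumpAt E p y = 0 := by
        by_contra h
        exact hy ((bumpAt E p).support_subset_source h)
      simp [this]
  · have hyb : y ∈ t.baseSet := hy
    simp only [hy1, one_smul]
    rw [Trivialization.continuousLinearMapAt_apply, Trivialization.linearMapAt_apply, if_pos hyb]
    exact b.sum_repr _

/-- An additive operation on smooth vector fields which is linear over the smooth functions at `p`
depends only on the value of the field at `p`. -/
lemma eq_of_tensorial {A : Type*} [AddCommGroup A] [Module ℝ A] {p : M} {Φ : VecField E M → A}
    (hadd : ∀ X Y, IsSmoothField X → IsSmoothField Y → Φ (X + Y) = Φ X + Φ Y)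
    (hsmul : ∀ (f : M → ℝ) X, CMDiff ∞ f → IsSmoothField X → Φ (f • X) = f p • Φ X)
    {X Y : VecField E M} (hX : IsSmoothField X) (hY : IsSmoothField Y) (hXY : X p = Y p) :
    Φ X = Φ Y := by
  classical
  have h0 : Φ 0 = 0 := by
    have := hadd 0 0 .zero .zero
    simpa using this
  have hsum : ∀ {ι : Type} (s : Finset ι) (F : ι → VecField E M), (∀ i, IsSmoothField (F i)) →
      Φ (∑ i ∈ s, F i) = ∑ i ∈ s, Φ (F i) := by
    intro ι s F hF
    induction s using Finset.induction_on with
    | empty => simpa using h0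
    | insert a s ha ih =>
      rw [Finset.sum_insert ha, Finset.sum_insert ha, hadd _ _ (hF a) (.sum fun i _ => hF i), ih]
  have key : ∀ Z : VecField E M, IsSmoothField Z → Z p = 0 → Φ Z = 0 := by
    intro Z hZ hZp
    obtain ⟨g, hg, hgp, hgZ, -⟩ := exists_frame_decomposition hZ p
    -- The cut-off equals one at p, so it does not affect Φ, and it turns Z into a global
    -- combination of smooth fields with coefficients vanishing at p.
    have h1 : Φ ((fun y => bumpAt E p y ^ 2) • Z) = Φ Z := by
      rw [hsmul _ _ ((bumpAt E p).contMDiff.pow 2) hZ, (bumpAt E p).eq_one]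
      simp
    rw [← h1, hgZ, hsum _ _ fun i => (isSmoothField_frameField _ _).smul (hg i)]
    refine Finset.sum_eq_zero fun i _ => ?_
    rw [hsmul _ _ (hg i) (isSmoothField_frameField _ _), hgp hZp i, zero_smul]
  have h1 : Φ X = Φ (Y + (X - Y)) := by simp
  rw [h1, hadd _ _ hY (hX.sub hY), key _ (hX.sub hY) (by simp [hXY]), add_zero]

end Tensoriality

/-! ### The curvature tensor of a torsion free connection -/

section TorsionFreeCurvature

variable {E : Type*} [NormedAddCommGroup E] [NormedSpace ℝ E] [FiniteDimensional ℝ E]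
  {M : Type*} [TopologicalSpace M] [ChartedSpace E M] [IsManifold 𝓘(ℝ, E) ∞ M]

namespace Connection

variable (nabla : Connection E M) {X Y Z W : VecField E M}

lemma mlieBracket_eq_of_torsion_eq_zero (ht : nabla.torsion = 0) (hX : IsSmoothField X)
    (hY : IsSmoothField Y) :
    VectorField.mlieBracket 𝓘(ℝ, E) X Y = nabla.along X Y - nabla.along Y X := by
  ext1 x
  exact ((nabla.torsion_eq_zero_iff).1 ht (hX.mdifferentiableAt x) (hY.mdifferentiableAt x)).symm

lemma curv_eq_of_torsion_eq_zero (ht : nabla.torsion = 0) (hX : IsSmoothField X)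
    (hY : IsSmoothField Y) (Z : VecField E M) :
    nabla.curv X Y Z = nabla.along X (nabla.along Y Z) - nabla.along Y (nabla.along X Z)
      - (nabla.along (nabla.along X Y) Z - nabla.along (nabla.along Y X) Z) := by
  rw [curv, nabla.mlieBracket_eq_of_torsion_eq_zero ht hX hY, along_sub_left]

lemma curv_swap (X Y Z : VecField E M) : nabla.curv X Y Z = -nabla.curv Y X Z := by
  rw [curv, curv, VectorField.mlieBracket_swap, along_neg_left]
  abel

/-- Without torsion, brackets are differences of covariant derivatives, and the cyclic sum becomes
the Jacobi identity for vector fields. -/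
lemma curv_bianchi (ht : nabla.torsion = 0) [nabla.ContMDiffCovariantDerivative ∞]
    (hX : IsSmoothField X) (hY : IsSmoothField Y) (hZ : IsSmoothField Z) :
    nabla.curv X Y Z + nabla.curv Y Z X + nabla.curv Z X Y = 0 := by
  have hle : minSmoothness ℝ 2 ≤ (∞ : WithTop ℕ∞) := by
    rw [minSmoothness_of_isRCLikeNormedField]
    exact WithTop.coe_le_coe.2 le_top
  have hM : IsManifold 𝓘(ℝ, E) (minSmoothness ℝ 3) M := by
    rw [minSmoothness_of_isRCLikeNormedField]
    exact IsManifold.of_le (n := ∞) (WithTop.coe_le_coe.2 le_top)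
  have hJ := VectorField.leibniz_identity_mlieBracket (I := 𝓘(ℝ, E))
    (ContMDiff.of_le hX hle) (ContMDiff.of_le hY hle) (ContMDiff.of_le hZ hle)
  have hXY := (hX.along nabla hY).sub (hY.along nabla hX)
  have hYZ := (hY.along nabla hZ).sub (hZ.along nabla hY)
  have hXZ := (hX.along nabla hZ).sub (hZ.along nabla hX)
  rw [nabla.mlieBracket_eq_of_torsion_eq_zero ht hY hZ,
    nabla.mlieBracket_eq_of_torsion_eq_zero ht hX hY,
    nabla.mlieBracket_eq_of_torsion_eq_zero ht hX hZ,
    nabla.mlieBracket_eq_of_torsion_eq_zero ht hX hYZ,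
    nabla.mlieBracket_eq_of_torsion_eq_zero ht hXY hZ,
    nabla.mlieBracket_eq_of_torsion_eq_zero ht hY hXZ,
    along_sub_left, along_sub_left, along_sub_left,
    along_sub_right _ _ (hY.along nabla hZ) (hZ.along nabla hY),
    along_sub_right _ _ (hX.along nabla hY) (hY.along nabla hX),
    along_sub_right _ _ (hX.along nabla hZ) (hZ.along nabla hX)] at hJ
  rw [nabla.curv_eq_of_torsion_eq_zero ht hX hY, nabla.curv_eq_of_torsion_eq_zero ht hY hZ,
    nabla.curv_eq_of_torsion_eq_zero ht hZ hX]
  rw [← sub_eq_zero] at hJ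
  rw [← hJ]
  abel

section

variable [nabla.ContMDiffCovariantDerivative ∞]

lemma curv_add_left (ht : nabla.torsion = 0) (hX : IsSmoothField X) (hW : IsSmoothField W)
    (hY : IsSmoothField Y) (hZ : IsSmoothField Z) :
    nabla.curv (X + W) Y Z = nabla.curv X Y Z + nabla.curv W Y Z := by
  rw [nabla.curv_eq_of_torsion_eq_zero ht (hX.add hW) hY,
    nabla.curv_eq_of_torsion_eq_zero ht hX hY, nabla.curv_eq_of_torsion_eq_zero ht hW hY]
  rw [along_add_left, along_add_left, along_add_left, along_add_right _ _ hX hW, along_add_left,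
    along_add_left, along_add_right _ _ (hX.along nabla hZ) (hW.along nabla hZ)]
  abel

lemma curv_smul_left (ht : nabla.torsion = 0) {f : M → ℝ} (hf : CMDiff ∞ f)
    (hX : IsSmoothField X) (hY : IsSmoothField Y) (hZ : IsSmoothField Z) :
    nabla.curv (f • X) Y Z = f • nabla.curv X Y Z := by
  rw [nabla.curv_eq_of_torsion_eq_zero ht (hX.smul hf) hY,
    nabla.curv_eq_of_torsion_eq_zero ht hX hY]
  rw [along_smul_left, along_smul_left, along_smul_left, along_smul_right _ hf _ hX,
    along_smul_right _ hf _ (hX.along nabla hZ), along_smul_left, along_add_left, along_smul_left,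
    along_smul_left, smul_sub, smul_sub, smul_sub]
  abel

lemma curv_add_middle (ht : nabla.torsion = 0) (hX : IsSmoothField X) (hY : IsSmoothField Y)
    (hW : IsSmoothField W) (hZ : IsSmoothField Z) :
    nabla.curv X (Y + W) Z = nabla.curv X Y Z + nabla.curv X W Z := by
  rw [curv_swap, nabla.curv_add_left ht hY hW hX hZ, neg_add, ← curv_swap, ← curv_swap]

lemma curv_smul_middle (ht : nabla.torsion = 0) {f : M → ℝ} (hf : CMDiff ∞ f)
    (hX : IsSmoothField X) (hY : IsSmoothField Y) (hZ : IsSmoothField Z) :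
    nabla.curv X (f • Y) Z = f • nabla.curv X Y Z := by
  rw [curv_swap, nabla.curv_smul_left ht hf hY hX hZ, ← smul_neg, ← curv_swap]

/-- Moves the third argument into the first two. Linearity over functions in the third slot then
needs no second derivatives of the function. -/
lemma curv_eq_neg_sub (ht : nabla.torsion = 0) (hX : IsSmoothField X) (hY : IsSmoothField Y)
    (hZ : IsSmoothField Z) :
    nabla.curv X Y Z = -nabla.curv Y Z X - nabla.curv Z X Y := by
  have := nabla.curv_bianchi ht hX hY hZ
  rw [add_assoc] at this
  rw [eq_neg_of_add_eq_zero_left this]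
  abel

lemma curv_add_right (ht : nabla.torsion = 0) (hX : IsSmoothField X) (hY : IsSmoothField Y)
    (hZ : IsSmoothField Z) (hW : IsSmoothField W) :
    nabla.curv X Y (Z + W) = nabla.curv X Y Z + nabla.curv X Y W := by
  rw [nabla.curv_eq_neg_sub ht hX hY (hZ.add hW), nabla.curv_add_middle ht hY hZ hW hX,
    nabla.curv_add_left ht hZ hW hX hY, nabla.curv_eq_neg_sub ht hX hY hZ,
    nabla.curv_eq_neg_sub ht hX hY hW]
  abel

lemma curv_smul_right (ht : nabla.torsion = 0) {f : M → ℝ} (hf : CMDiff ∞ f)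
    (hX : IsSmoothField X) (hY : IsSmoothField Y) (hZ : IsSmoothField Z) :
    nabla.curv X Y (f • Z) = f • nabla.curv X Y Z := by
  rw [nabla.curv_eq_neg_sub ht hX hY (hZ.smul hf), nabla.curv_smul_middle ht hf hY hZ hX,
    nabla.curv_smul_left ht hf hZ hX hY, nabla.curv_eq_neg_sub ht hX hY hZ, smul_sub, smul_neg]

lemma isSmoothField_curv (ht : nabla.torsion = 0) (hX : IsSmoothField X) (hY : IsSmoothField Y)
    (hZ : IsSmoothField Z) : IsSmoothField (nabla.curv X Y Z) := by
  rw [nabla.curv_eq_of_torsion_eq_zero ht hX hY]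
  exact ((hX.along nabla (hY.along nabla hZ)).sub (hY.along nabla (hX.along nabla hZ))).sub
    (((hX.along nabla hY).along nabla hZ).sub ((hY.along nabla hX).along nabla hZ))

variable [T2Space M]

lemma const_smul_eq (c : ℝ) (X : VecField E M) : c • X = (fun _ : M => c) • X := rfl

/-- The value of the curvature at a point depends only on the values of the fields there. -/
lemma curv_congr (ht : nabla.torsion = 0) {X' Y' Z' : VecField E M}
    (hX : IsSmoothField X) (hX' : IsSmoothField X')
    (hY : IsSmoothField Y) (hY' : IsSmoothField Y') (hZ : IsSmoothField Z) (hZ' : IsSmoothField Z')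
    {x : M} (hXX : X x = X' x) (hYY : Y x = Y' x) (hZZ : Z x = Z' x) :
    nabla.curv X Y Z x = nabla.curv X' Y' Z' x := by
  have h1 : nabla.curv X Y Z x = nabla.curv X' Y Z x :=
    eq_of_tensorial (p := x) (Φ := fun X => nabla.curv X Y Z x)
      (fun A B hA hB => by rw [nabla.curv_add_left ht hA hB hY hZ]; rfl)
      (fun f A hf hA => by rw [nabla.curv_smul_left ht hf hA hY hZ]; rfl) hX hX' hXX
  have h2 : nabla.curv X' Y Z x = nabla.curv X' Y' Z x :=
    eq_of_tensorial (p := x) (Φ := fun Y => nabla.curv X' Y Z x)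
      (fun A B hA hB => by rw [nabla.curv_add_middle ht hX' hA hB hZ]; rfl)
      (fun f A hf hA => by rw [nabla.curv_smul_middle ht hf hX' hA hZ]; rfl) hY hY' hYY
  have h3 : nabla.curv X' Y' Z x = nabla.curv X' Y' Z' x :=
    eq_of_tensorial (p := x) (Φ := fun Z => nabla.curv X' Y' Z x)
      (fun A B hA hB => by rw [nabla.curv_add_right ht hX' hY' hA hB]; rfl)
      (fun f A hf hA => by rw [nabla.curv_smul_right ht hf hX' hY' hA]; rfl) hZ hZ' hZZ
  rw [h1, h2, h3]

/-- The curvature tensor of a torsion free connection at a point. -/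
def curvAt (ht : nabla.torsion = 0) (x : M) :
    MultilinearMap ℝ (fun _ : Fin 3 => TangentSpace 𝓘(ℝ, E) x) (TangentSpace 𝓘(ℝ, E) x) where
  toFun v := nabla.curv (smoothExtend (v 0)) (smoothExtend (v 1)) (smoothExtend (v 2)) x
  map_update_add' v i a b := by
    have hs := fun w : TangentSpace 𝓘(ℝ, E) x => isSmoothField_smoothExtend w
    fin_cases i
    · simp only [Fin.zero_eta, Function.update_self, smoothExtend_add,
        Function.update_of_ne (show (1 : Fin 3) ≠ 0 from Fin.ne_of_val_ne (by decide)),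
        Function.update_of_ne (show (2 : Fin 3) ≠ 0 from Fin.ne_of_val_ne (by decide))]
      rw [nabla.curv_add_left ht (hs _) (hs _) (hs _) (hs _)]; rfl
    · simp only [Fin.mk_one, Function.update_self, smoothExtend_add,
        Function.update_of_ne (show (0 : Fin 3) ≠ 1 from Fin.ne_of_val_ne (by decide)),
        Function.update_of_ne (show (2 : Fin 3) ≠ 1 from Fin.ne_of_val_ne (by decide))]
      rw [nabla.curv_add_middle ht (hs _) (hs _) (hs _) (hs _)]; rfl
    · simp only [Fin.reduceFinMk, Function.update_self, smoothExtend_add,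
        Function.update_of_ne (show (0 : Fin 3) ≠ 2 from Fin.ne_of_val_ne (by decide)),
        Function.update_of_ne (show (1 : Fin 3) ≠ 2 from Fin.ne_of_val_ne (by decide))]
      rw [nabla.curv_add_right ht (hs _) (hs _) (hs _) (hs _)]; rfl
  map_update_smul' v i c a := by
    have hs := fun w : TangentSpace 𝓘(ℝ, E) x => isSmoothField_smoothExtend w
    have hc : CMDiff ∞ (fun _ : M => c) := contMDiff_const
    fin_cases i
    · simp only [Fin.zero_eta, Function.update_self, smoothExtend_smul,
        Function.update_of_ne (show (1 : Fin 3) ≠ 0 from Fin.ne_of_val_ne (by decide)),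
        Function.update_of_ne (show (2 : Fin 3) ≠ 0 from Fin.ne_of_val_ne (by decide))]
      rw [const_smul_eq, nabla.curv_smul_left ht hc (hs _) (hs _) (hs _)]; rfl
    · simp only [Fin.mk_one, Function.update_self, smoothExtend_smul,
        Function.update_of_ne (show (0 : Fin 3) ≠ 1 from Fin.ne_of_val_ne (by decide)),
        Function.update_of_ne (show (2 : Fin 3) ≠ 1 from Fin.ne_of_val_ne (by decide))]
      rw [const_smul_eq, nabla.curv_smul_middle ht hc (hs _) (hs _) (hs _)]; rfl
    · simp only [Fin.reduceFinMk, Function.update_self, smoothExtend_smul,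
        Function.update_of_ne (show (0 : Fin 3) ≠ 2 from Fin.ne_of_val_ne (by decide)),
        Function.update_of_ne (show (1 : Fin 3) ≠ 2 from Fin.ne_of_val_ne (by decide))]
      rw [const_smul_eq, nabla.curv_smul_right ht hc (hs _) (hs _) (hs _)]; rfl

lemma curv_apply_eq_curvAt (ht : nabla.torsion = 0) {F : Fin 3 → VecField E M}
    (hF : ∀ i, IsSmoothField (F i)) (x : M) :
    nabla.curv (F 0) (F 1) (F 2) x = nabla.curvAt ht x fun i => F i x :=
  nabla.curv_congr ht (hF 0) (isSmoothField_smoothExtend _) (hF 1) (isSmoothField_smoothExtend _)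
    (hF 2) (isSmoothField_smoothExtend _) (by simp) (by simp) (by simp)

/-- `jacobiOp` is defined through extensions that are smooth only near p, so `curv_congr`, which
concerns globally smooth fields, does not apply. Instead the two kinds of extension agree near p,
and all derivatives involved depend on germs only. -/
lemma jacobiOp_eq_curvAt (ht : nabla.torsion = 0) {p : M} (X U : TangentSpace 𝓘(ℝ, E) p) :
    nabla.jacobiOp X U = nabla.curvAt ht p ![U, X, X] := by
  have hs := fun w : TangentSpace 𝓘(ℝ, E) p => isSmoothField_smoothExtend w
  have hd : ∀ a b : TangentSpace 𝓘(ℝ, E) p,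
      ∀ᶠ y in nhds p, nabla.along (FiberBundle.extend E a) (FiberBundle.extend E b) y
        = nabla.along (smoothExtend a) (smoothExtend b) y := by
    intro a b
    obtain ⟨s, hs', hsb⟩ := FiberBundle.exists_contMDiffOn_extend (k := ∞) 𝓘(ℝ, E) E b
    filter_upwards [eventually_smoothExtend_eq a,
      eventually_eventually_nhds.2 (eventually_smoothExtend_eq b),
      eventually_mem_nhds_iff.2 hs'] with y hya hyb hys
    rw [along_apply, along_apply, hya]
    congr 1
    refine nabla.isCovariantDerivativeOnUniv.congr_of_eventuallyEq
      ((hsb.contMDiffAt hys).mdifferentiableAt (by simp)) ((hs b).mdifferentiableAt y)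
      Filter.univ_mem ?_
    filter_upwards [hyb] with z hz using hz.symm
  have hdd : ∀ a b c : TangentSpace 𝓘(ℝ, E) p,
      nabla.along (FiberBundle.extend E a)
          (nabla.along (FiberBundle.extend E b) (FiberBundle.extend E c)) p
        = nabla.along (smoothExtend a) (nabla.along (smoothExtend b) (smoothExtend c)) p := by
    intro a b c
    rw [along_apply, along_apply, smoothExtend_self, FiberBundle.extend_apply_self]
    congr 1
    exact nabla.isCovariantDerivativeOnUniv.congr_of_eventuallyEq
      (mdifferentiableAt_along_extend nabla b c)
      (((hs b).along nabla (hs c)).mdifferentiableAt p) Filter.univ_mem (hd b c)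
  have hbr : VectorField.mlieBracket 𝓘(ℝ, E) (FiberBundle.extend E U) (FiberBundle.extend E X) p
      = VectorField.mlieBracket 𝓘(ℝ, E) (smoothExtend U) (smoothExtend X) p :=
    Filter.EventuallyEq.mlieBracket_vectorField_eq
      ((eventually_smoothExtend_eq U).mono fun _ h => h.symm)
      ((eventually_smoothExtend_eq X).mono fun _ h => h.symm)
  have hX : nabla (FiberBundle.extend E X) p = nabla (smoothExtend X) p :=
    nabla.isCovariantDerivativeOnUniv.congr_of_eventuallyEq
      (FiberBundle.mdifferentiableAt_extend 𝓘(ℝ, E) E X) ((hs X).mdifferentiableAt p)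
      Filter.univ_mem ((eventually_smoothExtend_eq X).mono fun _ h => h.symm)
  change nabla.curv (FiberBundle.extend E U) (FiberBundle.extend E X) (FiberBundle.extend E X) p
    = nabla.curv (smoothExtend U) (smoothExtend X) (smoothExtend X) p
  simp only [curv, Pi.sub_apply, hdd]
  rw [along_apply nabla (VectorField.mlieBracket _ _ _), hbr, hX]
  rfl

end

end Connection

end TorsionFreeCurvature

/-! ### Derivations of multilinear maps -/

section EndAction

variable {V : Type*} [AddCommGroup V] [Module ℝ V] {n : ℕ}

lemma compLinearMap_update_id_apply (S : MultilinearMap ℝ (fun _ : Fin n => V) V) (i : Fin n)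
    (A : Module.End ℝ V) (y : Fin n → V) :
    S.compLinearMap (Function.update (fun _ => LinearMap.id) i A) y
      = S (Function.update y i (A (y i))) := by
  rw [MultilinearMap.compLinearMap_apply]
  congr 1
  ext1 j
  rcases eq_or_ne j i with rfl | h <;> simp [*]

/-- The operator `S ↦ -1/2 (τ_{y₀} ⋆ S)`, where an endomorphism acts on multilinear maps as a
derivation; `y₀` becomes the first argument. -/
def endActionLeft (τ : V →ₗ[ℝ] Module.End ℝ V) (S : MultilinearMap ℝ (fun _ : Fin n => V) V) :
    MultilinearMap ℝ (fun _ : Fin (n + 1) => V) V :=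
  LinearMap.uncurryLeft (M := fun _ : Fin (n + 1) => V)
    { toFun := fun v => (-(1 / 2) : ℝ) • ((τ v).compMultilinearMap S
        - ∑ i, S.compLinearMap (Function.update (fun _ => LinearMap.id) i (τ v)))
      map_add' := fun v w => by
        ext y
        simp only [smul_apply, sub_apply, sum_apply, compLinearMap_update_id_apply, add_apply,
          LinearMap.compMultilinearMap_apply, map_add, LinearMap.add_apply, S.map_update_add,
          Finset.sum_add_distrib]
        module
      map_smul' := fun c v => by
        ext y
        simp only [smul_apply, sub_apply, sum_apply, compLinearMap_update_id_apply,
          LinearMap.compMultilinearMap_apply, map_smul, LinearMap.smul_apply, S.map_update_smul,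
          ← Finset.smul_sum, RingHom.id_apply]
        module }

lemma endActionLeft_apply (τ : V →ₗ[ℝ] Module.End ℝ V)
    (S : MultilinearMap ℝ (fun _ : Fin n => V) V) (y : Fin (n + 1) → V) :
    endActionLeft τ S y = (-(1 / 2) : ℝ) • (τ (y 0) (S (Fin.tail y))
      - ∑ i, S (Function.update (Fin.tail y) i (τ (y 0) (Fin.tail y i)))) := by
  rw [endActionLeft, LinearMap.uncurryLeft_apply]
  simp only [LinearMap.coe_mk, AddHom.coe_mk, smul_apply, sub_apply, sum_apply,
    compLinearMap_update_id_apply, LinearMap.compMultilinearMap_apply]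

/-- The product rule for `endActionLeft`. -/
lemma sum_endActionLeft_update (τ : V →ₗ[ℝ] Module.End ℝ V)
    (S : MultilinearMap ℝ (fun _ : Fin n => V) V) (y b : Fin (n + 1) → V) :
    ∑ i, endActionLeft τ S (Function.update y i (b i)) = (-(1 / 2) : ℝ) •
      (τ (b 0) (S (Fin.tail y))
        + τ (y 0) (∑ j, S (Function.update (Fin.tail y) j (Fin.tail b j)))
        - ∑ i, ∑ j, S (Function.update (Function.update (Fin.tail y) i (τ (y 0) (Fin.tail y i))) j
          (if j = i then τ (b 0) (Fin.tail y i) + τ (y 0) (Fin.tail b i) else Fin.tail b j))) := by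
  -- Off the diagonal the two updates commute; on the diagonal additivity separates the term that
  -- varies the direction `y 0` from the one that varies the i-th argument.
  have key : ∀ i j, S (Function.update (Function.update (Fin.tail y) i (τ (y 0) (Fin.tail y i))) j
          (if j = i then τ (b 0) (Fin.tail y i) + τ (y 0) (Fin.tail b i) else Fin.tail b j))
      = (if j = i then S (Function.update (Fin.tail y) i (τ (b 0) (Fin.tail y i))) else 0)
        + S (Function.update (Function.update (Fin.tail y) j (Fin.tail b j)) i
          (τ (y 0) (Function.update (Fin.tail y) j (Fin.tail b j) i))) := by
    intro i j
    rcases eq_or_ne j i with rfl | h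
    · simp only [if_true, Function.update_idem, Function.update_self, S.map_update_add]
    · simp only [if_neg h, zero_add, Function.update_of_ne h.symm]
      rw [Function.update_comm h]
  simp only [key, Finset.sum_add_distrib, Finset.sum_ite_eq', Finset.mem_univ,
    if_true]
  rw [Fin.sum_univ_succ, Finset.sum_comm, endActionLeft_apply]
  simp only [endActionLeft_apply, Fin.tail_update_zero, Fin.tail_update_succ, Function.update_self,
    Function.update_of_ne (Fin.succ_ne_zero _).symm, ← Finset.smul_sum, Finset.sum_sub_distrib,
    map_sum]
  have hb : ∀ j : Fin n, b j.succ = Fin.tail b j := fun _ => rfl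
  simp only [hb]
  module

/-- The iterated covariant derivatives of a tensor `r` which is parallel for a connection with
difference tensor `τ / 2`. -/
def iterEndAction (τ : V →ₗ[ℝ] Module.End ℝ V) (r : MultilinearMap ℝ (fun _ : Fin 3 => V) V) :
    (k : ℕ) → MultilinearMap ℝ (fun _ : Fin (3 + k) => V) V
  | 0 => r
  | k + 1 => endActionLeft τ (iterEndAction τ r k)

end EndAction

/-- All slots but one hold X, and τ_X X = 0 kills the corresponding terms of the derivation. What
remains is -1/2 times the commutator of τ_X with the operator already obtained. -/
lemma iterEndAction_apply_symmetric {V : Type*} [NormedAddCommGroup V] [InnerProductSpace ℝ V]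
    [FiniteDimensional ℝ V] (τ : V →ₗ[ℝ] Module.End ℝ V)
    (r : MultilinearMap ℝ (fun _ : Fin 3 => V) V) {X : V} (hX : τ X X = 0) (J : Module.End ℝ V)
    (hJ : ∀ U, J U = r ![U, X, X]) (k : ℕ) (U : V) :
    iterEndAction τ r k (fun i => if (i : ℕ) = k then U else X)
      = ((halfCommutator (τ X)) ^ k) J U := by
  induction k generalizing U with
  | zero =>
    simp only [iterEndAction, pow_zero, Module.End.one_apply, hJ]
    congr 1
    ext1 i
    fin_cases i <;> rfl
  | succ k ih =>
    have h0 : (if ((0 : Fin (3 + k + 1)) : ℕ) = k + 1 then U else X) = X := by simp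
    -- Removing the new direction of differentiation shifts the slot of U from k + 1 to k.
    have ht : Fin.tail (n := 3 + k) (α := fun _ => V) (fun i => if (i : ℕ) = k + 1 then U else X)
        = fun i : Fin (3 + k) => if (i : ℕ) = k then U else X := by
      ext1 i
      simp [Fin.tail]
    have hk : k < 3 + k := by omega
    change endActionLeft τ (iterEndAction τ r k) _ = _
    rw [endActionLeft_apply]
    erw [ht]
    rw [h0]
    rw [Finset.sum_eq_single (⟨k, hk⟩ : Fin (3 + k)), ih]
    · have : Function.update (fun i : Fin (3 + k) => if (i : ℕ) = k then U else X) ⟨k, hk⟩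
          (τ X (if k = k then U else X)) = fun i : Fin (3 + k) => if (i : ℕ) = k then τ X U else X := by
        ext1 i
        rcases eq_or_ne i ⟨k, hk⟩ with rfl | h
        · simp
        · have h' : (i : ℕ) ≠ k := fun e => h (Fin.ext e)
          simp [h, h']
      rw [this, ih, pow_succ', Module.End.mul_apply, halfCommutator_apply]
      simp only [LinearMap.smul_apply, LinearMap.sub_apply, Module.End.mul_apply]
      module
    · intro i _ hi
      have h' : (i : ℕ) ≠ k := fun e => hi (Fin.ext e)
      simp only [if_neg h', hX]
      exact MultilinearMap.map_update_zero _ _ _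
    · simp

/-! ### Parallel tensors of a connection with parallel skew-symmetric torsion and curvature -/

section ParallelTensors

variable {E : Type*} [NormedAddCommGroup E] [NormedSpace ℝ E] [FiniteDimensional ℝ E]
  {M : Type*} [TopologicalSpace M] [ChartedSpace E M] [IsManifold 𝓘(ℝ, E) ∞ M]

/-- `τ` as a linear map into the endomorphisms. -/
def torsionMap (nabla nablaBar : Connection E M) (p : M) :
    TangentSpace 𝓘(ℝ, E) p →ₗ[ℝ] Module.End ℝ (TangentSpace 𝓘(ℝ, E) p) where
  toFun X := torsionEnd nabla nablaBar X
  map_add' X Y := by ext Z; simp [torsionEnd]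
  map_smul' c X := by ext Z; simp [torsionEnd, smul_smul, mul_comm]

lemma torsionMap_apply (nabla nablaBar : Connection E M) {p : M} (X : TangentSpace 𝓘(ℝ, E) p) :
    torsionMap nabla nablaBar p X = torsionEnd nabla nablaBar X := rfl

/-- The vector field `τ_X Y`. -/
def torsionField (nabla nablaBar : Connection E M) (X Y : VecField E M) : VecField E M :=
  fun x => torsionEnd nabla nablaBar (X x) (Y x)

/-- A tensor with `n` arguments which is smooth and parallel for the connection `nabla`. -/
structure Connection.IsParallelTensor (nabla : Connection E M) {n : ℕ}
    (S : ∀ x : M, MultilinearMap ℝ (fun _ : Fin n => TangentSpace 𝓘(ℝ, E) x)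
      (TangentSpace 𝓘(ℝ, E) x)) : Prop where
  smooth : ∀ Y : Fin n → VecField E M, (∀ i, IsSmoothField (Y i)) →
    IsSmoothField (fun x => S x fun i => Y i x)
  along : ∀ (W : VecField E M) (Y : Fin n → VecField E M), IsSmoothField W →
    (∀ i, IsSmoothField (Y i)) → ∀ x : M, nabla.along W (fun x => S x fun i => Y i x) x
      = ∑ i, S x (Function.update (fun j => Y j x) i (nabla.along W (Y i) x))

variable {nabla nablaBar : Connection E M} {X Y Z W : VecField E M}

lemma torsionField_eq (hY : IsSmoothField Y) :
    torsionField nabla nablaBar X Y = (2 : ℝ) • (nablaBar.along X Y - nabla.along X Y) := by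
  ext1 x
  change (2 : ℝ) • nablaBar.difference nabla x (Y x) (X x) = _
  rw [CovariantDerivative.difference, IsCovariantDerivativeOn.difference_apply _ _ (Set.mem_univ x)
    (hY.mdifferentiableAt x)]
  rfl

lemma along_eq_sub_torsionField (nabla nablaBar : Connection E M) (X : VecField E M)
    (hY : IsSmoothField Y) :
    nabla.along X Y = nablaBar.along X Y - (1 / 2 : ℝ) • torsionField nabla nablaBar X Y := by
  rw [torsionField_eq hY]
  module

lemma isSmoothField_torsionField [nabla.ContMDiffCovariantDerivative ∞]
    [nablaBar.ContMDiffCovariantDerivative ∞] (hX : IsSmoothField X) (hY : IsSmoothField Y) :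
    IsSmoothField (torsionField nabla nablaBar X Y) := by
  rw [torsionField_eq hY]
  exact ((hX.along nablaBar hY).sub (hX.along nabla hY)).const_smul 2

lemma torsionField_add_left (X W Y : VecField E M) : torsionField nabla nablaBar (X + W) Y
    = torsionField nabla nablaBar X Y + torsionField nabla nablaBar W Y := by
  ext1 x; simp [torsionField, torsionEnd]

lemma torsionField_sub_left (X W Y : VecField E M) : torsionField nabla nablaBar (X - W) Y
    = torsionField nabla nablaBar X Y - torsionField nabla nablaBar W Y := by
  ext1 x; simp [torsionField, torsionEnd, smul_sub]

lemma torsionField_add_right (X Y W : VecField E M) : torsionField nabla nablaBar X (Y + W)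
    = torsionField nabla nablaBar X Y + torsionField nabla nablaBar X W := by
  ext1 x; simp [torsionField]

lemma torsionField_sub_right (X Y W : VecField E M) : torsionField nabla nablaBar X (Y - W)
    = torsionField nabla nablaBar X Y - torsionField nabla nablaBar X W := by
  ext1 x; simp [torsionField]

lemma torsionField_smul_right (c : ℝ) (X Y : VecField E M) :
    torsionField nabla nablaBar X (c • Y) = c • torsionField nabla nablaBar X Y := by
  ext1 x; simp [torsionField]

lemma torsionField_swap
    (hskew : ∀ (p : M) (u v : TangentSpace 𝓘(ℝ, E) p),
      torsionEnd nabla nablaBar u v = -torsionEnd nabla nablaBar v u) (X Y : VecField E M) :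
    torsionField nabla nablaBar X Y = -torsionField nabla nablaBar Y X := by
  ext1 x; exact hskew _ _ _

section Bracket

variable (ht : nabla.torsion = 0)
  (hskew : ∀ (p : M) (u v : TangentSpace 𝓘(ℝ, E) p),
    torsionEnd nabla nablaBar u v = -torsionEnd nabla nablaBar v u)
include ht hskew

lemma mlieBracket_eq_of_skew (hX : IsSmoothField X) (hY : IsSmoothField Y) :
    VectorField.mlieBracket 𝓘(ℝ, E) X Y
      = nablaBar.along X Y - nablaBar.along Y X - torsionField nabla nablaBar X Y := by
  rw [nabla.mlieBracket_eq_of_torsion_eq_zero ht hX hY,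
    along_eq_sub_torsionField nabla nablaBar X hY,
    along_eq_sub_torsionField nabla nablaBar Y hX, torsionField_swap hskew Y X]
  module

/-- The torsion of ∇̄ is (τ_u v - τ_v u)/2, which equals τ_u v by skew-symmetry. Parallel torsion
thus means parallel τ. -/
lemma torsion_eq_torsionEnd [T2Space M] (x : M) (u v : TangentSpace 𝓘(ℝ, E) x) :
    nablaBar.torsion x u v = torsionEnd nabla nablaBar u v := by
  have hu := isSmoothField_smoothExtend u
  have hv := isSmoothField_smoothExtend v
  have h := nablaBar.torsion_apply (hu.mdifferentiableAt x) (hv.mdifferentiableAt x)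
  rw [mlieBracket_eq_of_skew ht hskew hu hv] at h
  simp only [smoothExtend_self] at h
  rw [h]
  simp [Connection.along, torsionField]

/-- The tensor `τ` is parallel for an Ambrose-Singer connection. -/
lemma along_torsionField [T2Space M]
    (hpar : nablaBar.IsParallel
      (fun Y : Fin 2 → VecField E M => fun x => nablaBar.torsion x (Y 0 x) (Y 1 x)))
    (hW : IsSmoothField W) (hX : IsSmoothField X) (hY : IsSmoothField Y) :
    nablaBar.along W (torsionField nabla nablaBar X Y)
      = torsionField nabla nablaBar (nablaBar.along W X) Y
        + torsionField nabla nablaBar X (nablaBar.along W Y) := by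
  have h := hpar ![W, X, Y] (by intro i; fin_cases i <;> assumption)
  simp only [Connection.derivTensor, torsion_eq_torsionEnd ht hskew] at h
  rw [Fin.sum_univ_two, sub_eq_zero] at h
  exact h

variable [nabla.ContMDiffCovariantDerivative ∞] [nablaBar.ContMDiffCovariantDerivative ∞]
  [T2Space M]
  (hpar : nablaBar.IsParallel
    (fun Y : Fin 2 → VecField E M => fun x => nablaBar.torsion x (Y 0 x) (Y 1 x)))
include hpar

/-- Comparison of the curvatures of `∇` and `∇̄`. -/
lemma curv_eq_curv_add (hX : IsSmoothField X) (hY : IsSmoothField Y) (hZ : IsSmoothField Z) :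
    nabla.curv X Y Z = nablaBar.curv X Y Z
      - (1 / 2 : ℝ) • torsionField nabla nablaBar (torsionField nabla nablaBar X Y) Z
      + (1 / 4 : ℝ) • (torsionField nabla nablaBar X (torsionField nabla nablaBar Y Z)
        - torsionField nabla nablaBar Y (torsionField nabla nablaBar X Z)) := by
  have hbr : IsSmoothField (VectorField.mlieBracket 𝓘(ℝ, E) X Y) := by
    rw [mlieBracket_eq_of_skew ht hskew hX hY]
    exact ((hX.along nablaBar hY).sub (hY.along nablaBar hX)).sub (isSmoothField_torsionField hX hY)
  -- Expand both derivatives by ∇ = ∇̄ - τ/2; parallelism of τ distributes ∇̄ over τ_B Z. The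
  -- first-order terms cancel in the curvature after antisymmetrization, against the bracket.
  have h2 : ∀ {A B : VecField E M}, IsSmoothField A → IsSmoothField B →
      nabla.along A (nabla.along B Z) = nablaBar.along A (nablaBar.along B Z)
        - (1 / 2 : ℝ) • (torsionField nabla nablaBar (nablaBar.along A B) Z
          + torsionField nabla nablaBar B (nablaBar.along A Z))
        - (1 / 2 : ℝ) • (torsionField nabla nablaBar A (nablaBar.along B Z)
          - (1 / 2 : ℝ) • torsionField nabla nablaBar A (torsionField nabla nablaBar B Z)) := by
    intro A B hA hB
    have hT : IsSmoothField (torsionField nabla nablaBar B Z) := isSmoothField_torsionField hB hZ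
    rw [along_eq_sub_torsionField nabla nablaBar A (hB.along nabla hZ),
      along_eq_sub_torsionField nabla nablaBar B hZ,
      nablaBar.along_sub_right _ (hB.along nablaBar hZ) (hT.const_smul _),
      nablaBar.along_const_smul_right _ _ hT, along_torsionField ht hskew hpar hA hB hZ,
      torsionField_sub_right, torsionField_smul_right]
  rw [Connection.curv, Connection.curv, h2 hX hY, h2 hY hX,
    along_eq_sub_torsionField nabla nablaBar _ hZ,
    mlieBracket_eq_of_skew ht hskew hX hY, torsionField_sub_left, torsionField_sub_left]
  module

/-- The curvature of `∇` is parallel for an Ambrose-Singer connection `∇̄`. -/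
lemma along_curv (hcurv : nablaBar.IsParallel nablaBar.curvTensor)
    (hW : IsSmoothField W) (hX : IsSmoothField X) (hY : IsSmoothField Y) (hZ : IsSmoothField Z) :
    nablaBar.along W (nabla.curv X Y Z) = nabla.curv (nablaBar.along W X) Y Z
      + nabla.curv X (nablaBar.along W Y) Z + nabla.curv X Y (nablaBar.along W Z) := by
  have h0 : nablaBar.along W (nablaBar.curv X Y Z) = nablaBar.curv (nablaBar.along W X) Y Z
      + nablaBar.curv X (nablaBar.along W Y) Z + nablaBar.curv X Y (nablaBar.along W Z) := by
    have h := hcurv ![W, X, Y, Z] (by intro i; fin_cases i <;> assumption)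
    simp only [Connection.derivTensor] at h
    rw [Fin.sum_univ_three, sub_eq_zero] at h
    exact h
  have hT : ∀ {A B : VecField E M}, IsSmoothField A → IsSmoothField B →
    IsSmoothField (torsionField nabla nablaBar A B) := fun hA hB => isSmoothField_torsionField hA hB
  have hWX := hW.along nablaBar hX
  have hWY := hW.along nablaBar hY
  have hWZ := hW.along nablaBar hZ
  -- Smoothness is read off from the comparison formula, because `isSmoothField_curv` requires
  -- vanishing torsion.
  have hB : IsSmoothField (nablaBar.curv X Y Z) := by
    have : nablaBar.curv X Y Z = nabla.curv X Y Z
        + (1 / 2 : ℝ) • torsionField nabla nablaBar (torsionField nabla nablaBar X Y) Z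
        - (1 / 4 : ℝ) • (torsionField nabla nablaBar X (torsionField nabla nablaBar Y Z)
          - torsionField nabla nablaBar Y (torsionField nabla nablaBar X Z)) := by
      rw [curv_eq_curv_add ht hskew hpar hX hY hZ]
      abel
    rw [this]
    exact ((nabla.isSmoothField_curv ht hX hY hZ).add ((hT (hT hX hY) hZ).const_smul _)).sub
      (((hT hX (hT hY hZ)).sub (hT hY (hT hX hZ))).const_smul _)
  rw [curv_eq_curv_add ht hskew hpar hX hY hZ, curv_eq_curv_add ht hskew hpar hWX hY hZ,
    curv_eq_curv_add ht hskew hpar hX hWY hZ, curv_eq_curv_add ht hskew hpar hX hY hWZ,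
    nablaBar.along_add_right _ (hB.sub ((hT (hT hX hY) hZ).const_smul _))
      (((hT hX (hT hY hZ)).sub (hT hY (hT hX hZ))).const_smul _),
    nablaBar.along_sub_right _ hB ((hT (hT hX hY) hZ).const_smul _), h0,
    nablaBar.along_const_smul_right _ _ (hT (hT hX hY) hZ),
    nablaBar.along_const_smul_right _ _ ((hT hX (hT hY hZ)).sub (hT hY (hT hX hZ))),
    nablaBar.along_sub_right _ (hT hX (hT hY hZ)) (hT hY (hT hX hZ)),
    along_torsionField ht hskew hpar hW (hT hX hY) hZ,
    along_torsionField ht hskew hpar hW hX (hT hY hZ),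
    along_torsionField ht hskew hpar hW hY (hT hX hZ),
    along_torsionField ht hskew hpar hW hX hY,
    along_torsionField ht hskew hpar hW hY hZ,
    along_torsionField ht hskew hpar hW hX hZ]
  simp only [torsionField_add_right, torsionField_add_left]
  module

end Bracket

end ParallelTensors

/-! ### Symmetrized covariant derivatives of the curvature -/

section SymmetrizedDerivatives

variable {E : Type*} [NormedAddCommGroup E] [NormedSpace ℝ E] [FiniteDimensional ℝ E]
  {M : Type*} [TopologicalSpace M] [ChartedSpace E M] [IsManifold 𝓘(ℝ, E) ∞ M]
  {nabla nablaBar : Connection E M}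

lemma update_field_apply {n : ℕ} (Y : Fin n → VecField E M) (i : Fin n) (Z : VecField E M) (x : M) :
    (fun j => Function.update Y i Z j x) = Function.update (fun j => Y j x) i (Z x) := by
  ext1 j
  rcases eq_or_ne j i with rfl | h <;> simp [*]

lemma isSmoothField_update {n : ℕ} {Y : Fin n → VecField E M} (hY : ∀ i, IsSmoothField (Y i))
    (i : Fin n) {Z : VecField E M} (hZ : IsSmoothField Z) (j : Fin n) :
    IsSmoothField (Function.update Y i Z j) := by
  rcases eq_or_ne j i with rfl | h
  · simpa using hZ
  · simpa [h] using hY j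

lemma endActionLeft_field_eq {n : ℕ}
    (S : ∀ x : M, MultilinearMap ℝ (fun _ : Fin n => TangentSpace 𝓘(ℝ, E) x)
      (TangentSpace 𝓘(ℝ, E) x)) (Y : Fin (n + 1) → VecField E M) :
    (fun x => endActionLeft (torsionMap nabla nablaBar x) (S x) fun i => Y i x)
      = (-(1 / 2) : ℝ) • (torsionField nabla nablaBar (Y 0) (fun x => S x fun i => Fin.tail Y i x)
        - ∑ i, fun x => S x fun j => Function.update (Fin.tail Y) i
          (torsionField nabla nablaBar (Y 0) (Fin.tail Y i)) j x) := by
  ext1 x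
  rw [endActionLeft_apply]
  simp only [Pi.smul_apply, Pi.sub_apply, Finset.sum_apply, update_field_apply]
  rfl

section

variable (ht : nabla.torsion = 0)
  (hskew : ∀ (p : M) (u v : TangentSpace 𝓘(ℝ, E) p),
    torsionEnd nabla nablaBar u v = -torsionEnd nabla nablaBar v u)
  [nabla.ContMDiffCovariantDerivative ∞] [nablaBar.ContMDiffCovariantDerivative ∞] [T2Space M]
  (hpar : nablaBar.IsParallel
    (fun Y : Fin 2 → VecField E M => fun x => nablaBar.torsion x (Y 0 x) (Y 1 x)))
include ht hskew hpar

/-- The action of the parallel tensor `τ` maps parallel tensors to parallel tensors. -/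
lemma Connection.IsParallelTensor.endActionLeft {n : ℕ}
    {S : ∀ x : M, MultilinearMap ℝ (fun _ : Fin n => TangentSpace 𝓘(ℝ, E) x)
      (TangentSpace 𝓘(ℝ, E) x)} (hS : nablaBar.IsParallelTensor S) :
    nablaBar.IsParallelTensor fun x => endActionLeft (torsionMap nabla nablaBar x) (S x) := by
  have hA : ∀ Y : Fin (n + 1) → VecField E M, (∀ i, IsSmoothField (Y i)) →
      IsSmoothField (torsionField nabla nablaBar (Y 0) (fun x => S x fun i => Fin.tail Y i x)) :=
    fun Y hY => isSmoothField_torsionField (hY 0) (hS.smooth (Fin.tail Y) fun i => hY i.succ)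
  have hY' : ∀ Y : Fin (n + 1) → VecField E M, (∀ i, IsSmoothField (Y i)) → ∀ i j,
      IsSmoothField (Function.update (Fin.tail Y) i
        (torsionField nabla nablaBar (Y 0) (Fin.tail Y i)) j) := fun Y hY i =>
    isSmoothField_update (fun j => hY j.succ) i (isSmoothField_torsionField (hY 0) (hY i.succ))
  have hC : ∀ Y : Fin (n + 1) → VecField E M, (∀ i, IsSmoothField (Y i)) → ∀ i,
      IsSmoothField (fun x => S x fun j => Function.update (Fin.tail Y) i
        (torsionField nabla nablaBar (Y 0) (Fin.tail Y i)) j x) := fun Y hY i =>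
    hS.smooth _ (hY' Y hY i)
  refine ⟨fun Y hY => ?_, fun W Y hW hY x => ?_⟩
  · rw [endActionLeft_field_eq]
    exact ((hA Y hY).sub (.sum fun i _ => hC Y hY i)).const_smul _
  · rw [endActionLeft_field_eq,
      nablaBar.along_const_smul_right _ _ ((hA Y hY).sub (.sum fun i _ => hC Y hY i)),
      nablaBar.along_sub_right _ (hA Y hY) (.sum fun i _ => hC Y hY i),
      nablaBar.along_sum_right _ fun i _ => hC Y hY i,
      along_torsionField ht hskew hpar hW (hY 0) (hS.smooth (Fin.tail Y) fun i => hY i.succ),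
      sum_endActionLeft_update (torsionMap nabla nablaBar x) (S x) (fun i => Y i x)
        (fun i => nablaBar.along W (Y i) x)]
    have h1 : nablaBar.along W (fun x => S x fun i => Fin.tail Y i x) x
        = ∑ i, S x (Function.update (fun j => Fin.tail Y j x) i
          (nablaBar.along W (Fin.tail Y i) x)) :=
      hS.along W (Fin.tail Y) hW (fun i => hY i.succ) x
    have h2 : ∀ i, nablaBar.along W (fun x => S x fun j => Function.update (Fin.tail Y) i
        (torsionField nabla nablaBar (Y 0) (Fin.tail Y i)) j x) x
        = ∑ j, S x (Function.update (Function.update (fun j => Fin.tail Y j x) i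
            (torsionEnd nabla nablaBar (Y 0 x) (Fin.tail Y i x))) j
          (if j = i then torsionEnd nabla nablaBar (nablaBar.along W (Y 0) x) (Fin.tail Y i x)
            + torsionEnd nabla nablaBar (Y 0 x) (nablaBar.along W (Fin.tail Y i) x)
            else nablaBar.along W (Fin.tail Y j) x)) := by
      intro i
      rw [hS.along W _ hW (hY' Y hY i) x]
      refine Finset.sum_congr rfl fun j _ => ?_
      rw [update_field_apply]
      congr 2
      rcases eq_or_ne j i with rfl | h
      · rw [Function.update_self, if_pos rfl,
          along_torsionField ht hskew hpar hW (hY 0)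
            (show IsSmoothField (Fin.tail Y j) from hY j.succ)]
        rfl
      · rw [Function.update_of_ne h, if_neg h]
    simp only [Pi.smul_apply, Pi.sub_apply, Pi.add_apply, Finset.sum_apply, h2]
    congr 3
    change torsionEnd nabla nablaBar (Y 0 x) _ = torsionEnd nabla nablaBar (Y 0 x) _
    rw [h1]
    rfl

variable (hcurv : nablaBar.IsParallel nablaBar.curvTensor)
include hcurv

lemma isParallelTensor_curvAt : nablaBar.IsParallelTensor (nabla.curvAt ht) := by
  have he : ∀ Y : Fin 3 → VecField E M, (∀ i, IsSmoothField (Y i)) →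
      (fun x => nabla.curvAt ht x fun i => Y i x) = nabla.curv (Y 0) (Y 1) (Y 2) := fun Y hY => by
    ext1 x
    exact (nabla.curv_apply_eq_curvAt ht hY x).symm
  refine ⟨fun Y hY => ?_, fun W Y hW hY x => ?_⟩
  · rw [he Y hY]
    exact nabla.isSmoothField_curv ht (hY 0) (hY 1) (hY 2)
  · rw [he Y hY, along_curv ht hskew hpar hcurv hW (hY 0) (hY 1) (hY 2)]
    simp only [← update_field_apply]
    rw [Fin.sum_univ_three]
    have hu := fun i => isSmoothField_update hY i (hW.along nablaBar (hY i))
    rw [← nabla.curv_apply_eq_curvAt ht (hu 0), ← nabla.curv_apply_eq_curvAt ht (hu 1),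
      ← nabla.curv_apply_eq_curvAt ht (hu 2)]
    rfl

lemma isParallelTensor_iterEndAction (k : ℕ) : nablaBar.IsParallelTensor
    fun x => iterEndAction (torsionMap nabla nablaBar x) (nabla.curvAt ht x) k := by
  induction k with
  | zero => exact isParallelTensor_curvAt ht hskew hpar hcurv
  | succ k ih => exact ih.endActionLeft ht hskew hpar

/-- On smooth vector fields, the iterated covariant derivatives of the curvature are algebraic
expressions in the tensors `τ` and `R`. -/
lemma iterDerivCurv_eq (k : ℕ) (Y : Fin (3 + k) → VecField E M) (hY : ∀ i, IsSmoothField (Y i)) :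
    nabla.iterDerivCurv k Y = fun x =>
      iterEndAction (torsionMap nabla nablaBar x) (nabla.curvAt ht x) k fun i => Y i x := by
  induction k with
  | zero =>
    ext1 x
    exact nabla.curv_apply_eq_curvAt ht hY x
  | succ k ih =>
    have hp := isParallelTensor_iterEndAction ht hskew hpar hcurv k
    have hY0 : IsSmoothField (Y 0) := hY 0
    have htl : ∀ i : Fin (3 + k), IsSmoothField (Fin.tail (n := 3 + k) Y i) := fun i => hY i.succ
    change nabla.derivTensor (nabla.iterDerivCurv k) Y = fun x => endActionLeft
      (torsionMap nabla nablaBar x) (iterEndAction (torsionMap nabla nablaBar x)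
        (nabla.curvAt ht x) k) fun i => Y i x
    have hu : ∀ i : Fin (3 + k), nabla.iterDerivCurv k
        (Function.update (Fin.tail (n := 3 + k) Y) i (nabla.along (Y 0) (Fin.tail (n := 3 + k) Y i)))
        = fun x => iterEndAction (torsionMap nabla nablaBar x) (nabla.curvAt ht x) k
          (Function.update (fun j => Fin.tail (n := 3 + k) Y j x) i
            (nabla.along (Y 0) (Fin.tail (n := 3 + k) Y i) x)) := by
      intro i
      rw [ih _ (isSmoothField_update htl i (hY0.along nabla (htl i)))]
      simp only [update_field_apply]
    rw [endActionLeft_field_eq, Connection.derivTensor, ih _ htl]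
    simp only [hu]
    rw [along_eq_sub_torsionField nabla nablaBar (Y 0) (hp.smooth (Fin.tail (n := 3 + k) Y) htl)]
    ext1 x
    have hx := hp.along (Y 0) (Fin.tail (n := 3 + k) Y) hY0 htl x
    simp only [Pi.sub_apply, Pi.smul_apply, Finset.sum_apply]
    rw [hx]
    -- Substitute ∇ = ∇̄ - τ/2 in every slot. The ∇̄ parts cancel against the derivative of the
    -- tensor, which is parallel, and the τ parts form the derivation action.
    have hs : ∀ i : Fin (3 + k), iterEndAction (torsionMap nabla nablaBar x) (nabla.curvAt ht x) k
          (Function.update (fun j => Fin.tail (n := 3 + k) Y j x) i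
            (nabla.along (Y 0) (Fin.tail (n := 3 + k) Y i) x))
        = iterEndAction (torsionMap nabla nablaBar x) (nabla.curvAt ht x) k
          (Function.update (fun j => Fin.tail (n := 3 + k) Y j x) i
            (nablaBar.along (Y 0) (Fin.tail (n := 3 + k) Y i) x))
        - (1 / 2 : ℝ) • iterEndAction (torsionMap nabla nablaBar x) (nabla.curvAt ht x) k
          (fun j => Function.update (Fin.tail (n := 3 + k) Y) i
            (torsionField nabla nablaBar (Y 0) (Fin.tail (n := 3 + k) Y i)) j x) := by
      intro i
      rw [update_field_apply, along_eq_sub_torsionField nabla nablaBar (Y 0) (htl i),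
        Pi.sub_apply, Pi.smul_apply, MultilinearMap.map_update_sub, MultilinearMap.map_update_smul]
    simp only [hs, Finset.sum_sub_distrib, ← Finset.smul_sum]
    module

end

end SymmetrizedDerivatives

/-! ### Linear Jacobi relations on naturally reductive spaces are algebraic -/

section NaturallyReductive

variable {E : Type*} [NormedAddCommGroup E] [NormedSpace ℝ E] [FiniteDimensional ℝ E]
  {M : Type*} [TopologicalSpace M] [ChartedSpace E M] [IsManifold 𝓘(ℝ, E) ∞ M]
  [RiemannianBundle (fun x : M => TangentSpace 𝓘(ℝ, E) x)]
  [IsContMDiffRiemannianBundle 𝓘(ℝ, E) ∞ E (fun x : M => TangentSpace 𝓘(ℝ, E) x)]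
  {nabla nablaBar : Connection E M}

namespace IsNaturallyReductive

lemma torsionEnd_self (h : IsNaturallyReductive nabla nablaBar) {p : M}
    (X : TangentSpace 𝓘(ℝ, E) p) : torsionEnd nabla nablaBar X X = 0 :=
  inner_self_eq_zero.1 ((h.alternating p X (torsionEnd nabla nablaBar X X)).1)

lemma torsionEnd_swap (h : IsNaturallyReductive nabla nablaBar) (p : M)
    (X Y : TangentSpace 𝓘(ℝ, E) p) :
    torsionEnd nabla nablaBar X Y = -torsionEnd nabla nablaBar Y X := by
  have h1 := h.torsionEnd_self (X + Y)
  simp only [← torsionMap_apply] at h1 ⊢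
  simp only [map_add, LinearMap.add_apply] at h1
  rw [torsionMap_apply, torsionMap_apply nabla nablaBar Y, h.torsionEnd_self, h.torsionEnd_self,
    zero_add, add_zero, add_comm] at h1
  exact eq_neg_of_add_eq_zero_left h1

lemma torsionEnd_skew (h : IsNaturallyReductive nabla nablaBar) {p : M}
    (X Y Z : TangentSpace 𝓘(ℝ, E) p) : inner ℝ (torsionEnd nabla nablaBar X Y) Z
      = -inner ℝ Y (torsionEnd nabla nablaBar X Z) := by
  have h1 := (h.alternating p X (Y + Z)).2.1
  rw [map_add, inner_add_left, inner_add_right, inner_add_right,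
    (h.alternating p X Y).2.1, (h.alternating p X Z).2.1, zero_add, add_zero] at h1
  rw [eq_neg_of_add_eq_zero_left h1, real_inner_comm]

end IsNaturallyReductive

variable [T2Space M] [nabla.ContMDiffCovariantDerivative ∞]

lemma jacobiOp_smul (ht : nabla.torsion = 0) {p : M} (t : ℝ) (X : TangentSpace 𝓘(ℝ, E) p) :
    nabla.jacobiOp (t • X) = t ^ 2 • nabla.jacobiOp X := by
  refine LinearMap.ext fun U => ?_
  rw [LinearMap.smul_apply, nabla.jacobiOp_eq_curvAt ht, nabla.jacobiOp_eq_curvAt ht]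
  have h1 : ![U, t • X, t • X] = Function.update ![U, X, t • X] 1 (t • X) := by
    ext1 i; fin_cases i <;> simp
  have h2 : ![U, X, t • X] = Function.update ![U, X, X] 2 (t • X) := by
    ext1 i; fin_cases i <;> simp
  have h3 : Function.update ![U, X, t • X] 1 X = ![U, X, t • X] := by
    ext1 i; fin_cases i <;> simp
  have h4 : Function.update ![U, X, X] 2 X = ![U, X, X] := by
    ext1 i; fin_cases i <;> simp
  rw [h1, MultilinearMap.map_update_smul, h3, h2, MultilinearMap.map_update_smul, h4, smul_smul,
    pow_two]

/-- The bridge from analysis to algebra: derivatives of R are iterated actions of τ, and with equal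
directions these are powers of the half commutator. -/
lemma symDerivCurv_eq [nablaBar.ContMDiffCovariantDerivative ∞]
    (hLC : IsLeviCivita nabla) (hNR : IsNaturallyReductive nabla nablaBar) (k : ℕ)
    {X U : VecField E M} (hX : IsSmoothField X) (hU : IsSmoothField U) (x : M) :
    nabla.symDerivCurv k X U x
      = ((halfCommutator (torsionMap nabla nablaBar x (X x))) ^ k) (nabla.jacobiOp (X x)) (U x) := by
  have hF : ∀ i : Fin (3 + k), IsSmoothField (if (i : ℕ) = k then U else X) := by
    intro i; split_ifs <;> assumption
  rw [Connection.symDerivCurv, iterDerivCurv_eq hLC.torsion_free hNR.torsionEnd_swap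
    hNR.ambroseSinger.torsion_parallel hNR.ambroseSinger.curvature_parallel k _ hF,
    ← iterEndAction_apply_symmetric (torsionMap nabla nablaBar x)
      (nabla.curvAt hLC.torsion_free x) (hNR.torsionEnd_self (X x)) _
      (fun V => nabla.jacobiOp_eq_curvAt hLC.torsion_free (X x) V)]
  have : (fun i : Fin (3 + k) => (if (i : ℕ) = k then U else X) x)
      = fun i : Fin (3 + k) => if (i : ℕ) = k then U x else X x := by
    funext i
    split_ifs <;> rfl
  exact congrArg _ this

/-- Both sides amount to the vanishing of the homogenized relation on all tangent vectors: every
pair of tangent vectors extends to smooth fields, and the quadratic behaviour of the Jacobi operator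
reduces the claim to unit vectors. -/
theorem isLinearJacobi_iff [nablaBar.ContMDiffCovariantDerivative ∞]
    (hLC : IsLeviCivita nabla) (hNR : IsNaturallyReductive nabla nablaBar) (P : Polynomial ℝ) :
    IsLinearJacobi nabla P ↔ P.Monic ∧ HasParity P ∧ AlgebraicJacobi nabla nablaBar P := by
  have hrel : (∀ X U : VecField E M, IsSmoothField X → IsSmoothField U → ∀ x : M,
      ∑ i ∈ Finset.range (P.natDegree + 1),
        (P.coeff i * ‖X x‖ ^ (P.natDegree - i)) • nabla.symDerivCurv i X U x = 0)
      ↔ ∀ (x : M) (v : TangentSpace 𝓘(ℝ, E) x), homogenizedRelation (torsionMap nabla nablaBar x)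
        (fun v => nabla.jacobiOp v) P v = 0 := by
    constructor
    · intro h x v
      refine LinearMap.ext fun u => ?_
      have := h _ _ (isSmoothField_smoothExtend v) (isSmoothField_smoothExtend u) x
      simp only [symDerivCurv_eq hLC hNR _ (isSmoothField_smoothExtend v)
        (isSmoothField_smoothExtend u), smoothExtend_self] at this
      simpa [homogenizedRelation, LinearMap.sum_apply] using this
    · intro h X U hX hU x
      have := congrArg (fun A => A (U x)) (h x (X x))
      simp only [homogenizedRelation, LinearMap.sum_apply, LinearMap.smul_apply,
        LinearMap.zero_apply] at this
      simpa only [symDerivCurv_eq hLC hNR _ hX hU] using this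
  have halg : AlgebraicJacobi nabla nablaBar P ↔ ∀ (x : M) (v : TangentSpace 𝓘(ℝ, E) x),
      homogenizedRelation (torsionMap nabla nablaBar x) (fun v => nabla.jacobiOp v) P v = 0 :=
    forall_congr' fun x => (homogenizedRelation_eq_zero_iff (torsionMap nabla nablaBar x)
      (fun t v => jacobiOp_smul hLC.torsion_free t v) P).symm
  rw [halg, ← hrel]
  exact ⟨fun h => ⟨h.monic, h.parity, h.relation⟩, fun h => ⟨h.1, h.2.1, h.2.2⟩⟩

/-- The endomorphism `U ↦ R(U, v) w` as a bilinear function of `v` and `w`. -/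
def curvEnd (ht : nabla.torsion = 0) (p : M) : TangentSpace 𝓘(ℝ, E) p →ₗ[ℝ]
    TangentSpace 𝓘(ℝ, E) p →ₗ[ℝ] (TangentSpace 𝓘(ℝ, E) p →L[ℝ] TangentSpace 𝓘(ℝ, E) p) :=
  LinearMap.mk₂ ℝ
    (fun v w => endCLM (TangentSpace 𝓘(ℝ, E) p) ((nabla.curvAt ht p).toLinearMap ![0, v, w] 0))
    (fun v v' w => by
      rw [← map_add]
      congr 1
      refine LinearMap.ext fun U => ?_
      have h : ∀ v, Function.update ![0, v, w] 0 U = Function.update ![U, 0, w] 1 v := by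
        intro v; ext1 i; fin_cases i <;> simp
      simp only [LinearMap.add_apply, MultilinearMap.toLinearMap_apply, h,
        MultilinearMap.map_update_add])
    (fun c v w => by
      rw [← map_smul]
      congr 1
      refine LinearMap.ext fun U => ?_
      have h : ∀ v, Function.update ![0, v, w] 0 U = Function.update ![U, 0, w] 1 v := by
        intro v; ext1 i; fin_cases i <;> simp
      simp only [LinearMap.smul_apply, MultilinearMap.toLinearMap_apply, h,
        MultilinearMap.map_update_smul])
    (fun v w w' => by
      rw [← map_add]
      congr 1
      refine LinearMap.ext fun U => ?_
      have h : ∀ w, Function.update ![0, v, w] 0 U = Function.update ![U, v, 0] 2 w := by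
        intro w; ext1 i; fin_cases i <;> simp
      simp only [LinearMap.add_apply, MultilinearMap.toLinearMap_apply, h,
        MultilinearMap.map_update_add])
    (fun c v w => by
      rw [← map_smul]
      congr 1
      refine LinearMap.ext fun U => ?_
      have h : ∀ w, Function.update ![0, v, w] 0 U = Function.update ![U, v, 0] 2 w := by
        intro w; ext1 i; fin_cases i <;> simp
      simp only [LinearMap.smul_apply, MultilinearMap.toLinearMap_apply, h,
        MultilinearMap.map_update_smul])

/-- A bilinear map restricted to the diagonal; its analyticity feeds the identity theorem. -/
lemma contDiff_jacobiOp (ht : nabla.torsion = 0) (p : M) :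
    ContDiff ℝ ω fun v : TangentSpace 𝓘(ℝ, E) p =>
      endCLM (TangentSpace 𝓘(ℝ, E) p) (nabla.jacobiOp v) := by
  have h : (fun v : TangentSpace 𝓘(ℝ, E) p => endCLM (TangentSpace 𝓘(ℝ, E) p) (nabla.jacobiOp v))
      = fun v => (curvEnd ht p).toContinuousBilinearMap v v := by
    ext1 v
    change _ = endCLM (TangentSpace 𝓘(ℝ, E) p) ((nabla.curvAt ht p).toLinearMap ![0, v, v] 0)
    congr 1
    refine LinearMap.ext fun U => ?_
    rw [nabla.jacobiOp_eq_curvAt ht, MultilinearMap.toLinearMap_apply]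
    congr 1
    ext1 i; fin_cases i <;> simp
  rw [h]
  exact (ContinuousLinearMap.contDiff _).clm_apply contDiff_id

end NaturallyReductive

/-! ### Linear differential equations and multilinear maps -/

section LinearODE

open Set

/-- Solutions of a linear differential equation with small coefficients are determined by their
initial value. -/
lemma linearODE_unique {F : Type*} [NormedAddCommGroup F] [NormedSpace ℝ F] {B : ℝ → F →L[ℝ] F}
    (hb : ∀ t ∈ Ioo (-2 : ℝ) 2, ‖B t‖ ≤ 1 / 4) {y z : ℝ → F}
    (hy : ∀ t ∈ Ioo (-2 : ℝ) 2, HasDerivAt y (B t (y t)) t)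
    (hz : ∀ t ∈ Ioo (-2 : ℝ) 2, HasDerivAt z (B t (z t)) t) (h0 : y 0 = z 0) :
    EqOn y z (Ioo (-2) 2) := by
  refine ODE_solution_unique_of_mem_Ioo (v := fun t x => B t x) (s := fun _ => univ) (K := 1 / 4)
    (t₀ := 0) (fun t ht => ?_) (by norm_num) (fun t ht => ⟨hy t ht, trivial⟩)
    (fun t ht => ⟨hz t ht, trivial⟩) h0
  refine ((B t).lipschitz.weaken ?_).lipschitzOnWith
  rw [← NNReal.coe_le_coe]
  simpa using hb t ht

/-- Picard–Lindelöf in the unit ball around the identity: there ‖Ψ‖ ≤ 2, so the speed is at most 1/2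
and the displacement in time 2 at most 1. The interval exceeds [0, 1], so that both times of
interest are interior. -/
lemma exists_linearODE_solution {E : Type*} [NormedAddCommGroup E] [NormedSpace ℝ E]
    [CompleteSpace E] {A : ℝ → E →L[ℝ] E} (hA : ContinuousOn A (Icc (-2) 2))
    (hb : ∀ t ∈ Icc (-2 : ℝ) 2, ‖A t‖ ≤ 1 / 4) :
    ∃ Φ : ℝ → E →L[ℝ] E, Φ 0 = 1 ∧ ∀ t ∈ Ioo (-2 : ℝ) 2, HasDerivAt Φ (A t * Φ t) t := by
  have hP : IsPicardLindelof (fun t (Ψ : E →L[ℝ] E) => A t * Ψ) (tmin := -2) (tmax := 2)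
      ⟨0, by norm_num⟩ 1 1 0 (1 / 2) (1 / 4) := by
    refine ⟨fun t ht => LipschitzOnWith.of_dist_le_mul fun Ψ _ Ψ' _ => ?_,
      fun Ψ _ => hA.mul continuousOn_const, fun t ht Ψ hΨ => ?_, ?_⟩
    · rw [dist_eq_norm, dist_eq_norm, ← mul_sub]
      exact (norm_mul_le _ _).trans (mul_le_mul_of_nonneg_right (by simpa using hb t ht)
        (norm_nonneg _))
    · have h1 : ‖Ψ‖ ≤ 2 := by
        have h2 : ‖Ψ - 1‖ ≤ 1 := by simpa [dist_eq_norm] using hΨ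
        have h3 : ‖(1 : E →L[ℝ] E)‖ ≤ 1 := ContinuousLinearMap.norm_id_le
        calc ‖Ψ‖ = ‖(Ψ - 1) + 1‖ := by rw [sub_add_cancel]
          _ ≤ ‖Ψ - 1‖ + ‖(1 : E →L[ℝ] E)‖ := norm_add_le _ _
          _ ≤ 2 := by linarith
      refine (norm_mul_le _ _).trans ((mul_le_mul (hb t ht) h1 (norm_nonneg _)
        (by norm_num)).trans ?_)
      norm_num
    · norm_num
  obtain ⟨Φ, h0, hΦ⟩ := hP.exists_eq_forall_mem_Icc_hasDerivWithinAt₀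
  exact ⟨Φ, h0, fun t ht => (hΦ t (Ioo_subset_Icc_self ht)).hasDerivAt (Icc_mem_nhds ht.1 ht.2)⟩

variable {E F : Type*} [NormedAddCommGroup E] [NormedSpace ℝ E] [FiniteDimensional ℝ E]
  [NormedAddCommGroup F] [NormedSpace ℝ F]

/-- The product rule for the evaluation of a curve of multilinear maps. -/
lemma hasDerivAt_multilinearMap_apply {n : ℕ} {σ : ℝ → MultilinearMap ℝ (fun _ : Fin n => E) F}
    {σ' : (Fin n → E) → F} {s : ℝ} (hσ : ∀ a, HasDerivAt (fun t => σ t a) (σ' a) s)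
    {y : Fin n → ℝ → E} {y' : Fin n → E} (hy : ∀ i, HasDerivAt (y i) (y' i) s) :
    HasDerivAt (fun t => σ t fun i => y i t)
      (σ' (fun i => y i s) + ∑ i, σ s (Function.update (fun i => y i s) i (y' i))) s := by
  induction n with
  | zero =>
    have h : ∀ t, (fun i => y i t) = fun i => y i s := fun t => funext fun i => i.elim0
    simp only [h]
    simpa using hσ fun i => y i s
  | succ n ih =>
    set b := Module.finBasis ℝ E
    have hexp : ∀ (T : MultilinearMap ℝ (fun _ : Fin (n + 1) => E) F) (v : E) (m : Fin n → E),
        T (Fin.cons v m) = ∑ j, b.repr v j • T.curryLeft (b j) m := by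
      intro T v m
      rw [← MultilinearMap.curryLeft_apply]
      conv_lhs => rw [← b.sum_repr v]
      simp only [map_sum, map_smul, sum_apply, smul_apply]
    have hcons : ∀ t, (fun i => y i t) = Fin.cons (y 0 t) fun i : Fin n => y i.succ t := by
      intro t
      ext1 i
      refine Fin.cases ?_ (fun i => ?_) i <;> simp
    have hc : ∀ j, HasDerivAt (fun t => b.repr (y 0 t) j) (b.repr (y' 0) j) s := fun j =>
      ((LinearMap.toContinuousLinearMap (b.coord j)).hasFDerivAt.comp_hasDerivAt s (hy 0))
    have hD : ∀ j, HasDerivAt (fun t => (σ t).curryLeft (b j) fun i => y i.succ t)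
        (σ' (Fin.cons (b j) fun i => y i.succ s) + ∑ i, (σ s).curryLeft (b j)
          (Function.update (fun i => y i.succ s) i (y' i.succ))) s := fun j =>
      ih (σ := fun t => (σ t).curryLeft (b j)) (σ' := fun m => σ' (Fin.cons (b j) m))
        (fun a => hσ (Fin.cons (b j) a)) (fun i => hy i.succ)
    -- σ' is merely a function; its linearity in the first slot follows from uniqueness of
    -- derivatives.
    have hσ' : σ' (Fin.cons (y 0 s) fun i : Fin n => y i.succ s)
        = ∑ j, b.repr (y 0 s) j • σ' (Fin.cons (b j) fun i => y i.succ s) := by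
      refine (hσ _).unique ?_
      simp only [hexp]
      exact HasDerivAt.fun_sum fun j _ => (hσ (Fin.cons (b j) fun i => y i.succ s)).const_smul _
    have hmain := HasDerivAt.fun_sum (u := Finset.univ) fun j _ => (hc j).smul (hD j)
    simp only [hcons, hexp (σ _)]
    convert! hmain using 1
    rw [hσ', Fin.sum_univ_succ]
    simp only [← Fin.cons_update, Fin.update_cons_zero, hexp, Finset.sum_add_distrib, smul_add,
      Finset.smul_sum]
    rw [Finset.sum_comm (γ := Fin n)]
    abel

/-- If the derivative of a curve of tensors is given by the action of `-A`, then the tensors are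
intertwined by the solution of `Φ' = A Φ`. -/
lemma multilinearMap_apply_eq_of_hasDerivAt {n : ℕ}
    {σ : ℝ → MultilinearMap ℝ (fun _ : Fin n => E) F} {A : ℝ → E →L[ℝ] E} {B : ℝ → F →L[ℝ] F}
    (hb : ∀ t ∈ Ioo (-2 : ℝ) 2, ‖B t‖ ≤ 1 / 4)
    (hσ : ∀ t ∈ Ioo (-2 : ℝ) 2, ∀ a, HasDerivAt (fun t => σ t a)
      (B t (σ t a) - ∑ i, σ t (Function.update a i (A t (a i)))) t)
    {Φ : ℝ → E →L[ℝ] E} (hΦ : ∀ t ∈ Ioo (-2 : ℝ) 2, HasDerivAt Φ (A t * Φ t) t) (hΦ0 : Φ 0 = 1)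
    {Ψ : ℝ → F →L[ℝ] F} (hΨ : ∀ t ∈ Ioo (-2 : ℝ) 2, HasDerivAt Ψ (B t * Ψ t) t) (hΨ0 : Ψ 0 = 1)
    {t : ℝ} (ht : t ∈ Ioo (-2 : ℝ) 2) (a : Fin n → E) :
    σ t (fun i => Φ t (a i)) = Ψ t (σ 0 a) := by
  refine linearODE_unique hb (y := fun t => σ t fun i => Φ t (a i)) (z := fun t => Ψ t (σ 0 a))
    (fun s hs => ?_) (fun s hs => ?_) (by simp [hΦ0, hΨ0]) ht
  · have h := hasDerivAt_multilinearMap_apply (hσ s hs) (y := fun i t => Φ t (a i))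
      (y' := fun i => A s (Φ s (a i)))
      (fun i => by simpa using (hΦ s hs).clm_apply (hasDerivAt_const s (a i)))
    simpa using h
  · simpa using (hΨ s hs).clm_apply (hasDerivAt_const s (σ 0 a))

end LinearODE

/-! ### Parallel transport of parallel tensors in tangent coordinates -/

section Transport

open Filter Topology Set

variable {E : Type*} [NormedAddCommGroup E] [NormedSpace ℝ E] [FiniteDimensional ℝ E]
  {M : Type*} [TopologicalSpace M] [ChartedSpace E M] [IsManifold 𝓘(ℝ, E) ∞ M] [T2Space M]

/-- The domain near `p` on which the fields `frameField p` form a frame. -/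
def frameDomain (E : Type*) [NormedAddCommGroup E] [NormedSpace ℝ E] [FiniteDimensional ℝ E]
    {M : Type*} [TopologicalSpace M] [ChartedSpace E M] (p : M) : Set M :=
  {x | x ∈ (chartAt E p).source ∧ ∀ᶠ y in 𝓝 x, bumpAt E p y = 1}

lemma frameDomain_mem_nhds (p : M) : frameDomain E p ∈ 𝓝 p :=
  inter_mem ((chartAt E p).open_source.mem_nhds (mem_chart_source E p))
    (eventually_eventually_nhds.2 (bumpAt E p).eventuallyEq_one)

lemma isOpen_frameDomain (p : M) : IsOpen (frameDomain E p) :=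
  (chartAt E p).open_source.inter isOpen_setOfPred_eventually_nhds

/-- The tangent coordinates at `p`. -/
def tangentCoord (p x : M) : TangentSpace 𝓘(ℝ, E) x →L[ℝ] E :=
  (trivializationAt E (fun x : M => TangentSpace 𝓘(ℝ, E) x) p).continuousLinearMapAt ℝ x

section Frame

variable {p x : M} (hx : x ∈ frameDomain E p)
include hx

lemma bumpAt_eq_one : bumpAt E p x = 1 := hx.2.self_of_nhds

lemma frameField_eq_symmL (a : E) : frameField p a x =
    (trivializationAt E (fun x : M => TangentSpace 𝓘(ℝ, E) x) p).symmL ℝ x a := by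
  rw [frameField_apply, bumpAt_eq_one hx, one_smul]

lemma tangentCoord_frameField (a : E) : tangentCoord p x (frameField p a x) = a := by
  rw [frameField_eq_symmL hx]
  exact (trivializationAt E (fun x : M => TangentSpace 𝓘(ℝ, E) x) p).continuousLinearMapAt_symmL
    (show x ∈ _ from hx.1) a

lemma frameField_tangentCoord (u : TangentSpace 𝓘(ℝ, E) x) :
    frameField p (tangentCoord p x u) x = u := by
  rw [frameField_eq_symmL hx]
  exact (trivializationAt E (fun x : M => TangentSpace 𝓘(ℝ, E) x) p).symmL_continuousLinearMapAt
    (show x ∈ _ from hx.1) u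

end Frame

/-- The derivative of a function along a coordinate line. -/
lemma hasDerivAt_comp_coordLine {p : M} {h : M → ℝ} (hh : ∀ x, MDiffAt h x) {z v : E} {s : ℝ}
    (hz : z + s • v ∈ (extChartAt 𝓘(ℝ, E) p).target)
    (hx : (extChartAt 𝓘(ℝ, E) p).symm (z + s • v) ∈ frameDomain E p) :
    HasDerivAt (fun s : ℝ => h ((extChartAt 𝓘(ℝ, E) p).symm (z + s • v)))
      (d% h ((extChartAt 𝓘(ℝ, E) p).symm (z + s • v))
        (frameField p v ((extChartAt 𝓘(ℝ, E) p).symm (z + s • v)))) s := by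
  have h1 := (mdifferentiableWithinAt_extChartAt_symm hz).hasMFDerivWithinAt
  -- The derivative of the inverse chart is the inverse trivialization, so the coordinate line in
  -- direction v has the frame field of v as its velocity.
  have hS := TangentBundle.symmL_trivializationAt (I := 𝓘(ℝ, E)) (x₀ := p)
    (x := (extChartAt 𝓘(ℝ, E) p).symm (z + s • v)) hx.1
  rw [(extChartAt 𝓘(ℝ, E) p).right_inv hz] at hS
  rw [← hS] at h1
  simp only [modelWithCornersSelf_coe, range_id] at h1
  have h2 := ((hh _).hasMFDerivAt.comp _ (hasMFDerivWithinAt_univ.1 h1)).hasFDerivAt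
  have h3 : HasDerivAt (fun s : ℝ => z + s • v) v s := by
    simpa using ((hasDerivAt_id s).smul_const v).const_add z
  have h4 := h2.comp_hasDerivAt s h3
  rw [frameField_eq_symmL hx]
  exact h4

/-- Smooth vector fields in tangent coordinates, together with their covariant derivatives. -/
lemma exists_tangentCoord_eq (nabla : Connection E M) {p : M} {Y : VecField E M}
    (hY : IsSmoothField Y) : ∃ g : Fin (Module.finrank ℝ E) → M → ℝ, (∀ i, CMDiff ∞ (g i)) ∧
      (∀ x ∈ frameDomain E p,
        tangentCoord p x (Y x) = ∑ i, g i x • Module.finBasis ℝ E i) ∧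
      ∀ x ∈ frameDomain E p, ∀ w, nabla Y x w =
        ∑ i, (g i x • nabla (frameField p (Module.finBasis ℝ E i)) x w
          + d% (g i) x w • frameField p (Module.finBasis ℝ E i) x) := by
  obtain ⟨g, hg, -, hgY, hgc⟩ := exists_frame_decomposition hY p
  refine ⟨g, hg, fun x hx => (hgc x hx.1 (bumpAt_eq_one hx)).symm, fun x hx w => ?_⟩
  have hF := fun i => isSmoothField_frameField p (Module.finBasis ℝ E i)
  -- Near x the cut-off is one, so Y may be replaced by a global combination of frame fields.
  have h1 : nabla Y x = nabla ((fun y => bumpAt E p y ^ 2) • Y) x := by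
    refine nabla.isCovariantDerivativeOnUniv.congr_of_eventuallyEq (hY.mdifferentiableAt x)
      ((hY.smul ((bumpAt E p).contMDiff.pow 2)).mdifferentiableAt x) Filter.univ_mem ?_
    filter_upwards [hx.2] with y hy
    simp [hy]
  obtain ⟨W, rfl⟩ : ∃ W : VecField E M, W x = w := ⟨smoothExtend w, smoothExtend_self w⟩
  rw [h1, hgY, ← Connection.along_apply, nabla.along_sum_right _ fun i _ => (hF i).smul (hg i)]
  simp only [Finset.sum_apply, nabla.along_smul_right (hg _) W (hF _)]
  rfl

/-- The Christoffel symbols of a connection in tangent coordinates. -/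
def christoffel (nabla : Connection E M) (p x : M) : E →ₗ[ℝ] E →ₗ[ℝ] E :=
  LinearMap.mk₂ ℝ (fun w a => tangentCoord p x (nabla (frameField p a) x (frameField p w x)))
    (fun w w' a => by simp)
    (fun c w a => by simp)
    (fun w a a' => by
      have := congrFun (nabla.along_add_right (frameField p w) (isSmoothField_frameField p a)
        (isSmoothField_frameField p a')) x
      simp only [Connection.along_apply, Pi.add_apply] at this
      rw [map_add, this, map_add])
    (fun c w a => by
      have := congrFun (nabla.along_const_smul_right c (frameField p w)
        (isSmoothField_frameField p a)) x
      simp only [Connection.along_apply, Pi.smul_apply] at this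
      rw [map_smul, this, map_smul])

lemma christoffel_apply (nabla : Connection E M) (p x : M) (w a : E) : christoffel nabla p x w a
    = tangentCoord p x (nabla (frameField p a) x (frameField p w x)) := rfl

/-- The derivative of the tangent coordinates of a vector field along a coordinate line. -/
lemma hasDerivAt_tangentCoord (nabla : Connection E M) {p : M} {Y : VecField E M}
    (hY : IsSmoothField Y) {γ : ℝ → M} {z v : E} {s : ℝ}
    (hγ : γ = fun s => (extChartAt 𝓘(ℝ, E) p).symm (z + s • v))
    (hz : z + s • v ∈ (extChartAt 𝓘(ℝ, E) p).target) (hx : γ s ∈ frameDomain E p) :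
    HasDerivAt (fun s => tangentCoord p (γ s) (Y (γ s)))
      (tangentCoord p (γ s) (nabla Y (γ s) (frameField p v (γ s)))
        - christoffel nabla p (γ s) v (tangentCoord p (γ s) (Y (γ s)))) s := by
  obtain ⟨g, hg, hgY, hgn⟩ := exists_tangentCoord_eq nabla (p := p) hY
  have hcont : ContinuousAt γ s := by
    rw [hγ]
    exact ((continuousAt_extChartAt_symm'' (I := 𝓘(ℝ, E)) hz).comp (x := s)
      (f := fun s : ℝ => z + s • v) (by fun_prop))
  have hd : HasDerivAt (fun s => ∑ i, g i (γ s) • Module.finBasis ℝ E i)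
      (∑ i, d% (g i) (γ s) (frameField p v (γ s)) • Module.finBasis ℝ E i) s := by
    refine HasDerivAt.fun_sum fun i _ => HasDerivAt.smul_const ?_ _
    subst hγ
    exact hasDerivAt_comp_coordLine
      (fun x => (hg i).contMDiffAt.mdifferentiableAt (by simp)) hz hx
  have he : (fun s => tangentCoord p (γ s) (Y (γ s)))
      =ᶠ[𝓝 s] fun s => ∑ i, g i (γ s) • Module.finBasis ℝ E i := by
    filter_upwards [hcont ((isOpen_frameDomain p).mem_nhds hx)] with r hr
    exact hgY _ hr
  convert! hd.congr_of_eventuallyEq he using 1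
  rw [hgn _ hx, hgY _ hx, map_sum, map_sum, ← Finset.sum_sub_distrib]
  refine Finset.sum_congr rfl fun i _ => ?_
  rw [map_add, map_smul, map_smul, map_smul, christoffel_apply, tangentCoord_frameField hx]
  abel

lemma continuousAt_tangentCoord {p x : M} (hx : x ∈ frameDomain E p) {Y : VecField E M}
    (hY : IsSmoothField Y) (nabla : Connection E M) :
    ContinuousAt (fun y => tangentCoord p y (Y y)) x := by
  obtain ⟨g, hg, hgY, -⟩ := exists_tangentCoord_eq nabla (p := p) hY
  have he : (fun y => tangentCoord p y (Y y))
      =ᶠ[𝓝 x] fun y => ∑ i, g i y • Module.finBasis ℝ E i := by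
    filter_upwards [(isOpen_frameDomain p).mem_nhds hx] with y hy
    exact hgY _ hy
  refine ContinuousAt.congr ?_ he.symm
  exact (continuous_finsetSum _ fun i _ =>
    (hg i).continuous.smul continuous_const).continuousAt

lemma continuousAt_christoffel (nabla : Connection E M) [nabla.ContMDiffCovariantDerivative ∞]
    {p x : M} (hx : x ∈ frameDomain E p) :
    ContinuousAt (fun y => (christoffel nabla p y).toContinuousBilinearMap) x := by
  rw [continuousAt_clm_apply]
  intro w
  rw [continuousAt_clm_apply]
  intro a
  exact continuousAt_tangentCoord hx
    ((isSmoothField_frameField p w).along nabla (isSmoothField_frameField p a)) nabla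

end Transport

/-- A bilinear map as a multilinear map of two arguments. -/
def multilinearOfBilin {V W : Type*} [AddCommGroup V] [Module ℝ V] [AddCommGroup W] [Module ℝ W]
    (B : V →ₗ[ℝ] V →ₗ[ℝ] W) : MultilinearMap ℝ (fun _ : Fin 2 => V) W where
  toFun a := B (a 0) (a 1)
  map_update_add' a i x y := by fin_cases i <;> simp [Function.update]
  map_update_smul' a i c x := by fin_cases i <;> simp [Function.update]

lemma multilinearOfBilin_apply {V W : Type*} [AddCommGroup V] [Module ℝ V] [AddCommGroup W]
    [Module ℝ W] (B : V →ₗ[ℝ] V →ₗ[ℝ] W) (a : Fin 2 → V) :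
    multilinearOfBilin B a = B (a 0) (a 1) := rfl

/-! ### Parallel transport as an isometry preserving parallel tensors. -/

section ParallelTransport

open Filter Topology Set

variable {E : Type*} [NormedAddCommGroup E] [NormedSpace ℝ E] [FiniteDimensional ℝ E]
  {M : Type*} [TopologicalSpace M] [ChartedSpace E M] [IsManifold 𝓘(ℝ, E) ∞ M] [T2Space M]

/-- Coordinate segments that start at the centre of the chart stay in the frame domain, and the
connection coefficients along them are small. -/
lemma eventually_coordLine (nabla : Connection E M) [nabla.ContMDiffCovariantDerivative ∞] (p : M) :
    ∀ᶠ q in 𝓝 p, ∃ v : E, (extChartAt 𝓘(ℝ, E) p).symm (extChartAt 𝓘(ℝ, E) p p + (1 : ℝ) • v) = q ∧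
      ∀ s ∈ Icc (-2 : ℝ) 2, extChartAt 𝓘(ℝ, E) p p + s • v ∈ (extChartAt 𝓘(ℝ, E) p).target ∧
        (extChartAt 𝓘(ℝ, E) p).symm (extChartAt 𝓘(ℝ, E) p p + s • v) ∈ frameDomain E p ∧
        ‖(christoffel nabla p
          ((extChartAt 𝓘(ℝ, E) p).symm (extChartAt 𝓘(ℝ, E) p p + s • v))).toContinuousBilinearMap v‖
            ≤ 1 / 4 := by
  set e := extChartAt 𝓘(ℝ, E) p with he
  set C := ‖(christoffel nabla p p).toContinuousBilinearMap‖ + 1 with hC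
  have hCpos : 0 < C := by positivity
  have hpF : p ∈ frameDomain E p := mem_of_mem_nhds (frameDomain_mem_nhds p)
  have hN : ∀ᶠ x in 𝓝 p, x ∈ frameDomain E p ∧
      ‖(christoffel nabla p x).toContinuousBilinearMap‖ < C :=
    Filter.Eventually.and (frameDomain_mem_nhds p)
      ((continuousAt_christoffel nabla hpF).norm.eventually (Iio_mem_nhds (lt_add_one _)))
  have hsymm : Tendsto e.symm (𝓝 (e p)) (𝓝 p) := by
    have := continuousAt_extChartAt_symm (I := 𝓘(ℝ, E)) p
    rwa [ContinuousAt, extChartAt_to_inv] at this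
  -- With |s| ≤ 2, the bound ‖v‖ < r/2 keeps the segment in this ball, and ‖v‖ < 1/(4C) makes the
  -- connection coefficients at most 1/4, as the differential equation lemmas require.
  obtain ⟨r, hr, hball⟩ := Metric.eventually_nhds_iff.1
    ((hsymm.eventually hN).and (extChartAt_target_mem_nhds (I := 𝓘(ℝ, E)) p))
  have hcont : Tendsto (fun q => e q - e p) (𝓝 p) (𝓝 0) := by
    have h := (continuousAt_extChartAt (I := 𝓘(ℝ, E)) p).tendsto.sub_const (e p)
    rwa [← he, sub_self] at h
  have hsmall := hcont.norm
  rw [norm_zero] at hsmall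
  filter_upwards [extChartAt_source_mem_nhds (I := 𝓘(ℝ, E)) p,
    hsmall.eventually (Iio_mem_nhds (show 0 < r / 2 by positivity)),
    hsmall.eventually (Iio_mem_nhds (show 0 < 1 / (4 * C) by positivity))] with q hq h1 h2
  refine ⟨e q - e p, by simpa using e.left_inv hq, fun s hs => ?_⟩
  have hs' : |s| ≤ 2 := abs_le.2 hs
  have hd : dist (e p + s • (e q - e p)) (e p) < r := by
    rw [dist_eq_norm, add_sub_cancel_left, norm_smul, Real.norm_eq_abs]
    nlinarith [norm_nonneg (e q - e p), abs_nonneg s]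
  obtain ⟨⟨hF, hn⟩, ht⟩ := hball hd
  refine ⟨ht, hF, (ContinuousLinearMap.le_opNorm _ _).trans ?_⟩
  rw [lt_div_iff₀ (by positivity)] at h2
  nlinarith [norm_nonneg (e q - e p)]

/-- A tensor in tangent coordinates. -/
def coordTensor {n : ℕ} (S : ∀ x : M, MultilinearMap ℝ (fun _ : Fin n => TangentSpace 𝓘(ℝ, E) x)
    (TangentSpace 𝓘(ℝ, E) x)) (p x : M) : MultilinearMap ℝ (fun _ : Fin n => E) E :=
  (tangentCoord p x).toLinearMap.compMultilinearMap
    ((S x).compLinearMap fun _ => (LinearMap.proj x).comp (frameField p))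

lemma coordTensor_apply {n : ℕ}
    (S : ∀ x : M, MultilinearMap ℝ (fun _ : Fin n => TangentSpace 𝓘(ℝ, E) x)
      (TangentSpace 𝓘(ℝ, E) x)) (p x : M) (a : Fin n → E) :
    coordTensor S p x a = tangentCoord p x (S x fun i => frameField p (a i) x) := rfl

lemma frameField_update {n : ℕ} (p x : M) (a : Fin n → E) (i : Fin n) (c : E) :
    (fun j => frameField p (Function.update a i c j) x)
      = Function.update (fun j => frameField p (a j) x) i (frameField p c x) := by
  ext1 j
  rcases eq_or_ne j i with rfl | h <;> simp [*]

/-- A parallel tensor along a coordinate line. -/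
lemma Connection.IsParallelTensor.hasDerivAt_coordTensor {nabla : Connection E M} {n : ℕ}
    {S : ∀ x : M, MultilinearMap ℝ (fun _ : Fin n => TangentSpace 𝓘(ℝ, E) x)
      (TangentSpace 𝓘(ℝ, E) x)} (hS : nabla.IsParallelTensor S) {p : M} {γ : ℝ → M} {z v : E}
    {s : ℝ} (hγ : γ = fun s => (extChartAt 𝓘(ℝ, E) p).symm (z + s • v))
    (hz : z + s • v ∈ (extChartAt 𝓘(ℝ, E) p).target) (hx : γ s ∈ frameDomain E p)
    (a : Fin n → E) : HasDerivAt (fun s => coordTensor S p (γ s) a)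
      (-christoffel nabla p (γ s) v (coordTensor S p (γ s) a)
        - ∑ i, coordTensor S p (γ s) (Function.update a i (-christoffel nabla p (γ s) v (a i)))) s := by
  have hF := fun i => isSmoothField_frameField p (a i)
  convert! hasDerivAt_tangentCoord nabla (hS.smooth (fun i => frameField p (a i)) hF) hγ hz hx
    using 1
  have h := hS.along (frameField p v) (fun i => frameField p (a i)) (isSmoothField_frameField p v)
    hF (γ s)
  rw [Connection.along_apply] at h
  rw [h, map_sum, coordTensor_apply]
  simp only [coordTensor_apply, frameField_update, MultilinearMap.map_update_neg,
    christoffel_apply, frameField_tangentCoord hx, Connection.along_apply, Finset.sum_neg_distrib]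
  abel

variable [RiemannianBundle (fun x : M => TangentSpace 𝓘(ℝ, E) x)]
  [IsContMDiffRiemannianBundle 𝓘(ℝ, E) ∞ E (fun x : M => TangentSpace 𝓘(ℝ, E) x)]

/-- The metric in tangent coordinates. -/
def coordMetric (p x : M) : MultilinearMap ℝ (fun _ : Fin 2 => E) ℝ :=
  multilinearOfBilin ((innerₗ (TangentSpace 𝓘(ℝ, E) x)).compl₁₂
    ((LinearMap.proj x).comp (frameField p)) ((LinearMap.proj x).comp (frameField p)))

lemma coordMetric_apply (p x : M) (a : Fin 2 → E) :
    coordMetric p x a = inner ℝ (frameField p (a 0) x) (frameField p (a 1) x) := rfl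

/-- The metric along a coordinate line. -/
lemma hasDerivAt_coordMetric {nabla : Connection E M}
    (hmet : CovariantDerivative.IsMetricCompatible (I := 𝓘(ℝ, E))
      (V := fun x : M => TangentSpace 𝓘(ℝ, E) x) nabla) {p : M} {γ : ℝ → M} {z v : E}
    {s : ℝ} (hγ : γ = fun s => (extChartAt 𝓘(ℝ, E) p).symm (z + s • v))
    (hz : z + s • v ∈ (extChartAt 𝓘(ℝ, E) p).target) (hx : γ s ∈ frameDomain E p)
    (a : Fin 2 → E) : HasDerivAt (fun s => coordMetric p (γ s) a)
      (-∑ i, coordMetric p (γ s) (Function.update a i (-christoffel nabla p (γ s) v (a i)))) s := by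
  have hF := fun (a : E) (x : M) => (isSmoothField_frameField p a).mdifferentiableAt x
  have h := hmet.mvfderiv_inner_eq (x := γ s) (frameField p v) (hF (a 0) (γ s)) (hF (a 1) (γ s))
  have h1 : HasDerivAt
      (fun s => inner ℝ (frameField p (a 0) (γ s)) (frameField p (a 1) (γ s)))
      (d% (fun x => inner ℝ (frameField p (a 0) x) (frameField p (a 1) x)) (γ s)
        (frameField p v (γ s))) s := by
    subst hγ
    exact hasDerivAt_comp_coordLine (p := p)
      (h := fun x => inner ℝ (frameField p (a 0) x) (frameField p (a 1) x))
      (fun x => MDifferentiableAt.inner_bundle (hF (a 0) x) (hF (a 1) x)) hz hx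
  convert! h1 using 1
  refine Eq.trans ?_ h.symm
  rw [Fin.sum_univ_two]
  simp [coordMetric_apply, christoffel_apply, frameField_tangentCoord hx]
  exact add_comm _ _

/-- Parallel transport: nearby tangent spaces are related by an isometry which intertwines all
parallel tensors. -/
theorem eventually_exists_isometry {nabla : Connection E M} [nabla.ContMDiffCovariantDerivative ∞]
    (hmet : CovariantDerivative.IsMetricCompatible (I := 𝓘(ℝ, E))
      (V := fun x : M => TangentSpace 𝓘(ℝ, E) x) nabla) (p : M) :
    ∀ᶠ q in 𝓝 p, ∃ φ : TangentSpace 𝓘(ℝ, E) p →ₗ[ℝ] TangentSpace 𝓘(ℝ, E) q,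
      (∀ u v, inner ℝ (φ u) (φ v) = inner ℝ u v) ∧
      ∀ (n : ℕ) (S : ∀ x : M, MultilinearMap ℝ (fun _ : Fin n => TangentSpace 𝓘(ℝ, E) x)
        (TangentSpace 𝓘(ℝ, E) x)), nabla.IsParallelTensor S →
          ∀ u, S q (fun i => φ (u i)) = φ (S p u) := by
  filter_upwards [eventually_coordLine nabla p] with q ⟨v, hq, hv⟩
  set z := extChartAt 𝓘(ℝ, E) p p with hzdef
  obtain ⟨γ, hγ⟩ : ∃ γ : ℝ → M, γ = fun s => (extChartAt 𝓘(ℝ, E) p).symm (z + s • v) := ⟨_, rfl⟩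
  have hγ0 : γ 0 = p := by simp [hγ, hzdef]
  have hγ1 : γ 1 = q := by rw [hγ]; exact hq
  have hγF : ∀ s ∈ Icc (-2 : ℝ) 2, γ s ∈ frameDomain E p := fun s hs => by
    rw [hγ]; exact (hv s hs).2.1
  -- Coordinates of parallel fields along γ solve y' = -Γ(v) y, so the solution operator Φ at time 1
  -- is parallel transport from p to q.
  set A : ℝ → E →L[ℝ] E := fun s =>
    -(christoffel nabla p (γ s)).toContinuousBilinearMap v with hA
  have hAb : ∀ s ∈ Icc (-2 : ℝ) 2, ‖A s‖ ≤ 1 / 4 := fun s hs => by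
    rw [hA, norm_neg, hγ]; exact (hv s hs).2.2
  have hAc : ContinuousOn A (Icc (-2) 2) := by
    intro s hs
    refine ContinuousAt.continuousWithinAt ?_
    have hγc : ContinuousAt γ s := by
      rw [hγ]
      exact ((continuousAt_extChartAt_symm'' (I := 𝓘(ℝ, E)) (hv s hs).1).comp (x := s)
        (f := fun s : ℝ => z + s • v) (by fun_prop))
    exact (((continuousAt_christoffel nabla (hγF s hs)).comp hγc).clm_apply
      continuousAt_const).neg
  obtain ⟨Φ, hΦ0, hΦ⟩ := exists_linearODE_solution hAc hAb
  have hsub : Ioo (-2 : ℝ) 2 ⊆ Icc (-2) 2 := Ioo_subset_Icc_self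
  have h1mem : (1 : ℝ) ∈ Ioo (-2 : ℝ) 2 := by norm_num
  have hp : p ∈ frameDomain E p := mem_of_mem_nhds (frameDomain_mem_nhds p)
  have hqF : q ∈ frameDomain E p := hγ1 ▸ hγF 1 (hsub h1mem)
  refine ⟨((LinearMap.proj q).comp (frameField p)).comp
    ((Φ 1).toLinearMap.comp (tangentCoord p p).toLinearMap), fun u w => ?_, fun n S hS u => ?_⟩
  -- The metric has scalar values, on which transport is trivial: B = 0 and Ψ = 1. For
  -- tangent-valued tensors below, the values are transported by Φ as well.
  · have h := multilinearMap_apply_eq_of_hasDerivAt (σ := fun s => coordMetric p (γ s)) (A := A)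
      (B := fun _ => (0 : ℝ →L[ℝ] ℝ)) (Ψ := fun _ => 1) (fun t ht => by norm_num)
      (fun t ht a => by
        simpa [hA] using hasDerivAt_coordMetric hmet hγ (hv t (hsub ht)).1 (hγF t (hsub ht)) a)
      hΦ hΦ0 (fun t ht => by simpa using hasDerivAt_const t (1 : ℝ →L[ℝ] ℝ)) rfl h1mem
      ![tangentCoord p p u, tangentCoord p p w]
    rw [coordMetric_apply, coordMetric_apply, hγ0, hγ1] at h
    simpa [frameField_tangentCoord hp] using h
  · have h := multilinearMap_apply_eq_of_hasDerivAt (σ := fun s => coordTensor S p (γ s)) (A := A)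
      (B := A) (Ψ := Φ) (fun t ht => hAb t (hsub ht))
      (fun t ht a => hS.hasDerivAt_coordTensor hγ (hv t (hsub ht)).1 (hγF t (hsub ht)) a)
      hΦ hΦ0 hΦ hΦ0 h1mem (fun i => tangentCoord p p (u i))
    rw [coordTensor_apply, coordTensor_apply, hγ0, hγ1] at h
    have h' := congrArg (fun c => frameField p c q) h
    simp only [frameField_tangentCoord hqF, frameField_tangentCoord hp] at h'
    exact h'

end ParallelTransport

/-! ### Propagation of algebraic relations -/

section Propagation

open Filter Topology

section Intertwining

variable {V W : Type*} [NormedAddCommGroup V] [InnerProductSpace ℝ V] [FiniteDimensional ℝ V]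
  [NormedAddCommGroup W] [InnerProductSpace ℝ W] [FiniteDimensional ℝ W]

/-- Only compositions and linear combinations occur in P(𝒯)S, so φ need not be invertible here. -/
lemma comp_aeval_halfCommutator {φ : V →ₗ[ℝ] W} {A S : Module.End ℝ V} {A' S' : Module.End ℝ W}
    (hA : φ ∘ₗ A = A' ∘ₗ φ) (hS : φ ∘ₗ S = S' ∘ₗ φ) (P : Polynomial ℝ) :
    φ ∘ₗ Polynomial.aeval (halfCommutator A) P S
      = Polynomial.aeval (halfCommutator A') P S' ∘ₗ φ := by
  have hpow : ∀ n : ℕ, φ ∘ₗ (halfCommutator A ^ n) S = (halfCommutator A' ^ n) S' ∘ₗ φ := by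
    intro n
    induction n with
    | zero => simpa using hS
    | succ n ih =>
      rw [pow_succ', pow_succ', Module.End.mul_apply, Module.End.mul_apply, halfCommutator_apply,
        halfCommutator_apply, LinearMap.comp_smul, LinearMap.smul_comp, LinearMap.comp_sub,
        LinearMap.sub_comp, Module.End.mul_eq_comp, Module.End.mul_eq_comp, Module.End.mul_eq_comp,
        Module.End.mul_eq_comp, ← LinearMap.comp_assoc, ← LinearMap.comp_assoc, ih, hA,
        LinearMap.comp_assoc, LinearMap.comp_assoc, LinearMap.comp_assoc, LinearMap.comp_assoc, ih,
        hA]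
  rw [Polynomial.aeval_eq_sum_range, Polynomial.aeval_eq_sum_range]
  ext v
  have hv : ∀ n, φ ((halfCommutator A ^ n) S v) = (halfCommutator A' ^ n) S' (φ v) := fun n =>
    LinearMap.congr_fun (hpow n) v
  simp [LinearMap.sum_apply, hv]

end Intertwining

variable {E : Type*} [NormedAddCommGroup E] [NormedSpace ℝ E] [FiniteDimensional ℝ E]
  {M : Type*} [TopologicalSpace M] [ChartedSpace E M] [IsManifold 𝓘(ℝ, E) ∞ M] [T2Space M]
  [RiemannianBundle (fun x : M => TangentSpace 𝓘(ℝ, E) x)]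
  [IsContMDiffRiemannianBundle 𝓘(ℝ, E) ∞ E (fun x : M => TangentSpace 𝓘(ℝ, E) x)]
  {nabla nablaBar : Connection E M} [nabla.ContMDiffCovariantDerivative ∞]
  [nablaBar.ContMDiffCovariantDerivative ∞]

lemma isParallelTensor_torsionMap (hLC : IsLeviCivita nabla)
    (hNR : IsNaturallyReductive nabla nablaBar) :
    nablaBar.IsParallelTensor fun x => multilinearOfBilin (torsionMap nabla nablaBar x) := by
  refine ⟨fun Y hY => isSmoothField_torsionField (hY 0) (hY 1), fun W Y hW hY x => ?_⟩
  have h := along_torsionField hLC.torsion_free hNR.torsionEnd_swap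
    hNR.ambroseSinger.torsion_parallel hW (hY 0) (hY 1)
  rw [Fin.sum_univ_two]
  simp only [multilinearOfBilin_apply]
  exact congrFun h x

/-- Whether an algebraic relation holds at a point does not change locally. -/
lemma eventually_aeval_eq_zero_iff (hLC : IsLeviCivita nabla)
    (hNR : IsNaturallyReductive nabla nablaBar) (P : Polynomial ℝ) (p : M) : ∀ᶠ q in 𝓝 p,
      ((∀ X : TangentSpace 𝓘(ℝ, E) p, ‖X‖ = 1 → Polynomial.aeval
        (halfCommutator (torsionEnd nabla nablaBar X)) P (nabla.jacobiOp X) = 0) ↔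
      ∀ X : TangentSpace 𝓘(ℝ, E) q, ‖X‖ = 1 → Polynomial.aeval
        (halfCommutator (torsionEnd nabla nablaBar X)) P (nabla.jacobiOp X) = 0) := by
  filter_upwards [eventually_exists_isometry hNR.ambroseSinger.metric p] with q ⟨φ, hφ, hS⟩
  have hnorm : ∀ u, ‖φ u‖ = ‖u‖ := fun u => by
    rw [norm_eq_sqrt_real_inner, hφ, ← norm_eq_sqrt_real_inner]
  have hinj : Function.Injective φ := by
    rw [injective_iff_map_eq_zero]
    intro u hu
    rw [← norm_eq_zero, ← hnorm, hu, norm_zero]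
  have hsurj : Function.Surjective φ :=
    (LinearMap.injective_iff_surjective_of_finrank_eq_finrank
      (show Module.finrank ℝ E = Module.finrank ℝ E from rfl)).1 hinj
  have hτ : ∀ u v, φ (torsionEnd nabla nablaBar u v) = torsionEnd nabla nablaBar (φ u) (φ v) :=
    fun u v => (hS 2 _ (isParallelTensor_torsionMap hLC hNR) ![u, v]).symm
  have hR : ∀ u v, φ (nabla.jacobiOp u v) = nabla.jacobiOp (φ u) (φ v) := fun u v => by
    have h := hS 3 _ (isParallelTensor_curvAt hLC.torsion_free hNR.torsionEnd_swap
      hNR.ambroseSinger.torsion_parallel hNR.ambroseSinger.curvature_parallel) ![v, u, u]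
    rw [nabla.jacobiOp_eq_curvAt hLC.torsion_free, nabla.jacobiOp_eq_curvAt hLC.torsion_free, ← h]
    congr 1
    ext1 i
    fin_cases i <;> rfl
  have key : ∀ X : TangentSpace 𝓘(ℝ, E) p,
      Polynomial.aeval (halfCommutator (torsionEnd nabla nablaBar X)) P (nabla.jacobiOp X) = 0 ↔
      Polynomial.aeval (halfCommutator (torsionEnd nabla nablaBar (φ X))) P
        (nabla.jacobiOp (φ X)) = 0 := by
    intro X
    have h := comp_aeval_halfCommutator (φ := φ) (A := torsionEnd nabla nablaBar X)
      (A' := torsionEnd nabla nablaBar (φ X)) (S := nabla.jacobiOp X) (S' := nabla.jacobiOp (φ X))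
      (LinearMap.ext fun v => hτ X v)
      (LinearMap.ext fun v => hR X v) P
    constructor
    · intro h0
      rw [h0, LinearMap.comp_zero] at h
      refine LinearMap.ext fun w => ?_
      obtain ⟨v, rfl⟩ := hsurj w
      exact (LinearMap.congr_fun h v).symm
    · intro h0
      rw [h0, LinearMap.zero_comp] at h
      refine LinearMap.ext fun v => hinj ?_
      rw [LinearMap.zero_apply, map_zero]
      exact LinearMap.congr_fun h v
  constructor
  · intro h X hX
    obtain ⟨u, rfl⟩ := hsurj X
    exact (key u).1 (h u (by rwa [hnorm] at hX))
  · exact fun h X hX => (key X).2 (h _ (by rwa [hnorm]))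

/-- On a connected naturally reductive space, algebraic relations need only be checked at one
point. -/
theorem algebraicJacobi_of_point [ConnectedSpace M] (hLC : IsLeviCivita nabla)
    (hNR : IsNaturallyReductive nabla nablaBar) {P : Polynomial ℝ} {p : M}
    (h : ∀ X : TangentSpace 𝓘(ℝ, E) p, ‖X‖ = 1 → Polynomial.aeval
      (halfCommutator (torsionEnd nabla nablaBar X)) P (nabla.jacobiOp X) = 0) :
    AlgebraicJacobi nabla nablaBar P := by
  have hclopen : IsClopen {q : M | ∀ X : TangentSpace 𝓘(ℝ, E) q, ‖X‖ = 1 → Polynomial.aeval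
      (halfCommutator (torsionEnd nabla nablaBar X)) P (nabla.jacobiOp X) = 0} := by
    -- The local statement is an equivalence, so the set where the relation holds and its complement
    -- are both open.
    refine ⟨⟨isOpen_iff_mem_nhds.2 fun q hq => ?_⟩, isOpen_iff_mem_nhds.2 fun q hq => ?_⟩
    · filter_upwards [eventually_aeval_eq_zero_iff hLC hNR P q] with r hr
      exact fun hr' => hq (hr.2 hr')
    · filter_upwards [eventually_aeval_eq_zero_iff hLC hNR P q] with r hr
      exact hr.1 hq
  have huniv := hclopen.eq_univ ⟨p, h⟩
  exact fun q => Set.eq_univ_iff_forall.1 huniv q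

end Propagation

end

/-! ### Characterization and minimality of linear Jacobi relations. -/

theorem proposition7p7
    {E : Type*} [NormedAddCommGroup E] [NormedSpace ℝ E] [FiniteDimensional ℝ E]
    {M : Type*} [MetricSpace M] [CompleteSpace M] [ConnectedSpace M] [ChartedSpace E M]
    [IsManifold 𝓘(ℝ, E) ∞ M] [RiemannianBundle (fun x : M => TangentSpace 𝓘(ℝ, E) x)]
    [IsContMDiffRiemannianBundle 𝓘(ℝ, E) ∞ E (fun x : M => TangentSpace 𝓘(ℝ, E) x)]
    [IsRiemannianManifold 𝓘(ℝ, E) M]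
    (nabla nablaBar : Connection E M)
    [nabla.ContMDiffCovariantDerivative ∞] [nablaBar.ContMDiffCovariantDerivative ∞]
    (hLC : IsLeviCivita nabla) (hNR : IsNaturallyReductive nabla nablaBar)
    (p : M) (U : Set (Metric.sphere (0 : TangentSpace 𝓘(ℝ, E) p) 1))
    (hU_open : IsOpen U) (hU_conn : IsConnected U)
    (m : ℕ) (lam : Fin m → Metric.sphere (0 : TangentSpace 𝓘(ℝ, E) p) 1 → ℝ)
    (hlam : IsEigenvalueSystem nabla nablaBar U lam) :
    (HasLinearJacobi nabla ↔
      (∀ k : Fin m, (∀ X ∈ U, ∀ Y ∈ U, lam k X = lam k Y) ∨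
        ∀ X ∈ U, jacobi20 nabla nablaBar lam X k k = 0 ∧ jacobi0 nabla nablaBar lam X k = 0) ∧
      (∀ k j : Fin m, k < j → (∀ X ∈ U, ∀ Y ∈ U, lam j X - lam k X = lam j Y - lam k Y) ∨
        ∀ X ∈ U, jacobi11 nabla nablaBar lam X k j = 0) ∧
      (∀ k j : Fin m, k < j → (∀ X ∈ U, ∀ Y ∈ U, lam k X + lam j X = lam k Y + lam j Y) ∨
        ∀ X ∈ U, jacobi20 nabla nablaBar lam X k j = 0)) ∧
    (HasLinearJacobi nabla →
      ∃ Q : Polynomial ℝ, IsMonicLcm (jacobiFactors nabla nablaBar U lam) Q ∧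
        IsLinearJacobi nabla (Polynomial.X * Q) ∧
        AlgebraicJacobi nabla nablaBar (Polynomial.X * Q) ∧
        ∀ P : Polynomial ℝ, IsLinearJacobi nabla P →
          P.natDegree < (Polynomial.X * Q).natDegree →
            P = Q ∧ AlgebraicJacobi nabla nablaBar Q) := by
  have hspec : IsContinuousSpectrum (fun X : Metric.sphere (0 : TangentSpace 𝓘(ℝ, E) p) 1 =>
      torsionMap nabla nablaBar p (X : TangentSpace 𝓘(ℝ, E) p)) U lam :=
    ⟨fun X hX => ⟨fun x y => hNR.torsionEnd_skew _ x y, hlam.pos X hX,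
      (hlam.strictMono X hX).injective, hlam.eigenvalues X hX⟩, hlam.continuousOn,
      ((contDiff_endCLM_linear (n := 0) (torsionMap nabla nablaBar p)).continuous.comp
        continuous_subtype_val).continuousOn⟩
  have hRc : ContinuousOn (fun X : Metric.sphere (0 : TangentSpace 𝓘(ℝ, E) p) 1 =>
      endCLM (TangentSpace 𝓘(ℝ, E) p) (nabla.jacobiOp (X : TangentSpace 𝓘(ℝ, E) p))) U :=
    ((contDiff_jacobiOp hLC.torsion_free p).continuous.comp continuous_subtype_val).continuousOn
  set A := fun X : Metric.sphere (0 : TangentSpace 𝓘(ℝ, E) p) 1 =>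
    torsionMap nabla nablaBar p (X : TangentSpace 𝓘(ℝ, E) p) with hA
  set R := fun X : Metric.sphere (0 : TangentSpace 𝓘(ℝ, E) p) 1 =>
    nabla.jacobiOp (X : TangentSpace 𝓘(ℝ, E) p) with hR
  have hfac : jacobiFactors nabla nablaBar U lam = componentFactors A R U lam := rfl
  have hPU : ∀ P : Polynomial ℝ, IsLinearJacobi nabla P → ∀ X ∈ U,
      Polynomial.aeval (halfCommutator (A X)) P (R X) = 0 := fun P hP X _ =>
    ((isLinearJacobi_iff hLC hNR P).1 hP).2.2 p X (norm_eq_of_mem_sphere X)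
  have hnec : ∀ P : Polynomial ℝ, IsLinearJacobi nabla P → HasConstantFrequencies A R U lam :=
    fun P hP => hasConstantFrequencies_of_aeval_eq_zero hspec hU_open hU_conn.isPreconnected
      hRc hP.monic.ne_zero (hPU P hP)
  have hsuff : HasConstantFrequencies A R U lam → ∃ Q : Polynomial ℝ,
      IsMonicLcm (jacobiFactors nabla nablaBar U lam) Q ∧ IsLinearJacobi nabla (Polynomial.X * Q) ∧
        AlgebraicJacobi nabla nablaBar (Polynomial.X * Q) := by
    intro hc
    obtain ⟨Q, hQ, ⟨q, rfl⟩, hQU⟩ := hc.exists_isMonicLcm hspec.spec hU_conn.nonempty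
    have hpar := hasParity_X_mul_expand hQ.1
    have halg : AlgebraicJacobi nabla nablaBar (Polynomial.X * Polynomial.expand ℝ 2 q) :=
      -- Two extensions: from U to the unit sphere at p by analyticity, then from p to M by parallel
      -- transport.
      algebraicJacobi_of_point hLC hNR (p := p) fun v hv =>
        aeval_eq_zero_of_isOpen (torsionMap nabla nablaBar p)
          (fun t v => jacobiOp_smul hLC.torsion_free t v) (contDiff_jacobiOp hLC.torsion_free p)
          hpar hU_open hU_conn.nonempty hQU hv
    exact ⟨_, hQ, (isLinearJacobi_iff hLC hNR _).2 ⟨Polynomial.monic_X.mul hQ.1, hpar, halg⟩, halg⟩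
  have hiff : HasLinearJacobi nabla ↔ HasConstantFrequencies A R U lam := by
    refine ⟨fun ⟨_, P, _, hP⟩ => hnec P hP, fun hc => ?_⟩
    obtain ⟨Q, hQ, hlin, -⟩ := hsuff hc
    exact ⟨Q.natDegree, _, Polynomial.natDegree_X_mul hQ.1.ne_zero, hlin⟩
  refine ⟨hiff.trans ⟨fun hc => ⟨fun k => ?_, fun k j hkj => ?_, fun k j hkj => ?_⟩,
    fun ⟨h1, h2, h3⟩ => ⟨fun k hne => ?_, fun k j hkj hne => ?_, fun k j hkj hne => ?_⟩⟩,
    fun hJ => ?_⟩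
  · by_cases h0 : ∃ Y ∈ U, zeroBlock (A Y) (R Y) (lam k Y) ≠ 0
    · exact Or.inl (hc.zero k h0)
    by_cases h20 : ∃ Y ∈ U, block20 (A Y) (R Y) (fun i => lam i Y) k k ≠ 0
    · refine Or.inl fun X hX Y hY => ?_
      -- The case k = j says that 2λ_k is constant; this is how condition 1 absorbs the diagonal
      -- components.
      have := hc.add k k le_rfl h20 X hX Y hY
      linarith
    · push Not at h0 h20
      exact Or.inr fun X hX => ⟨h20 X hX, h0 X hX⟩
  · by_cases h11 : ∃ Y ∈ U, block11 (A Y) (R Y) (fun i => lam i Y) k j ≠ 0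
    · refine Or.inl fun X hX Y hY => ?_
      have := hc.sub k j hkj h11 X hX Y hY
      linarith
    · push Not at h11
      exact Or.inr h11
  · by_cases h20 : ∃ Y ∈ U, block20 (A Y) (R Y) (fun i => lam i Y) k j ≠ 0
    · exact Or.inl (hc.add k j hkj.le h20)
    · push Not at h20
      exact Or.inr h20
  · obtain ⟨Y, hY, hne⟩ := hne
    exact (h1 k).resolve_right fun h => hne (h Y hY).2
  · obtain ⟨Y, hY, hne⟩ := hne
    intro X hX Z hZ
    have := (h2 k j hkj).resolve_right (fun h => hne (h Y hY)) X hX Z hZ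
    linarith
  · obtain ⟨Y, hY, hne⟩ := hne
    rcases hkj.eq_or_lt with rfl | hkj
    · intro X hX Z hZ
      rw [(h1 k).resolve_right (fun h => hne (h Y hY).1) X hX Z hZ]
    · exact (h3 k j hkj).resolve_right fun h => hne (h Y hY)
  · have hc := hiff.1 hJ
    obtain ⟨Q, hQ, hlin, halg⟩ := hsuff hc
    refine ⟨Q, hQ, hlin, halg, fun P hP hdeg => ?_⟩
    -- Q divides P, while the degree of P is at most that of Q; two such monic polynomials coincide.
    have hdvd : Q ∣ P := (hQ.2 P).2 fun f hf => hc.dvd_of_mem hspec.spec (hPU P hP) hf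
    rw [Polynomial.natDegree_X_mul hQ.1.ne_zero] at hdeg
    obtain rfl : P = Q := (Polynomial.eq_of_monic_of_dvd_of_natDegree_le hQ.1 hP.monic hdvd
      (by omega))
    exact ⟨rfl, ((isLinearJacobi_iff hLC hNR P).1 hP).2.2⟩
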